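/- Let $d\ge 1$, $\mu>0$, and let $U,W:\mathbb{R}^d\to\mathbb{R}$ be measurable. On $L^2(\mathbb{R}^d,\mathbb{C}^2)$ put $$\mathcal{H}_0=\begin{pmatrix}-\Delta+\mu&0\\0&\Delta-\mu\end{pmatrix},\qquad V=\begin{pmatrix}U&W\\-W&-U\end{pmatrix},\qquad \mathcal{H}=\mathcal{H}_0+V,$$ where $\mathcal{H}_0$ has domain $H^2(\mathbb{R}^d,\mathbb{C}^2)$ and $V$ is the maximal multiplication operator. A function $X:\mathbb{R}^d\to\mathbb{R}$ is called relatively Laplacian-compact if $Xg\in L^2(\mathbb{R}^d)$ for all $g\in H^2(\mathbb{R}^d)$ and, for every sequence $(g_n)$ in $H^2(\mathbb{R}^d)$ with $(g_n)$ and $(\Delta g_n)$ bounded in $L^2$, the sequence $(Xg_n)$ has a subsequence that converges in $L^2$. For a densely defined operator $T$ on a Hilbert space let $\rho(T)$ be the set of $z\in\mathbb{C}$ such that $T-z$ has an everywhere defined bounded inverse, and $\sigma(T)=\mathbb{C}\setminus\rho(T)$. A closed operator is semi-Fredholm if its range is closed and its kernel or the orthogonal complement of its range is finite-dimensional; it is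 Fredholm if its range is closed and both are finite-dimensional, and its index is then the difference of the two dimensions. Let $\Delta_1(T)=\{z: T-z \text{ semi-Fredholm}\}$, $\Delta_2(T)=\{z\in\Delta_1(T): \dim\ker(T-z)<\infty\}$, $\Delta_3(T)=\{z: T-z\text{ Fredholm}\}$, $\Delta_4(T)=\{z\in\Delta_3(T): \operatorname{ind}(T-z)=0\}$, $\Delta_5(T)=\{z\in\Delta_4(T): \text{a deleted neighbourhood of } z \text{ lies in }\rho(T)\}$, and $\sigma_{\mathrm{ess},j}(T)=\mathbb{C}\setminus\Delta_j(T)$. (a) Let $X:\mathbb{R}^d\to\mathbb{R}$ be measurable and $-\Delta$-bounded with relative bound zero (that is, $Xg\in L^2$ for all $g\in H^2(\mathbb{R}^d)$, and for every $\varepsilon>0$ there is $C_\varepsilon$ with $\|Xg\|_2\le\varepsilon\|\Delta g\|_2+C_\varepsilon\|g\|_2$ for all $g\in H^2(\mathbb{R}^d)$), and suppose that $X(x)\to0$ as $|x|\to\infty$ (outside a null set). Then $X$ is relatively Laplacian-compact. (b) Suppose that $U$ and $W$ are relatively Laplacian-compact. Then $$\sigma_{\mathrm{ess},j}(\mathcal{H})=\sigma(\mathcal{H}_0)=(-\infty,-\mu]\cup[\mu,\infty)\qquad(j=1,\dots,5).$$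 The set $\sigma(\mathcal{H})\setminus\big((-\infty,-\mu]\cup[\mu,\infty)\big)$ is discrete, with no accumulation point outside $(-\infty,-\mu]\cup[\mu,\infty)$, and each of its points is an eigenvalue of $\mathcal{H}$ of finite algebraic multiplicity: its Riesz projection has finite rank and its generalized eigenspace $\bigcup_k\ker(\mathcal{H}-z)^k$ is finite-dimensional. Moreover $\sigma(\mathcal{H})$ is symmetric under reflection in the real and in the imaginary axis; $\sigma(\mathcal{H})=-\sigma(\mathcal{H})$ and $\sigma(\mathcal{H}^*)=\sigma(\mathcal{H})$. -/

import Mathlib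

/-! ### Unbounded operators: spectrum, Fredholm properties, algebraic multiplicity -/

namespace UnboundedOp

open Filter Topology

noncomputable section

variable {H : Type*} [NormedAddCommGroup H] [InnerProductSpace ℂ H]

/-- The operator `T - z`, on the domain of `T`. -/
def shift (T : H →ₗ.[ℂ] H) (z : ℂ) : H →ₗ.[ℂ] H where
  domain := T.domain
  toFun := T.toFun - z • T.domain.subtype

/-- `B` is an everywhere defined bounded two-sided inverse of `T`. -/
def IsBoundedInverse (T : H →ₗ.[ℂ] H) (B : H →L[ℂ] H) : Prop :=
  (∀ x : H, ∃ h : B x ∈ T.domain, T ⟨B x, h⟩ = x) ∧ ∀ u : T.domain, B (T u) = u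

/-- The resolvent set: all `z` such that `T - z` is boundedly invertible. -/
def resolventSet (T : H →ₗ.[ℂ] H) : Set ℂ :=
  {z | ∃ B : H →L[ℂ] H, IsBoundedInverse (shift T z) B}

/-- The spectrum, the complement of the resolvent set. -/
def spectrum (T : H →ₗ.[ℂ] H) : Set ℂ := (resolventSet T)ᶜ

/-- The kernel of `T`. -/
def kernel (T : H →ₗ.[ℂ] H) : Submodule ℂ T.domain := LinearMap.ker T.toFun

/-- The range of `T`. -/
def range (T : H →ₗ.[ℂ] H) : Submodule ℂ H := LinearMap.range T.toFun

/-- A closed operator is semi-Fredholm if its range is closed and its kernel or its co-kernel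
(the orthogonal complement of the range) is finite-dimensional. -/
def IsSemiFredholm (T : H →ₗ.[ℂ] H) : Prop :=
  T.IsClosed ∧ IsClosed (range T : Set H) ∧
    (FiniteDimensional ℂ (kernel T) ∨ FiniteDimensional ℂ (range T)ᗮ)

/-- A closed operator is Fredholm if its range is closed and both its kernel and its co-kernel
are finite-dimensional. -/
def IsFredholm (T : H →ₗ.[ℂ] H) : Prop :=
  T.IsClosed ∧ IsClosed (range T : Set H) ∧
    FiniteDimensional ℂ (kernel T) ∧ FiniteDimensional ℂ (range T)ᗮ

/-- The index `dim ker T - dim (ran T)ᗮ`; only used for Fredholm operators. -/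
def index (T : H →ₗ.[ℂ] H) : ℤ :=
  (Module.finrank ℂ (kernel T) : ℤ) - (Module.finrank ℂ (range T)ᗮ : ℤ)

def Delta1 (T : H →ₗ.[ℂ] H) : Set ℂ := {z | IsSemiFredholm (shift T z)}

def Delta2 (T : H →ₗ.[ℂ] H) : Set ℂ :=
  {z | IsSemiFredholm (shift T z) ∧ FiniteDimensional ℂ (kernel (shift T z))}

def Delta3 (T : H →ₗ.[ℂ] H) : Set ℂ := {z | IsFredholm (shift T z)}

def Delta4 (T : H →ₗ.[ℂ] H) : Set ℂ := {z | IsFredholm (shift T z) ∧ index (shift T z) = 0}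

/-- The points of `Delta4 T` with a deleted neighbourhood contained in the resolvent set. -/
def Delta5 (T : H →ₗ.[ℂ] H) : Set ℂ := {z | z ∈ Delta4 T ∧ ∀ᶠ w in 𝓝[≠] z, w ∈ resolventSet T}

/-- The five essential spectra; the index `j : Fin 5` stands for the `(j + 1)`-st one. -/
def essentialSpectrum (T : H →ₗ.[ℂ] H) (j : Fin 5) : Set ℂ :=
  (![Delta1 T, Delta2 T, Delta3 T, Delta4 T, Delta5 T] j)ᶜ

/-- `z` is an eigenvalue of `T`. -/
def IsEigenvalue (T : H →ₗ.[ℂ] H) (z : ℂ) : Prop :=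
  ∃ u : T.domain, u ≠ 0 ∧ T u = z • (u : H)

/-- The kernel of `T ^ k`, where `D(T ^ (k + 1)) = {x ∈ D(T) | T x ∈ D(T ^ k)}`. -/
def kernelPow (T : H →ₗ.[ℂ] H) : ℕ → Submodule ℂ H
  | 0 => ⊥
  | k + 1 => ((kernelPow T k).comap T.toFun).map T.domain.subtype

/-- The generalized eigenspace `⋃ₖ ker (T - z) ^ k` (an increasing union). -/
def generalizedEigenspace (T : H →ₗ.[ℂ] H) (z : ℂ) : Submodule ℂ H :=
  ⨆ k, kernelPow (shift T z) k

open Classical in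
/-- The resolvent `(T - z)⁻¹` (zero if `z` is not in the resolvent set). -/
def resolvent (T : H →ₗ.[ℂ] H) (z : ℂ) : H →L[ℂ] H :=
  if h : z ∈ resolventSet T then h.choose else 0

/-- The Riesz projection `-(2πi)⁻¹ ∮ (T - w)⁻¹ dw` over the circle of radius `r` around `z`. -/
def rieszProjection (T : H →ₗ.[ℂ] H) (z : ℂ) (r : ℝ) : H →L[ℂ] H :=
  (-(2 * (Real.pi : ℂ) * Complex.I)⁻¹) • ∮ w in C(z, r), resolvent T w

/-- Finite algebraic multiplicity of an isolated point `z` of the spectrum: the Riesz projection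
at `z` has finite rank. Finite-dimensionality of the generalized eigenspace, which is the other
usual meaning of the term, is required as well. -/
def HasFiniteAlgebraicMultiplicity (T : H →ₗ.[ℂ] H) (z : ℂ) : Prop :=
  (∃ r : ℝ, 0 < r ∧ Metric.closedBall z r \ {z} ⊆ resolventSet T ∧
      FiniteDimensional ℂ (LinearMap.range (rieszProjection T z r).toLinearMap)) ∧
    FiniteDimensional ℂ (generalizedEigenspace T z)

/-- `A` is `T`-bounded with relative bound zero. -/
def IsRelativelyBoundedZero (A T : H →ₗ.[ℂ] H) : Prop :=
  ∃ h : T.domain ≤ A.domain, ∀ ε : ℝ, 0 < ε → ∃ C : ℝ, ∀ u : T.domain,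
    ‖A (Submodule.inclusion h u)‖ ≤ ε * ‖T u‖ + C * ‖(u : H)‖

/-- `A` is `T`-compact: `D(T) ⊆ D(A)`, and if `uₙ` and `T uₙ` are bounded sequences, then `A uₙ`
has a convergent subsequence. -/
def IsRelativelyCompact (A T : H →ₗ.[ℂ] H) : Prop :=
  ∃ h : T.domain ≤ A.domain, ∀ u : ℕ → T.domain,
    (∃ C : ℝ, ∀ n, ‖(u n : H)‖ ≤ C ∧ ‖T (u n)‖ ≤ C) →
    ∃ (y : H) (φ : ℕ → ℕ), StrictMono φ ∧
      Tendsto (fun n => A (Submodule.inclusion h (u (φ n)))) atTop (𝓝 y)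

end

end UnboundedOp

/-! ### The matrix Schrödinger operator -/

namespace MatrixSchrodinger

open MeasureTheory Filter Topology TemperedDistribution
open scoped SchwartzMap Laplacian ENNReal

noncomputable section

/-- `ℝ^d` with its Euclidean structure. -/
abbrev Space (d : ℕ) : Type := EuclideanSpace ℝ (Fin d)

/-- `L²(ℝ^d, F)`. -/
abbrev L2 (d : ℕ) (F : Type*) [NormedAddCommGroup F] : Type _ :=
  Lp F 2 (volume : Measure (Space d))

/-- `ℂ²` with its Hermitian structure. -/
abbrev C2 : Type := EuclideanSpace ℂ (Fin 2)

section

variable (d : ℕ) (F : Type*) [NormedAddCommGroup F] [InnerProductSpace ℂ F] [CompleteSpace F]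

/-- The embedding of `L²` into the tempered distributions. -/
def toDistr : L2 d F →L[ℂ] 𝓢'(Space d, F) := Lp.toTemperedDistributionCLM F volume 2

theorem toDistr_injective : Function.Injective (toDistr d F) :=
  LinearMap.ker_eq_bot.mp (Lp.ker_toTemperedDistributionCLM_eq_bot (F := F) (p := 2)
    (μ := (volume : Measure (Space d))))

/-- The Sobolev space `H²(ℝ^d, F)` as a subspace of `L²(ℝ^d, F)`. -/
def sobolevH2 : Submodule ℂ (L2 d F) where
  carrier := {f | MemSobolev 2 2 (toDistr d F f)}
  add_mem' hf hg := by
    simp only [Set.mem_ofPred_eq, map_add]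
    exact MemSobolev.add hf hg
  zero_mem' := by
    simp only [Set.mem_ofPred_eq, map_zero]
    exact memSobolev_fun_zero _ _ _ _
  smul_mem' c f hf := by
    simp only [Set.mem_ofPred_eq, map_smul]
    exact MemSobolev.smul c hf

theorem exists_laplacian (f : sobolevH2 d F) :
    ∃ g : L2 d F, toDistr d F g = Δ (toDistr d F (f : L2 d F)) := by
  have h : MemSobolev (2 - 2) 2 (Δ (toDistr d F (f : L2 d F))) := MemSobolev.laplacian f.2
  rw [sub_self, memSobolev_zero_iff] at h
  obtain ⟨g, hg⟩ := h
  exact ⟨g, hg.symm⟩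

/-- The Laplacian `Δ` on `L²(ℝ^d, F)` with domain `H²(ℝ^d, F)`: the function `Δ f` is the element
of `L²` that represents the distributional Laplacian of `f`. -/
def laplacian : L2 d F →ₗ.[ℂ] L2 d F where
  domain := sobolevH2 d F
  toFun :=
    { toFun := fun f => (exists_laplacian d F f).choose
      map_add' := fun f g => by
        apply toDistr_injective d F
        rw [map_add, (exists_laplacian d F (f + g)).choose_spec,
          (exists_laplacian d F f).choose_spec, (exists_laplacian d F g).choose_spec]
        simp only [Submodule.coe_add, map_add, ← TemperedDistribution.laplacianCLM_apply]
      map_smul' := fun c f => by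
        apply toDistr_injective d F
        rw [map_smul, (exists_laplacian d F (c • f)).choose_spec,
          (exists_laplacian d F f).choose_spec]
        simp only [Submodule.coe_smul, map_smul, RingHom.id_apply, ← TemperedDistribution.laplacianCLM_apply] }

end

section

variable {d : ℕ} {F : Type*} [NormedAddCommGroup F] [InnerProductSpace ℂ F]

theorem multiplication_add (A : Space d → F →L[ℂ] F) (f g : L2 d F) :
    (fun x => A x (f x)) + (fun x => A x (g x)) =ᵐ[volume] fun x => A x ((f + g : L2 d F) x) := by
  filter_upwards [Lp.coeFn_add f g] with x hx
  rw [hx, Pi.add_apply, Pi.add_apply, map_add]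

theorem multiplication_smul (A : Space d → F →L[ℂ] F) (c : ℂ) (f : L2 d F) :
    c • (fun x => A x (f x)) =ᵐ[volume] fun x => A x ((c • f : L2 d F) x) := by
  filter_upwards [Lp.coeFn_smul c f] with x hx
  rw [hx, Pi.smul_apply, Pi.smul_apply, map_smul]

theorem multiplication_zero (A : Space d → F →L[ℂ] F) :
    (0 : Space d → F) =ᵐ[volume] fun x => A x ((0 : L2 d F) x) := by
  filter_upwards [Lp.coeFn_zero F 2 (volume : Measure (Space d))] with x hx
  rw [hx, Pi.zero_apply, map_zero]

/-- The natural domain `{f ∈ L² | A f ∈ L²}` of multiplication by `A`. -/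
def multiplicationDomain (A : Space d → F →L[ℂ] F) : Submodule ℂ (L2 d F) where
  carrier := {f | MemLp (fun x => A x (f x)) 2 (volume : Measure (Space d))}
  add_mem' {f g} hf hg := (MemLp.add hf hg).ae_eq (multiplication_add A f g)
  zero_mem' := MemLp.ae_eq (multiplication_zero A) MemLp.zero'
  smul_mem' c f hf := (MemLp.const_smul hf c).ae_eq (multiplication_smul A c f)

theorem mem_multiplicationDomain (A : Space d → F →L[ℂ] F) (f : multiplicationDomain A) :
    MemLp (fun x => A x ((f : L2 d F) x)) 2 (volume : Measure (Space d)) := f.2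

theorem multiplication_map_smul (A : Space d → F →L[ℂ] F) (c : ℂ) (f : multiplicationDomain A) :
    (mem_multiplicationDomain A (c • f)).toLp = c • (mem_multiplicationDomain A f).toLp := by
  rw [← MemLp.toLp_const_smul]
  exact MemLp.toLp_congr _ _ (multiplication_smul A c (f : L2 d F)).symm

theorem multiplication_map_add (A : Space d → F →L[ℂ] F) (f g : multiplicationDomain A) :
    (mem_multiplicationDomain A (f + g)).toLp =
      (mem_multiplicationDomain A f).toLp + (mem_multiplicationDomain A g).toLp := by
  rw [← MemLp.toLp_add]
  exact MemLp.toLp_congr _ _ (multiplication_add A (f : L2 d F) (g : L2 d F)).symm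

/-- The maximal operator of multiplication by an operator-valued function `A`. -/
def multiplication (A : Space d → F →L[ℂ] F) : L2 d F →ₗ.[ℂ] L2 d F where
  domain := multiplicationDomain A
  toFun :=
    { toFun := fun f => (mem_multiplicationDomain A f).toLp
      map_add' := multiplication_map_add A
      map_smul' := multiplication_map_smul A }

end

/-- Multiplication by the real-valued function `X` on `L²(ℝ^d, ℂ)`. -/
def scalarMultiplication {d : ℕ} (X : Space d → ℝ) : L2 d ℂ →ₗ.[ℂ] L2 d ℂ :=
  multiplication fun x => (X x : ℂ) • ContinuousLinearMap.id ℂ ℂ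

/-- `X` is Laplacian-bounded with relative bound zero. -/
def LaplacianBoundedZero {d : ℕ} (X : Space d → ℝ) : Prop :=
  UnboundedOp.IsRelativelyBoundedZero (scalarMultiplication X) (-laplacian d ℂ)

/-- `X` is relatively Laplacian-compact. -/
def LaplacianCompact {d : ℕ} (X : Space d → ℝ) : Prop :=
  UnboundedOp.IsRelativelyCompact (scalarMultiplication X) (-laplacian d ℂ)

/-- `X` tends to zero at infinity, up to a null set. -/
def DecaysAtInfinity {d : ℕ} (X : Space d → ℝ) : Prop :=
  Tendsto X (cocompact (Space d) ⊓ ae volume) (𝓝 0)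

/-- A `2 × 2` matrix as an operator on `ℂ²`. -/
def matrixCLM (M : Matrix (Fin 2) (Fin 2) ℂ) : C2 →L[ℂ] C2 :=
  Matrix.toEuclideanCLM (n := Fin 2) (𝕜 := ℂ) M

/-- The free operator `diag(-Δ + μ, Δ - μ) = diag(1, -1) (-Δ + μ)` on `H²(ℝ^d, ℂ²)`. -/
def freeOp (d : ℕ) (μ : ℝ) : L2 d C2 →ₗ.[ℂ] L2 d C2 where
  domain := (laplacian d C2).domain
  toFun := ((matrixCLM !![1, 0; 0, -1]).compLpL 2 (volume : Measure (Space d))).toLinearMap ∘ₗ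
    (-(laplacian d C2).toFun + (μ : ℂ) • (laplacian d C2).domain.subtype)

/-- Multiplication by the matrix potential with rows `(U, W)` and `(-W, -U)`. -/
def potential {d : ℕ} (U W : Space d → ℝ) : L2 d C2 →ₗ.[ℂ] L2 d C2 :=
  multiplication fun x => matrixCLM !![(U x : ℂ), (W x : ℂ); -(W x : ℂ), -(U x : ℂ)]

/-- The operator with rows `(-Δ + μ + U, W)` and `(-W, Δ - μ - U)`. Its domain is
`H²(ℝ^d, ℂ²)` if that space lies in the domain of the potential. -/
def fullOp {d : ℕ} (μ : ℝ) (U W : Space d → ℝ) : L2 d C2 →ₗ.[ℂ] L2 d C2 :=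
  freeOp d μ + potential U W

/-- The set `(-∞, -μ] ∪ [μ, ∞)` in the complex plane. -/
def gapComplement (μ : ℝ) : Set ℂ := Complex.ofReal '' (Set.Iic (-μ) ∪ Set.Ici μ)

end

end MatrixSchrodinger

/-!
Write `T = ℋ₀`, `R = (T - z₀)⁻¹` for a point `z₀` of the resolvent set of `T`, and
`T + V - z = (1 + V R - (z - z₀) R) (T - z₀)` on the domain. If `V` is relatively compact, `V R` is
compact, so `1 + V R` is an invertible operator plus one of finite rank: its index is zero, and near
`z₀` the resolvent of `T + V` is a Woodbury formula divided by an analytic determinant (analytic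
Fredholm theorem). A resolvent-set point of `T` is thus a resolvent-set point of `T + V`, or an
isolated eigenvalue of finite algebraic multiplicity, or interior to the spectrum of `T + V`; the
last is impossible, since the resolvent set of `T` is connected and, `T` being symmetric, contains
points `i y` which for large `y` are not eigenvalues of `T + V`. Conversely, relatively compact
perturbations do not destroy singular sequences. For `ℋ₀` such sequences are obtained by localizing
the Fourier transform in disjoint thin shells, which gives all of `σ(ℋ₀)`.

Conjugation with the Pauli matrix `σ₃` carries `ℋ` into `ℋ*`, conjugation with `σ₁` carries it into
`-ℋ`; together they yield the symmetries of the spectrum.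

For the compactness criterion, take a weakly null sequence bounded in `H²`. Its high frequencies are
small in `L²`, hence negligible after multiplication by `X`. Its low frequencies are bounded and
tend to zero pointwise, so that the decay of `X` and dominated convergence apply.
-/

namespace UnboundedOp

open Filter Topology
open scoped InnerProductSpace ComplexConjugate Pointwise

noncomputable section

/-! ### Resolvents and factorizations -/

section Resolvent

variable {H : Type*} [NormedAddCommGroup H] [InnerProductSpace ℂ H] {T : H →ₗ.[ℂ] H} {z : ℂ}

theorem IsBoundedInverse.unique {B B' : H →L[ℂ] H} (h : IsBoundedInverse T B)
    (h' : IsBoundedInverse T B') : B = B' := by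
  ext x
  obtain ⟨hx, hTx⟩ := h.1 x
  have := h'.2 ⟨B x, hx⟩
  rwa [hTx, eq_comm] at this

theorem isBoundedInverse_resolvent (hz : z ∈ resolventSet T) :
    IsBoundedInverse (shift T z) (resolvent T z) := by
  rw [resolvent, dif_pos hz]
  exact hz.choose_spec

theorem IsBoundedInverse.resolvent_eq {B : H →L[ℂ] H} (h : IsBoundedInverse (shift T z) B) :
    resolvent T z = B :=
  (isBoundedInverse_resolvent ⟨B, h⟩).unique h

theorem resolvent_mem_domain (hz : z ∈ resolventSet T) (x : H) : resolvent T z x ∈ T.domain :=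
  ((isBoundedInverse_resolvent hz).1 x).1

theorem apply_resolvent (hz : z ∈ resolventSet T) (x : H) :
    T ⟨resolvent T z x, resolvent_mem_domain hz x⟩ = x + z • resolvent T z x :=
  sub_eq_iff_eq_add.1 ((isBoundedInverse_resolvent hz).1 x).2

theorem resolvent_apply_sub (hz : z ∈ resolventSet T) (u : T.domain) :
    resolvent T z (T u - z • (u : H)) = u :=
  (isBoundedInverse_resolvent hz).2 u

theorem IsEigenvalue.notMem_resolventSet (h : IsEigenvalue T z) : z ∉ resolventSet T := by
  intro hz
  obtain ⟨u, hu, hTu⟩ := h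
  have := resolvent_apply_sub hz u
  rw [hTu, sub_self, map_zero] at this
  exact hu (Subtype.ext this.symm)

theorem isClosed_shift_of_mem_resolventSet {w : ℂ} (hw : w ∈ resolventSet T) (z : ℂ) :
    (shift T z).IsClosed := by
  have graph_eq : ((shift T z).graph : Set (H × H)) =
      {p | p.1 = resolvent T w (p.2 + (z - w) • p.1)} := by
    ext ⟨u, v⟩
    simp only [SetLike.mem_coe, LinearPMap.mem_graph_iff, Set.mem_ofPred_eq]
    constructor
    · rintro ⟨y, rfl, rfl⟩
      have hshift : T y - z • (y : H) + (z - w) • (y : H) = T y - w • (y : H) := by module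
      exact (resolvent_apply_sub hw y).symm.trans (congrArg _ hshift.symm)
    · intro h
      refine ⟨⟨_, resolvent_mem_domain hw (v + (z - w) • u)⟩, h.symm, ?_⟩
      refine (congrArg (· - z • resolvent T w (v + (z - w) • u)) (apply_resolvent hw _)).trans ?_
      simp only [← h]
      module
  rw [LinearPMap.IsClosed, graph_eq]
  exact isClosed_eq continuous_fst (by fun_prop)

/-- The bounded operator `R` parametrizes the domain of `T`, and `S` is the bounded operator
`(T - z) R`. The spectral properties of `T` at `z` can be read off from `S`. -/
structure Factorization (T : H →ₗ.[ℂ] H) (z : ℂ) (R S : H →L[ℂ] H) : Prop where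
  injective : Function.Injective R
  domain_eq : T.domain = R.range
  apply_eq : ∀ (x : H) (h : R x ∈ T.domain), T ⟨R x, h⟩ - z • R x = S x

theorem factorization_resolvent (hz : z ∈ resolventSet T) :
    Factorization T z (resolvent T z) 1 where
  injective := by
    rw [injective_iff_map_eq_zero]
    intro x hx
    have hzero : (⟨resolvent T z x, resolvent_mem_domain hz x⟩ : T.domain) = 0 := Subtype.ext hx
    have := apply_resolvent hz x
    rwa [hzero, LinearPMap.map_zero, hx, smul_zero, add_zero, eq_comm] at this
  domain_eq := by
    ext u
    exact ⟨fun hu => ⟨_, resolvent_apply_sub hz ⟨u, hu⟩⟩,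
      fun ⟨x, hx⟩ => hx ▸ resolvent_mem_domain hz x⟩
  apply_eq x _ := ((isBoundedInverse_resolvent hz).1 x).2

namespace Factorization

variable {R S : H →L[ℂ] H}

theorem mem_domain (h : Factorization T z R S) (x : H) : R x ∈ T.domain :=
  h.domain_eq ▸ ⟨x, rfl⟩

theorem exists_eq (h : Factorization T z R S) (u : T.domain) : ∃ x, u = ⟨R x, h.mem_domain x⟩ := by
  obtain ⟨x, hx⟩ : (u : H) ∈ R.range := h.domain_eq ▸ u.2
  exact ⟨x, Subtype.ext hx.symm⟩

theorem shift_apply_eq (h : Factorization T z R S) (x : H) :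
    shift T z ⟨R x, h.mem_domain x⟩ = S x := h.apply_eq x _

theorem translate (h : Factorization T z R S) (w : ℂ) : Factorization T w R (S - (w - z) • R) where
  injective := h.injective
  domain_eq := h.domain_eq
  apply_eq x hx := by
    simp only [sub_apply, smul_apply, ← h.apply_eq x hx]
    module

theorem range_eq (h : Factorization T z R S) : range (shift T z) = S.range := by
  ext y
  constructor
  · rintro ⟨u, rfl⟩
    obtain ⟨x, rfl⟩ := h.exists_eq u
    exact ⟨x, (h.shift_apply_eq x).symm⟩
  · rintro ⟨x, rfl⟩
    exact ⟨⟨R x, h.mem_domain x⟩, h.shift_apply_eq x⟩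

/-- The isomorphism from the kernel of `S` to the kernel of `T - z` induced by `R`. -/
def kernelEquiv (h : Factorization T z R S) : S.ker ≃ₗ[ℂ] kernel (shift T z) :=
  LinearEquiv.ofBijective
    { toFun := fun x : S.ker =>
        (⟨⟨R x, h.mem_domain x⟩, (h.shift_apply_eq x).trans x.2⟩ : kernel (shift T z))
      map_add' x y := Subtype.ext (Subtype.ext (map_add R _ _))
      map_smul' c x := Subtype.ext (Subtype.ext (map_smul R c _)) }
    ⟨fun x y hxy =>
      Subtype.ext (h.injective (congrArg (fun v : kernel (shift T z) => (v.1.1 : H)) hxy)), by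
      rintro ⟨u, hu⟩
      obtain ⟨x, rfl⟩ := h.exists_eq u
      exact ⟨⟨x, (h.shift_apply_eq x).symm.trans hu⟩, rfl⟩⟩

theorem isEigenvalue (h : Factorization T z R S) {x : H} (hx : x ≠ 0) (hSx : S x = 0) :
    IsEigenvalue T z := by
  refine ⟨⟨R x, h.mem_domain x⟩, fun h0 => hx (h.injective ?_), ?_⟩
  · rw [map_zero]
    exact congrArg Subtype.val h0
  · have := h.apply_eq x (h.mem_domain x)
    rwa [hSx, sub_eq_zero] at this

theorem isBoundedInverse (h : Factorization T z R S) {B : H →L[ℂ] H} (hSB : S * B = 1)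
    (hBS : B * S = 1) : IsBoundedInverse (shift T z) (R * B) := by
  refine ⟨fun x => ⟨h.mem_domain (B x), ?_⟩, fun u => ?_⟩
  · exact (h.shift_apply_eq (B x)).trans (DFunLike.congr_fun hSB x)
  · obtain ⟨x, rfl⟩ := h.exists_eq u
    exact (congrArg (R * B) (h.shift_apply_eq x)).trans (congrArg R (DFunLike.congr_fun hBS x))

end Factorization

theorem eventually_isUnit_sub_smul [CompleteSpace H] {A R : H →L[ℂ] H} (hA : IsUnit A) (z : ℂ) :
    ∀ᶠ w in 𝓝 z, IsUnit (A - (w - z) • R) := by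
  have hcont : Continuous fun w : ℂ => A - (w - z) • R := by fun_prop
  refine hcont.continuousAt.eventually_mem (Units.isOpen.mem_nhds ?_)
  simpa using hA

theorem analyticAt_resolvent [CompleteSpace H] (hz : z ∈ resolventSet T) :
    AnalyticAt ℂ (resolvent T) z := by
  have hunit := eventually_isUnit_sub_smul (R := resolvent T z) isUnit_one z
  have hdiff : ∀ᶠ w in 𝓝 z, DifferentiableAt ℂ
      (fun w => resolvent T z * Ring.inverse (1 - (w - z) • resolvent T z)) w := by
    filter_upwards [hunit] with w hw
    exact (differentiableAt_const _).mul (DifferentiableAt.inverse (by fun_prop) hw)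
  refine (Complex.analyticAt_iff_eventually_differentiableAt.2 hdiff).congr ?_
  filter_upwards [hunit] with w hw
  exact (((factorization_resolvent hz).translate w).isBoundedInverse
    (Ring.mul_inverse_cancel _ hw) (Ring.inverse_mul_cancel _ hw)).resolvent_eq.symm

end Resolvent

/-! ### Finite-rank perturbations of invertible operators -/

section KernelOfPerturbation

variable {𝕜 V W K : Type*} [Ring 𝕜] [AddCommGroup V] [Module 𝕜 V] [AddCommGroup W] [Module 𝕜 W]
  [AddCommGroup K] [Module 𝕜 K]

/-- The kernel of `A + E C`, for an invertible `A`, is isomorphic to the kernel of `1 + C A⁻¹ E`,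
an operator on the (usually much smaller) space through which the perturbation factors. The
isomorphism is `C`, its inverse is `-A⁻¹ E`. -/
def kerAddCompEquiv (A : V ≃ₗ[𝕜] W) (E : K →ₗ[𝕜] W) (C : V →ₗ[𝕜] K) :
    (A.toLinearMap + E ∘ₗ C).ker ≃ₗ[𝕜] (LinearMap.id + C ∘ₗ A.symm.toLinearMap ∘ₗ E).ker :=
  have symm_apply {x : V} (hx : A x + E (C x) = 0) : A.symm (E (C x)) = -x := by
    rw [A.symm_apply_eq, map_neg, eq_neg_iff_add_eq_zero, add_comm, hx]
  have comp_apply {c : K} (hc : c + C (A.symm (E c)) = 0) : C (-A.symm (E c)) = c := by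
    rw [map_neg, neg_eq_iff_add_eq_zero, add_comm, hc]
  LinearEquiv.ofLinearMap
    (C.restrict fun x hx => by
      simpa using congrArg C (symm_apply hx) ▸ add_eq_zero_iff_eq_neg.2 (by simp))
    ((-(A.symm.toLinearMap ∘ₗ E)).restrict fun c hc => by
      change A (-A.symm (E c)) + E (C (-A.symm (E c))) = 0
      rw [comp_apply (c := c) hc, map_neg, A.apply_symm_apply, neg_add_cancel])
    (LinearMap.ext fun c => Subtype.ext (comp_apply c.2))
    (LinearMap.ext fun x => Subtype.ext (neg_eq_iff_eq_neg.2 (symm_apply x.2)))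

end KernelOfPerturbation

section Adjugate

variable {𝕜 : Type*} [NontriviallyNormedField 𝕜]

theorem differentiable_matrix_det {ι V : Type*} [Fintype ι] [DecidableEq ι] [NormedAddCommGroup V]
    [NormedSpace 𝕜 V] {M : V → Matrix ι ι 𝕜} (hM : ∀ i j, Differentiable 𝕜 fun v => M v i j) :
    Differentiable 𝕜 fun v => (M v).det := by
  simp only [Matrix.det_apply]
  fun_prop

variable [CompleteSpace 𝕜] {K : Type*} [NormedAddCommGroup K] [NormedSpace 𝕜 K]
  [FiniteDimensional 𝕜 K]

theorem differentiable_toMatrix_apply {ι : Type*} [Fintype ι] [DecidableEq ι]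
    (b : Module.Basis ι 𝕜 K) (i j : ι) :
    Differentiable 𝕜 fun F : K →L[𝕜] K => LinearMap.toMatrix b b F.toLinearMap i j := by
  have apply_eq (F : K →L[𝕜] K) :
      LinearMap.toMatrix b b F.toLinearMap i j = (b.coord i).toContinuousLinearMap (F (b j)) := by
    simp [LinearMap.toMatrix_apply]
  simp only [apply_eq]
  fun_prop

theorem differentiable_det : Differentiable 𝕜 fun F : K →L[𝕜] K => F.det := by
  let b := Module.finBasis 𝕜 K
  have det_eq (F : K →L[𝕜] K) : F.det = (LinearMap.toMatrix b b F.toLinearMap).det :=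
    (LinearMap.det_toMatrix b _).symm
  simp only [det_eq]
  exact differentiable_matrix_det (differentiable_toMatrix_apply b)

/-- The adjugate of an endomorphism of a finite-dimensional space, computed in a basis. -/
def adjugate (F : K →L[𝕜] K) : K →L[𝕜] K :=
  let b := Module.finBasis 𝕜 K
  (Matrix.toLin b b (LinearMap.toMatrix b b F.toLinearMap).adjugate).toContinuousLinearMap

theorem apply_adjugate_apply (F : K →L[𝕜] K) (x : K) : F (adjugate F x) = F.det • x := by
  let b := Module.finBasis 𝕜 K
  have hF : F.toLinearMap = Matrix.toLin b b (LinearMap.toMatrix b b F.toLinearMap) :=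
    (Matrix.toLin_toMatrix b b _).symm
  change F.toLinearMap (Matrix.toLin b b (LinearMap.toMatrix b b F.toLinearMap).adjugate x) = _
  conv_lhs => enter [1]; rw [hF]
  rw [← Matrix.toLin_mul_apply b b b, Matrix.mul_adjugate, LinearMap.det_toMatrix, map_smul,
    Matrix.toLin_one]
  rfl

theorem adjugate_apply_apply (F : K →L[𝕜] K) (x : K) : adjugate F (F x) = F.det • x := by
  let b := Module.finBasis 𝕜 K
  have hF : F.toLinearMap = Matrix.toLin b b (LinearMap.toMatrix b b F.toLinearMap) :=
    (Matrix.toLin_toMatrix b b _).symm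
  change Matrix.toLin b b (LinearMap.toMatrix b b F.toLinearMap).adjugate (F.toLinearMap x) = _
  conv_lhs => enter [2, 1]; rw [hF]
  rw [← Matrix.toLin_mul_apply b b b, Matrix.adjugate_mul, LinearMap.det_toMatrix, map_smul,
    Matrix.toLin_one]
  rfl

theorem differentiable_adjugate : Differentiable 𝕜 (adjugate : (K →L[𝕜] K) → K →L[𝕜] K) := by
  let b := Module.finBasis 𝕜 K
  let M (F : K →L[𝕜] K) := LinearMap.toMatrix b b F.toLinearMap
  have adjugate_eq (F : K →L[𝕜] K) : adjugate F = ∑ i, ∑ j, (M F).adjugate i j •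
      (Matrix.toLin b b (Matrix.single i j 1)).toContinuousLinearMap := by
    simp only [← map_smul, ← map_sum, Matrix.smul_single, smul_eq_mul, mul_one,
      ← Matrix.matrix_eq_sum_single]
    rfl
  have entry_differentiable (i j) : Differentiable 𝕜 fun F => (M F).adjugate i j := by
    simp only [Matrix.adjugate_apply]
    refine differentiable_matrix_det fun k l => ?_
    by_cases hk : k = j
    · simp [hk]
    · simpa only [Matrix.updateRow_ne hk] using differentiable_toMatrix_apply b k l
  simp only [funext adjugate_eq]
  fun_prop

variable {H : Type*} [NormedAddCommGroup H] [NormedSpace 𝕜 H]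

/-- The multiple `det (1 + C A⁻¹ E) • (A + E C)⁻¹` of the inverse of a finite-rank perturbation,
written in terms of `B = A⁻¹` by the Woodbury formula so that it also makes sense when the
determinant vanishes. -/
def cofactorOp (E : K →L[𝕜] H) (C : H →L[𝕜] K) (B : H →L[𝕜] H) : H →L[𝕜] H :=
  (1 + C ∘L B ∘L E).det • B - B ∘L E ∘L adjugate (1 + C ∘L B ∘L E) ∘L C ∘L B

theorem mul_cofactorOp (E : K →L[𝕜] H) (C : H →L[𝕜] K) {A B : H →L[𝕜] H} (hAB : A * B = 1) :
    (A + E ∘L C) * cofactorOp E C B = (1 + C ∘L B ∘L E).det • 1 := by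
  ext x
  set F : K →L[𝕜] K := 1 + C ∘L B ∘L E
  set y := adjugate F (C (B x))
  have apply_inv (v : H) : A (B v) = v := DFunLike.congr_fun hAB v
  have hy : y + C (B (E y)) = F.det • C (B x) := apply_adjugate_apply F (C (B x))
  change A (F.det • B x - B (E y)) + E (C (F.det • B x - B (E y))) = F.det • x
  simp only [map_sub, map_smul, apply_inv]
  rw [← map_smul E, ← hy, map_add]
  abel

theorem cofactorOp_mul (E : K →L[𝕜] H) (C : H →L[𝕜] K) {A B : H →L[𝕜] H} (hBA : B * A = 1) :
    cofactorOp E C B * (A + E ∘L C) = (1 + C ∘L B ∘L E).det • 1 := by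
  ext x
  set F : K →L[𝕜] K := 1 + C ∘L B ∘L E
  have inv_apply (v : H) : B (A v) = v := DFunLike.congr_fun hBA v
  have hx : C x + C (B (E (C x))) = F (C x) := rfl
  change F.det • B (A x + E (C x)) - B (E (adjugate F (C (B (A x + E (C x)))))) = F.det • x
  simp only [map_add, inv_apply, hx]
  rw [adjugate_apply_apply, map_smul, map_smul, ← smul_sub, add_sub_cancel_right]

theorem differentiable_cofactorOp (E : K →L[𝕜] H) (C : H →L[𝕜] K) :
    Differentiable 𝕜 (cofactorOp E C) := by
  have hF : Differentiable 𝕜 fun B : H →L[𝕜] H => 1 + C ∘L B ∘L E := by fun_prop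
  have hdet := differentiable_det.comp hF
  have hadj := differentiable_adjugate.comp hF
  unfold cofactorOp
  exact (hdet.smul differentiable_id).sub (by fun_prop)

end Adjugate

section FiniteRank

open scoped InnerProduct

variable {H K : Type*} [NormedAddCommGroup H] [InnerProductSpace ℂ H] [NormedAddCommGroup K]
  [InnerProductSpace ℂ K] [FiniteDimensional ℂ K]

section

variable (A : (H →L[ℂ] H)ˣ) (E : K →L[ℂ] H) (C : H →L[ℂ] K)

/-- `kerAddCompEquiv` for bounded operators. -/
def kerAddCompEquivOfUnit :
    (↑A + E ∘L C).ker ≃ₗ[ℂ] (1 + C ∘L (↑A⁻¹ : H →L[ℂ] H) ∘L E).ker :=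
  kerAddCompEquiv (ContinuousLinearEquiv.ofUnit A).toLinearEquiv E.toLinearMap C.toLinearMap

theorem finiteDimensional_ker_add_comp : FiniteDimensional ℂ (↑A + E ∘L C).ker :=
  (kerAddCompEquivOfUnit A E C).symm.finiteDimensional

theorem isClosed_range_add_comp : IsClosed ((↑A + E ∘L C).range : Set H) := by
  let G : H →L[ℂ] K := C ∘L (↑A⁻¹ : H →L[ℂ] H)
  have : FiniteDimensional ℂ (H ⧸ G.ker) :=
    G.toLinearMap.quotKerEquivRange.symm.finiteDimensional
  refine Submodule.isClosed_mono_of_finiteDimensional_quotient G.isClosed_ker fun x hx => ?_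
  refine ⟨(↑A⁻¹ : H →L[ℂ] H) x, ?_⟩
  have hGx : C ((↑A⁻¹ : H →L[ℂ] H) x) = 0 := hx
  have hAx : (A : H →L[ℂ] H) ((↑A⁻¹ : H →L[ℂ] H) x) = x := DFunLike.congr_fun A.mul_inv x
  change (A : H →L[ℂ] H) _ + E (C _) = x
  rw [hGx, map_zero, add_zero, hAx]

theorem finrank_ker_adjoint (F : K →L[ℂ] K) :
    haveI := FiniteDimensional.complete ℂ K
    Module.finrank ℂ (F†).ker = Module.finrank ℂ F.ker := by
  have := FiniteDimensional.complete ℂ K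
  rw [← F.orthogonal_range]
  have hrank := F.toLinearMap.finrank_range_add_finrank_ker
  have horth := F.range.finrank_add_finrank_orthogonal
  omega

/-- The adjoint of `A + E C` has the same form, and its kernel is that of the adjoint of
`1 + C A⁻¹ E`. -/
def orthogonalRangeAddCompEquiv [CompleteSpace H] :
    haveI := FiniteDimensional.complete ℂ K
    ((↑A + E ∘L C).range)ᗮ ≃ₗ[ℂ] ((1 + C ∘L (↑A⁻¹ : H →L[ℂ] H) ∘L E)†).ker :=
  haveI := FiniteDimensional.complete ℂ K
  have adjoint_add_comp : (↑(star A) : H →L[ℂ] H) + (C†) ∘L (E†) = ((A : H →L[ℂ] H) + E ∘L C)† := by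
    rw [map_add, ContinuousLinearMap.adjoint_comp]
    rfl
  have adjoint_one_add : 1 + (E†) ∘L (↑(star A)⁻¹ : H →L[ℂ] H) ∘L (C†) =
      (1 + C ∘L (↑A⁻¹ : H →L[ℂ] H) ∘L E)† := by
    rw [map_add, ContinuousLinearMap.adjoint_comp, ContinuousLinearMap.adjoint_comp, ← star_inv,
      ContinuousLinearMap.comp_assoc]
    exact congrArg (· + _) (star_one (K →L[ℂ] K)).symm
  (LinearEquiv.ofEq _ _ (by
      rw [ContinuousLinearMap.orthogonal_range, adjoint_add_comp])).trans <|
    (kerAddCompEquivOfUnit (star A) (C†) (E†)).trans <|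
      LinearEquiv.ofEq _ _ (by rw [adjoint_one_add])

theorem finrank_orthogonal_range_add_comp [CompleteSpace H] :
    Module.finrank ℂ ((↑A + E ∘L C).range)ᗮ = Module.finrank ℂ (↑A + E ∘L C).ker := by
  rw [(orthogonalRangeAddCompEquiv A E C).finrank_eq, finrank_ker_adjoint,
    (kerAddCompEquivOfUnit A E C).finrank_eq]

theorem exists_ne_zero_of_det_eq_zero
    (hdet : (1 + C ∘L (↑A⁻¹ : H →L[ℂ] H) ∘L E).det = 0) : ∃ x, x ≠ 0 ∧ (↑A + E ∘L C) x = 0 := by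
  obtain ⟨c, hc, hc0⟩ := Submodule.exists_mem_ne_zero_of_ne_bot
    (LinearMap.bot_lt_ker_of_det_eq_zero hdet).ne'
  let x := (kerAddCompEquivOfUnit A E C).symm ⟨c, hc⟩
  refine ⟨x, fun hx => hc0 ?_, x.2⟩
  have : x = 0 := Subtype.ext hx
  exact congrArg Subtype.val ((LinearEquiv.map_eq_zero_iff _).1 this)

variable {A E C}

theorem Factorization.mem_Delta4 [CompleteSpace H] {T : H →ₗ.[ℂ] H} {z : ℂ} {R : H →L[ℂ] H}
    (h : Factorization T z R (↑A + E ∘L C)) (hT : (shift T z).IsClosed) : z ∈ Delta4 T := by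
  have hker := finiteDimensional_ker_add_comp A E C
  refine ⟨⟨hT, ?_, h.kernelEquiv.finiteDimensional, ?_⟩, ?_⟩
  · rw [h.range_eq]
    exact isClosed_range_add_comp A E C
  · rw [h.range_eq]
    exact (orthogonalRangeAddCompEquiv A E C).symm.finiteDimensional
  · rw [index, h.range_eq, finrank_orthogonal_range_add_comp, h.kernelEquiv.finrank_eq, sub_self]

end

/-- Near `z` the resolvent of `T` is a quotient `Θ / D` of analytic functions, and the zeros of `D`
are eigenvalues. This is the conclusion of the analytic Fredholm theorem. -/
def IsFredholmPoint (T : H →ₗ.[ℂ] H) (z : ℂ) : Prop :=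
  ∃ (D : ℂ → ℂ) (Θ : ℂ → H →L[ℂ] H), AnalyticAt ℂ D z ∧ AnalyticAt ℂ Θ z ∧
    ∀ᶠ w in 𝓝 z, (D w = 0 → IsEigenvalue T w) ∧
      (D w ≠ 0 → w ∈ resolventSet T ∧ D w • resolvent T w = Θ w)

theorem Factorization.smul_resolvent_eq {T : H →ₗ.[ℂ] H} {z : ℂ} {R A B : H →L[ℂ] H}
    {E : K →L[ℂ] H} {C : H →L[ℂ] K} (h : Factorization T z R (A + E ∘L C)) (hAB : A * B = 1)
    (hBA : B * A = 1) (hdet : (1 + C ∘L B ∘L E).det ≠ 0) :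
    z ∈ resolventSet T ∧
      (1 + C ∘L B ∘L E).det • resolvent T z = R * cofactorOp E C B := by
  set D := (1 + C ∘L B ∘L E).det
  have hB := h.isBoundedInverse (B := D⁻¹ • cofactorOp E C B)
    (by rw [mul_smul_comm, mul_cofactorOp E C hAB, smul_smul, inv_mul_cancel₀ hdet, one_smul])
    (by rw [smul_mul_assoc, cofactorOp_mul E C hBA, smul_smul, inv_mul_cancel₀ hdet, one_smul])
  refine ⟨⟨_, hB⟩, ?_⟩
  rw [hB.resolvent_eq, mul_smul_comm, smul_smul, mul_inv_cancel₀ hdet, one_smul]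

theorem Factorization.isFredholmPoint [CompleteSpace H] {T : H →ₗ.[ℂ] H} {z : ℂ} {R : H →L[ℂ] H}
    {A : (H →L[ℂ] H)ˣ} {E : K →L[ℂ] H} {C : H →L[ℂ] K}
    (h : Factorization T z R (↑A + E ∘L C)) : IsFredholmPoint T z := by
  let Aw (w : ℂ) : H →L[ℂ] H := A - (w - z) • R
  let Bw (w : ℂ) : H →L[ℂ] H := Ring.inverse (Aw w)
  have hAw : ∀ᶠ w in 𝓝 z, IsUnit (Aw w) := eventually_isUnit_sub_smul A.isUnit z
  have hBw : ∀ᶠ w in 𝓝 z, DifferentiableAt ℂ Bw w := by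
    filter_upwards [hAw] with w hw
    exact DifferentiableAt.inverse (by fun_prop) hw
  refine ⟨fun w => (1 + C ∘L Bw w ∘L E).det, fun w => R * cofactorOp E C (Bw w), ?_, ?_, ?_⟩
  · refine Complex.analyticAt_iff_eventually_differentiableAt.2 (hBw.mono fun w hw => ?_)
    exact DifferentiableAt.fun_comp' w (differentiable_det _) (by fun_prop)
  · refine Complex.analyticAt_iff_eventually_differentiableAt.2 (hBw.mono fun w hw => ?_)
    exact (differentiableAt_const R).mul
      (DifferentiableAt.fun_comp' w (differentiable_cofactorOp E C _) hw)
  · filter_upwards [hAw] with w hw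
    have hfac : Factorization T w R (Aw w + E ∘L C) := by
      convert h.translate w using 1
      exact (add_sub_right_comm _ _ _).symm
    refine ⟨fun hD => ?_, hfac.smul_resolvent_eq (Ring.mul_inverse_cancel _ hw)
      (Ring.inverse_mul_cancel _ hw)⟩
    obtain ⟨a, ha⟩ := hw
    simp only [Bw, ← ha, Ring.inverse_unit] at hD hfac
    obtain ⟨x, hx, hSx⟩ := exists_ne_zero_of_det_eq_zero a E C hD
    exact hfac.isEigenvalue hx hSx

end FiniteRank

theorem exists_eq_add_comp_of_isCompactOperator {H : Type*} [NormedAddCommGroup H]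
    [InnerProductSpace ℂ H] [CompleteSpace H] {L : H →L[ℂ] H} (hL : IsCompactOperator L) :
    ∃ (N : Submodule ℂ H) (_ : FiniteDimensional ℂ N) (A : (H →L[ℂ] H)ˣ) (C : H →L[ℂ] N),
      1 + L = A + N.subtypeL ∘L C := by
  obtain ⟨Z, hZ, hLZ⟩ := IsCompactOperator.image_closedBall_subset_compact
    (f := L.toLinearMap) hL 1
  obtain ⟨t, ht, hcov⟩ := Metric.totallyBounded_iff.1 hZ.totallyBounded (1 / 2) (by norm_num)
  let N : Submodule ℂ H := Submodule.span ℂ t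
  have hN : FiniteDimensional ℂ N := FiniteDimensional.span_of_finite ℂ ht
  let C : H →L[ℂ] N := N.orthogonalProjectionOnto ∘L L
  let Q : H →L[ℂ] H := N.subtypeL ∘L C - L
  have norm_apply_le (x : H) (hx : ‖x‖ = 1) : ‖Q x‖ ≤ 1 / 2 := by
    obtain ⟨y, hy, hxy⟩ := Set.mem_iUnion₂.1 (hcov (hLZ ⟨x, by simp [hx], rfl⟩))
    have hQx : Q x = -(L x - N.starProjection (L x)) := by simp [Q, C]
    calc ‖Q x‖ = ‖L x - N.starProjection (L x)‖ := by rw [hQx, norm_neg]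
      _ ≤ ‖L x - y‖ := by
        rw [N.starProjection_minimal (L x)]
        exact ciInf_le ⟨0, by rintro _ ⟨w, rfl⟩; exact norm_nonneg _⟩
          (⟨y, Submodule.subset_span hy⟩ : N)
      _ ≤ 1 / 2 := by
        rw [← dist_eq_norm]
        exact (Metric.mem_ball.1 hxy).le
  have hQ : ‖Q‖ < 1 :=
    (ContinuousLinearMap.opNorm_le_of_unit_norm (by norm_num) norm_apply_le).trans_lt (by norm_num)
  refine ⟨N, hN, Units.oneSub Q hQ, C, ?_⟩
  change 1 + L = 1 - (N.subtypeL ∘L C - L) + N.subtypeL ∘L C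
  abel

section IsFredholmPoint

variable {H : Type*} [NormedAddCommGroup H] [InnerProductSpace ℂ H] {T : H →ₗ.[ℂ] H} {z : ℂ}

theorem IsFredholmPoint.isEigenvalue (h : IsFredholmPoint T z) (hz : z ∉ resolventSet T) :
    IsEigenvalue T z := by
  obtain ⟨D, Θ, -, -, hDΘ⟩ := h
  obtain ⟨zero_imp, ne_zero_imp⟩ := hDΘ.self_of_nhds
  by_contra hz'
  exact hz (ne_zero_imp fun h0 => hz' (zero_imp h0)).1

theorem IsFredholmPoint.eventually_or_eventually (h : IsFredholmPoint T z) :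
    (∀ᶠ w in 𝓝[≠] z, w ∈ resolventSet T) ∨ ∀ᶠ w in 𝓝 z, w ∉ resolventSet T := by
  obtain ⟨D, Θ, hD, -, hDΘ⟩ := h
  rcases hD.eventually_eq_zero_or_eventually_ne_zero with h0 | h0
  · right
    filter_upwards [h0, hDΘ] with w h0 hw
    exact (hw.1 h0).notMem_resolventSet
  · left
    filter_upwards [h0, nhdsWithin_le_nhds hDΘ] with w h0 hw
    exact (hw.2 h0).1

theorem IsFredholmPoint.meromorphicAt_resolvent (h : IsFredholmPoint T z)
    (hz : ∀ᶠ w in 𝓝[≠] z, w ∈ resolventSet T) : MeromorphicAt (resolvent T) z := by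
  obtain ⟨D, Θ, hD, hΘ, hDΘ⟩ := h
  refine (hD.meromorphicAt.inv.smul hΘ.meromorphicAt).congr ?_
  filter_upwards [hz, nhdsWithin_le_nhds hDΘ] with w hw hDΘw
  have hDw : D w ≠ 0 := fun h0 => (hDΘw.1 h0).notMem_resolventSet hw
  change (D w)⁻¹ • Θ w = resolvent T w
  rw [← (hDΘw.2 hDw).2, inv_smul_smul₀ hDw]

theorem eventually_mem_resolventSet_of_isPreconnected {Ω : Set ℂ} (hΩ : IsPreconnected Ω)
    (hT : ∀ z ∈ Ω, IsFredholmPoint T z) (hρ : (Ω ∩ resolventSet T).Nonempty) (hz : z ∈ Ω) :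
    ∀ᶠ w in 𝓝[≠] z, w ∈ resolventSet T := by
  let u : Set ℂ := {z | ∀ᶠ w in 𝓝[≠] z, w ∈ resolventSet T}
  let v : Set ℂ := {z | ∀ᶠ w in 𝓝 z, w ∉ resolventSet T}
  have hu : IsOpen u := by
    rw [isOpen_iff_mem_nhds]
    intro x hx
    filter_upwards [eventually_nhds_nhdsWithin.2 hx] with y hy
    by_cases hyx : y = x
    · exact hyx ▸ hx
    · rw [nhdsWithin_eq_nhds.2 (isOpen_compl_singleton.mem_nhds hyx)] at hy
      exact nhdsWithin_le_nhds hy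
  have hv : IsOpen v := isOpen_setOfPred_eventually_nhds
  have huv : Disjoint u v := Set.disjoint_left.2 fun x hxu hxv => by
    have hxu : ∀ᶠ w in 𝓝[≠] x, w ∈ resolventSet T := hxu
    obtain ⟨w, hw, hw'⟩ := (hxu.and (nhdsWithin_le_nhds hxv)).exists
    exact hw' hw
  obtain ⟨z₀, hz₀, hz₀ρ⟩ := hρ
  refine hΩ.subset_left_of_subset_union hu hv huv (fun x hx => (hT x hx).eventually_or_eventually)
    ⟨z₀, hz₀, (hT z₀ hz₀).eventually_or_eventually.resolve_right fun h => ?_⟩ hz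
  exact h.self_of_nhds hz₀ρ

end IsFredholmPoint

/-! ### Algebraic multiplicity -/

theorem circleIntegral_comp_comm {E F : Type*} [NormedAddCommGroup E] [NormedSpace ℂ E]
    [CompleteSpace E] [NormedAddCommGroup F] [NormedSpace ℂ F] [CompleteSpace F] (L : E →L[ℂ] F)
    {f : ℂ → E} {z : ℂ} {r : ℝ} (hf : CircleIntegrable f z r) :
    ∮ w in C(z, r), L (f w) = L (∮ w in C(z, r), f w) := by
  simp only [circleIntegral, ← L.map_smul]
  exact L.intervalIntegral_comp_comm hf.out

theorem circleIntegrable_zpow_smul {E : Type*} [NormedAddCommGroup E] [NormedSpace ℂ E] {z : ℂ}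
    {r : ℝ} (hr : 0 < r) (n : ℤ) {f : ℂ → E} (hf : ContinuousOn f (Metric.sphere z r)) :
    CircleIntegrable (fun w => (w - z) ^ n • f w) z r := by
  refine ContinuousOn.circleIntegrable hr.le (ContinuousOn.smul (fun w hw => ?_) hf)
  have hwz : w - z ≠ 0 := sub_ne_zero.2 (Metric.ne_of_mem_sphere hw hr.ne')
  exact ((continuousAt_zpow₀ _ n (.inl hwz)).comp (f := (· - z))
    (by fun_prop)).continuousWithinAt

section AlgebraicMultiplicity

variable {H : Type*} [NormedAddCommGroup H] [InnerProductSpace ℂ H] {T : H →ₗ.[ℂ] H} {z : ℂ}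

theorem mem_kernelPow_succ {k : ℕ} {x : H} :
    x ∈ kernelPow T (k + 1) ↔ ∃ h : x ∈ T.domain, T ⟨x, h⟩ ∈ kernelPow T k := by
  constructor
  · rintro ⟨u, hu, rfl⟩
    exact ⟨u.2, hu⟩
  · rintro ⟨h, hx⟩
    exact ⟨⟨x, h⟩, hx, rfl⟩

theorem finiteDimensional_kernelPow (hT : FiniteDimensional ℂ (kernel T)) (k : ℕ) :
    FiniteDimensional ℂ (kernelPow T k) := by
  induction k with
  | zero => exact inferInstanceAs (FiniteDimensional ℂ (⊥ : Submodule ℂ H))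
  | succ k ih =>
    refine Module.Finite.iff_fg.2 (Submodule.FG.map _ ?_)
    refine Submodule.fg_of_fg_map_of_fg_inf_ker T.toFun ?_ ?_
    · have := Submodule.finiteDimensional_of_le
        (Submodule.map_comap_le T.toFun (kernelPow T k))
      exact Module.Finite.iff_fg.1 this
    · have : FiniteDimensional ℂ T.toFun.ker := hT
      exact Module.Finite.iff_fg.1 (Submodule.finiteDimensional_of_le inf_le_right)

theorem resolvent_eq_mul {w w₀ : ℂ} (hw : w ∈ resolventSet T) (hw₀ : w₀ ∈ resolventSet T) :
    resolvent T w = resolvent T w₀ * (1 + (w - w₀) • resolvent T w) := by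
  ext x
  have h := resolvent_apply_sub hw₀ ⟨resolvent T w x, resolvent_mem_domain hw x⟩
  rw [apply_resolvent hw, add_sub_assoc, ← sub_smul] at h
  exact h.symm

theorem resolvent_shift_apply {w : ℂ} (hw : w ∈ resolventSet T) (z : ℂ)
    (u : (shift T z).domain) :
    resolvent T w (shift T z u) = u + (w - z) • resolvent T w u := by
  obtain ⟨u, hu⟩ := u
  have hshift : shift T z ⟨u, hu⟩ = (T ⟨u, hu⟩ - w • u) + (w - z) • u := by
    change T ⟨u, hu⟩ - z • u = _
    module
  rw [hshift, map_add, resolvent_apply_sub hw ⟨u, hu⟩, map_smul]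

/-- The coefficients `∮ (w - z) ^ n (T - w)⁻¹ dw` of the Laurent expansion of the resolvent at `z`,
up to the factor `2πi`. -/
def resolventMoment (T : H →ₗ.[ℂ] H) (z : ℂ) (r : ℝ) (n : ℤ) : H →L[ℂ] H :=
  ∮ w in C(z, r), (w - z) ^ n • resolvent T w

theorem rieszProjection_eq (T : H →ₗ.[ℂ] H) (z : ℂ) (r : ℝ) :
    rieszProjection T z r = -(2 * (Real.pi : ℂ) * Complex.I)⁻¹ • resolventMoment T z r 0 := by
  simp [rieszProjection, resolventMoment]

variable [CompleteSpace H] {r : ℝ}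

theorem continuousOn_resolvent : ContinuousOn (resolvent T) (resolventSet T) :=
  fun _ hw => (analyticAt_resolvent hw).continuousAt.continuousWithinAt

theorem resolventMoment_apply (hr : 0 < r) (hρ : Metric.sphere z r ⊆ resolventSet T) (n : ℤ)
    (x : H) : resolventMoment T z r n x = ∮ w in C(z, r), (w - z) ^ n • resolvent T w x :=
  (circleIntegral_comp_comm (ContinuousLinearMap.apply ℂ H x)
    (circleIntegrable_zpow_smul hr n (continuousOn_resolvent.mono hρ))).symm

theorem resolventMoment_shift_apply (hr : 0 < r) (hρ : Metric.sphere z r ⊆ resolventSet T)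
    (n : ℤ) (u : (shift T z).domain) :
    resolventMoment T z r n (shift T z u) =
      (∮ w in C(z, r), (w - z) ^ n) • (u : H) + resolventMoment T z r (n + 1) u := by
  have integrable_const := circleIntegrable_zpow_smul (z := z) hr n
    (continuousOn_const (c := (u : H)))
  have integrable_succ := circleIntegrable_zpow_smul hr (n + 1)
    ((continuousOn_resolvent.mono hρ).clm_apply (continuousOn_const (c := (u : H))))
  rw [resolventMoment_apply hr hρ, resolventMoment_apply hr hρ,
    ← circleIntegral.integral_smul_const,
    ← circleIntegral.integral_add integrable_const integrable_succ]
  refine circleIntegral.integral_congr hr.le fun w hw => ?_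
  have hwz : w - z ≠ 0 := sub_ne_zero.2 (Metric.ne_of_mem_sphere hw hr.ne')
  change (w - z) ^ n • resolvent T w (shift T z u) = (w - z) ^ n • (u : H) + _
  rw [resolvent_shift_apply (hρ hw), smul_add, smul_smul, zpow_add_one₀ hwz]

theorem resolventMoment_eq_mul (hr : 0 < r) (hρ : Metric.sphere z r ⊆ resolventSet T) {w₀ : ℂ}
    (hw₀ : w₀ ∈ resolventSet T) (n : ℤ) :
    resolventMoment T z r n = resolvent T w₀ * ((∮ w in C(z, r), (w - z) ^ n) • 1 +
      resolventMoment T z r (n + 1) + (z - w₀) • resolventMoment T z r n) := by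
  have integrable_const := circleIntegrable_zpow_smul (z := z) hr n
    (continuousOn_const (c := (1 : H →L[ℂ] H)))
  have integrable (n) := circleIntegrable_zpow_smul hr n (continuousOn_resolvent.mono hρ)
  have integrable_sum : CircleIntegrable
      (fun w => (w - z) ^ n • (1 : H →L[ℂ] H) + (w - z) ^ (n + 1) • resolvent T w) z r :=
    integrable_const.add (integrable _)
  have integrable_smul : CircleIntegrable
      (fun w => (z - w₀) • (w - z) ^ n • resolvent T w) z r := by
    simpa only [Pi.smul_apply, smul_comm (z - w₀)] using circleIntegrable_zpow_smul hr n
      ((continuousOn_resolvent.mono hρ).const_smul (z - w₀))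
  simp only [resolventMoment]
  rw [← circleIntegral.integral_smul_const, ← circleIntegral.integral_smul (z - w₀),
    ← circleIntegral.integral_add integrable_const (integrable _),
    ← circleIntegral.integral_add integrable_sum integrable_smul]
  refine Eq.trans ?_ (circleIntegral_comp_comm (ContinuousLinearMap.mul ℂ _ (resolvent T w₀))
    (integrable_sum.add integrable_smul))
  refine circleIntegral.integral_congr hr.le fun w hw => ?_
  have hwz : w - z ≠ 0 := sub_ne_zero.2 (Metric.ne_of_mem_sphere hw hr.ne')
  have hsplit : (w - z) ^ n • (1 : H →L[ℂ] H) + (w - z) ^ (n + 1) • resolvent T w +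
      (z - w₀) • (w - z) ^ n • resolvent T w = (w - z) ^ n • (1 + (w - w₀) • resolvent T w) := by
    rw [zpow_add_one₀ hwz]
    module
  change (w - z) ^ n • resolvent T w = resolvent T w₀ * (_ + _ + _)
  rw [hsplit, mul_smul_comm, ← resolvent_eq_mul (hρ hw) hw₀]

theorem shift_resolventMoment_apply (hr : 0 < r) (hρ : Metric.sphere z r ⊆ resolventSet T)
    (n : ℤ) (x : H) : ∃ h : resolventMoment T z r n x ∈ T.domain,
      shift T z ⟨resolventMoment T z r n x, h⟩ =
        (∮ w in C(z, r), (w - z) ^ n) • x + resolventMoment T z r (n + 1) x := by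
  obtain ⟨w₀, hw₀⟩ := NormedSpace.sphere_nonempty (x := z).2 hr.le
  set y := (∮ w in C(z, r), (w - z) ^ n) • x + resolventMoment T z r (n + 1) x +
    (z - w₀) • resolventMoment T z r n x with hy
  have hMy : resolventMoment T z r n x = resolvent T w₀ y :=
    DFunLike.congr_fun (resolventMoment_eq_mul hr hρ (hρ hw₀) n) x
  refine ⟨hMy ▸ resolvent_mem_domain (hρ hw₀) y, ?_⟩
  have hTy := apply_resolvent (hρ hw₀) y
  simp only [← hMy] at hTy
  refine Eq.trans (congrArg (· - z • resolventMoment T z r n x) hTy) ?_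
  rw [hy]
  module

theorem resolventMoment_eq_zero_of_mem_kernelPow (hr : 0 < r)
    (hρ : Metric.sphere z r ⊆ resolventSet T) {k : ℕ} :
    ∀ {x : H}, x ∈ kernelPow (shift T z) k → ∀ n ≤ (-1 : ℤ), resolventMoment T z r n x = 0 := by
  induction k with
  | zero =>
    intro x hx n _
    rw [(Submodule.mem_bot ℂ).1 hx, map_zero]
  | succ k ih =>
    intro x hx n hn
    obtain ⟨hxT, hshift⟩ := mem_kernelPow_succ.1 hx
    have := resolventMoment_shift_apply hr hρ (n - 1) ⟨x, hxT⟩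
    rwa [circleIntegral.integral_sub_zpow_of_ne (by lia), zero_smul, zero_add, sub_add_cancel,
      ih hshift (n - 1) (by lia), eq_comm] at this

theorem rieszProjection_apply_of_mem_kernelPow (hr : 0 < r)
    (hρ : Metric.sphere z r ⊆ resolventSet T) {k : ℕ} {x : H}
    (hx : x ∈ kernelPow (shift T z) k) : rieszProjection T z r x = x := by
  cases k with
  | zero => rw [(Submodule.mem_bot ℂ).1 hx, map_zero]
  | succ k =>
    obtain ⟨hxT, hshift⟩ := mem_kernelPow_succ.1 hx
    have hM := resolventMoment_shift_apply hr hρ (-1) ⟨x, hxT⟩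
    simp only [zpow_neg_one] at hM
    rw [resolventMoment_eq_zero_of_mem_kernelPow hr hρ hshift (-1) le_rfl, neg_add_cancel,
      circleIntegral.integral_sub_center_inv z hr.ne', eq_comm, add_eq_zero_iff_neg_eq] at hM
    rw [rieszProjection_eq, smul_apply, ← hM, smul_neg, neg_smul, neg_neg,
      inv_smul_smul₀ Complex.two_pi_I_ne_zero]

theorem generalizedEigenspace_le_range_rieszProjection (hr : 0 < r)
    (hρ : Metric.sphere z r ⊆ resolventSet T) :
    generalizedEigenspace T z ≤ (rieszProjection T z r).range :=
  iSup_le fun _ x hx => ⟨x, rieszProjection_apply_of_mem_kernelPow hr hρ hx⟩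

theorem resolventMoment_apply_mem_kernelPow (hr : 0 < r)
    (hρ : Metric.sphere z r ⊆ resolventSet T) {m : ℕ} (hm : resolventMoment T z r m = 0) (x : H) :
    ∀ {j k : ℕ}, k + j = m → resolventMoment T z r k x ∈ kernelPow (shift T z) j := by
  intro j
  induction j with
  | zero =>
    rintro k rfl
    rw [add_zero] at hm
    simp [hm]
  | succ j ih =>
    intro k hk
    obtain ⟨hM, hshift⟩ := shift_resolventMoment_apply hr hρ k x
    rw [circleIntegral.integral_sub_zpow_of_ne (by lia), zero_smul, zero_add] at hshift
    refine mem_kernelPow_succ.2 ⟨hM, hshift ▸ ?_⟩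
    exact_mod_cast ih (k := k + 1) (by lia)

theorem range_rieszProjection_le_kernelPow (hr : 0 < r) (hρ : Metric.sphere z r ⊆ resolventSet T)
    {m : ℕ} (hm : resolventMoment T z r m = 0) :
    (rieszProjection T z r).range ≤ kernelPow (shift T z) m := by
  rintro _ ⟨x, rfl⟩
  simp only [rieszProjection_eq]
  exact Submodule.smul_mem _ _
    (resolventMoment_apply_mem_kernelPow hr hρ hm x (k := 0) (zero_add m))

theorem eventually_resolventMoment_eq_zero (hT : MeromorphicAt (resolvent T) z) :
    ∃ m : ℕ, ∀ᶠ r in 𝓝[>] 0, resolventMoment T z r m = 0 := by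
  obtain ⟨m, hm⟩ := hT
  refine ⟨m, ?_⟩
  obtain ⟨R, hR, hball⟩ := Metric.eventually_nhds_iff_ball.1 hm.eventually_analyticAt
  filter_upwards [Ioo_mem_nhdsGT hR] with r hr
  have hdiff : DifferentiableOn ℂ (fun w => (w - z) ^ m • resolvent T w)
      (closure (Metric.ball z r)) := fun w hw =>
    (hball w (Metric.closedBall_subset_ball hr.2
      (Metric.closure_ball_subset_closedBall hw))).differentiableAt.differentiableWithinAt
  simpa only [resolventMoment, zpow_natCast] using hdiff.diffContOnCl.circleIntegral_eq_zero hr.1.le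

theorem hasFiniteAlgebraicMultiplicity (hT : MeromorphicAt (resolvent T) z)
    (hz : ∀ᶠ w in 𝓝[≠] z, w ∈ resolventSet T) (hker : FiniteDimensional ℂ (kernel (shift T z))) :
    HasFiniteAlgebraicMultiplicity T z := by
  obtain ⟨m, hm⟩ := eventually_resolventMoment_eq_zero hT
  obtain ⟨R, hR, hball⟩ := Metric.eventually_nhds_iff_ball.1 (eventually_nhdsWithin_iff.1 hz)
  obtain ⟨r, hmr, hr0, hrR⟩ := (hm.and (Ioo_mem_nhdsGT hR)).exists
  have hρ : Metric.closedBall z r \ {z} ⊆ resolventSet T := fun w hw =>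
    hball w (Metric.closedBall_subset_ball hrR hw.1) hw.2
  have hsphere : Metric.sphere z r ⊆ resolventSet T := fun w hw =>
    hρ ⟨Metric.sphere_subset_closedBall hw, Metric.ne_of_mem_sphere hw hr0.ne'⟩
  have := finiteDimensional_kernelPow hker m
  have hrange := Submodule.finiteDimensional_of_le
    (range_rieszProjection_le_kernelPow hr0 hsphere hmr)
  exact ⟨⟨r, hr0, hρ, hrange⟩,
    Submodule.finiteDimensional_of_le (generalizedEigenspace_le_range_rieszProjection hr0 hsphere)⟩

end AlgebraicMultiplicity

/-! ### Relatively compact perturbations -/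

section RelativelyCompact

theorem exists_subseq_tendsto_of_surjective {E F : Type*} [NormedAddCommGroup E] [NormedSpace ℂ E]
    [CompleteSpace E] [NormedAddCommGroup F] [NormedSpace ℂ F] [CompleteSpace F] (f : E →L[ℂ] F)
    (hf : Function.Surjective f) [FiniteDimensional ℂ f.ker] {x : ℕ → E}
    (hx : Bornology.IsBounded (Set.range x)) {y : F}
    (hy : Tendsto (fun n => f (x n)) atTop (𝓝 y)) :
    ∃ (a : E) (φ : ℕ → ℕ), StrictMono φ ∧ Tendsto (x ∘ φ) atTop (𝓝 a) := by
  obtain ⟨x₀, rfl⟩ := hf y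
  obtain ⟨C, -, hC⟩ := f.exists_preimage_norm_le hf
  choose v hv hvC using fun n => hC (f (x n) - f x₀)
  have hv₀ : Tendsto v atTop (𝓝 0) := by
    refine squeeze_zero_norm hvC ?_
    simpa only [mul_zero] using (tendsto_iff_norm_sub_tendsto_zero.1 hy).const_mul C
  let k (n : ℕ) : f.ker := ⟨x n - v n - x₀, by
    rw [LinearMap.mem_ker, ContinuousLinearMap.coe_coe, map_sub, map_sub, hv, sub_sub_cancel,
      sub_self]⟩
  have : ProperSpace f.ker := FiniteDimensional.proper ℂ _
  have hk : Bornology.IsBounded (Set.range k) := by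
    have hsub : Bornology.IsBounded (Set.range x - Set.range v - {x₀}) :=
      (hx.sub (Metric.isBounded_range_of_tendsto v hv₀)).sub Bornology.isBounded_singleton
    refine (isometry_subtype_coe.antilipschitz.isBounded_preimage hsub).subset ?_
    rintro _ ⟨n, rfl⟩
    exact Set.sub_mem_sub (Set.sub_mem_sub ⟨n, rfl⟩ ⟨n, rfl⟩) rfl
  obtain ⟨a, -, φ, hφ, ha⟩ := tendsto_subseq_of_bounded hk (fun n => Set.mem_range_self n)
  refine ⟨a + 0 + x₀, φ, hφ, ?_⟩
  have hka : Tendsto (fun n => (k (φ n) : E)) atTop (𝓝 a) :=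
    (continuous_subtype_val.tendsto a).comp ha
  refine ((hka.add (hv₀.comp hφ.tendsto_atTop)).add_const x₀).congr fun n => ?_
  simp only [k, Function.comp_apply]
  abel

theorem isCompactOperator_of_forall_seq {E F : Type*} [NormedAddCommGroup E] [NormedSpace ℂ E]
    [NormedAddCommGroup F] [NormedSpace ℂ F] {L : E →ₗ[ℂ] F}
    (hL : ∀ x : ℕ → E, (∀ n, ‖x n‖ ≤ 1) → ∃ (y : F) (φ : ℕ → ℕ), StrictMono φ ∧
      Tendsto (fun n => L (x (φ n))) atTop (𝓝 y)) : IsCompactOperator L := by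
  rw [isCompactOperator_iff_isCompact_closure_image_closedBall L one_pos]
  refine IsSeqCompact.isCompact fun y hy => ?_
  have happrox (n : ℕ) : ∃ x : E, ‖x‖ ≤ 1 ∧ dist (y n) (L x) < 1 / ((n : ℝ) + 1) := by
    obtain ⟨_, ⟨x, hx, rfl⟩, hd⟩ := Metric.mem_closure_iff.1 (hy n) (1 / ((n : ℝ) + 1))
      Nat.one_div_pos_of_nat
    exact ⟨x, mem_closedBall_zero_iff.1 hx, hd⟩
  choose x hx hd using happrox
  obtain ⟨a, φ, hφ, ha⟩ := hL x hx
  have hdist : Tendsto (fun n => dist (y n) (L (x n))) atTop (𝓝 0) :=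
    squeeze_zero (fun _ => dist_nonneg) (fun n => (hd n).le) tendsto_one_div_add_atTop_nhds_zero_nat
  have hya : Tendsto (y ∘ φ) atTop (𝓝 a) :=
    (tendsto_iff_of_dist (hdist.comp hφ.tendsto_atTop)).2 ha
  exact ⟨a, isClosed_closure.mem_of_tendsto hya (Eventually.of_forall fun n => hy _), φ, hφ, hya⟩

variable {H : Type*} [NormedAddCommGroup H] [InnerProductSpace ℂ H]

/-- The operator `T + V` for `V` defined on the domain of `T`. -/
def perturb (T : H →ₗ.[ℂ] H) (V : T.domain →ₗ[ℂ] H) : H →ₗ.[ℂ] H := ⟨T.domain, T.toFun + V⟩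

/-- Compactness of `V` relative to `T`, for `V` defined on the domain of `T` only: graph norm
bounded sequences are mapped to sequences with a convergent subsequence. -/
def IsGraphCompact (T : H →ₗ.[ℂ] H) (V : T.domain →ₗ[ℂ] H) : Prop :=
  ∀ u : ℕ → T.domain, (∃ C : ℝ, ∀ n, ‖(u n : H)‖ ≤ C ∧ ‖T (u n)‖ ≤ C) →
    ∃ (y : H) (φ : ℕ → ℕ), StrictMono φ ∧ Tendsto (fun n => V (u (φ n))) atTop (𝓝 y)

variable {T : H →ₗ.[ℂ] H} {V : T.domain →ₗ[ℂ] H} {z : ℂ}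

theorem IsGraphCompact.clm_comp (hV : IsGraphCompact T V) (L : H →L[ℂ] H) :
    IsGraphCompact T (L.toLinearMap ∘ₗ V) := fun u hu =>
  let ⟨y, φ, hφ, hy⟩ := hV u hu
  ⟨L y, φ, hφ, (L.continuous.tendsto y).comp hy⟩

theorem IsGraphCompact.add {V' : T.domain →ₗ[ℂ] H} (hV : IsGraphCompact T V)
    (hV' : IsGraphCompact T V') : IsGraphCompact T (V + V') := by
  rintro u ⟨C, hC⟩
  obtain ⟨y, φ, hφ, hy⟩ := hV u ⟨C, hC⟩
  obtain ⟨y', ψ, hψ, hy'⟩ := hV' (u ∘ φ) ⟨C, fun n => hC (φ n)⟩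
  exact ⟨y + y', φ ∘ ψ, hφ.comp hψ, (hy.comp hψ.tendsto_atTop).add hy'⟩

/-- Weyl's singular sequences of approximate eigenvectors. Their separation replaces the usual weak
convergence to zero; all that matters is that no subsequence converges. -/
def HasSingularSequence (T : H →ₗ.[ℂ] H) (z : ℂ) : Prop :=
  ∃ u : ℕ → T.domain, (∀ n, ‖(u n : H)‖ = 1) ∧ (Pairwise fun m n => 1 ≤ dist (u m : H) (u n)) ∧
    Tendsto (fun n => T (u n) - z • (u n : H)) atTop (𝓝 0)

theorem HasSingularSequence.mem_spectrum (h : HasSingularSequence T z) : z ∈ spectrum T := by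
  intro hz
  obtain ⟨u, hu, -, hlim⟩ := h
  have hR := ((resolvent T z).continuous.tendsto 0).comp hlim
  have hnorm : Tendsto (fun n => ‖(u n : H)‖) atTop (𝓝 ‖resolvent T z 0‖) :=
    (hR.congr fun n => resolvent_apply_sub hz (u n)).norm
  simp only [hu, map_zero, norm_zero, tendsto_const_nhds_iff, one_ne_zero] at hnorm

theorem exists_subseq_tendsto_of_isClosed_range [CompleteSpace H] (hT : T.IsClosed)
    (hrange : IsClosed (range T : Set H)) (hker : FiniteDimensional ℂ (kernel T))
    {u : ℕ → T.domain} (hu : Bornology.IsBounded (Set.range fun n => (u n : H))) {y : H}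
    (hy : Tendsto (fun n => T (u n)) atTop (𝓝 y)) :
    ∃ (x : H) (φ : ℕ → ℕ), StrictMono φ ∧ Tendsto (fun n => (u (φ n) : H)) atTop (𝓝 x) := by
  have : CompleteSpace T.graph := hT.completeSpace_coe
  have : CompleteSpace (range T) := hrange.completeSpace_coe
  let toGraph : T.domain →ₗ[ℂ] T.graph :=
    (T.domain.subtype.prod T.toFun).codRestrict T.graph T.mem_graph
  have toGraph_surjective : Function.Surjective toGraph := by
    rintro ⟨p, hp⟩
    obtain ⟨v, hv⟩ := (LinearPMap.mem_graph_iff T).1 hp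
    exact ⟨v, Subtype.ext (Prod.ext hv.1 hv.2)⟩
  let f : T.graph →L[ℂ] range T :=
    (ContinuousLinearMap.snd ℂ H H ∘L T.graph.subtypeL).codRestrict (range T) fun p => by
      obtain ⟨v, rfl⟩ := toGraph_surjective p
      exact ⟨v, rfl⟩
  have hf : Function.Surjective f := fun ⟨_, v, hv⟩ => ⟨toGraph v, Subtype.ext hv⟩
  have : FiniteDimensional ℂ f.ker := by
    refine Submodule.finiteDimensional_of_le (S₂ := (kernel T).map toGraph) fun p hp => ?_
    obtain ⟨v, rfl⟩ := toGraph_surjective p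
    exact ⟨v, congrArg Subtype.val (LinearMap.mem_ker.1 hp), rfl⟩
  have hbounded : Bornology.IsBounded (Set.range (toGraph ∘ u)) := by
    refine (isometry_subtype_coe.antilipschitz.isBounded_preimage
      (hu.prod (Metric.isBounded_range_of_tendsto _ hy))).subset ?_
    rintro _ ⟨n, rfl⟩
    exact ⟨⟨n, rfl⟩, ⟨n, rfl⟩⟩
  have hfu : Tendsto (fun n => f (toGraph (u n))) atTop
      (𝓝 ⟨y, hrange.mem_of_tendsto hy (Eventually.of_forall fun n => ⟨u n, rfl⟩)⟩) :=
    tendsto_subtype_rng.2 hy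
  obtain ⟨p, φ, hφ, hp⟩ := exists_subseq_tendsto_of_surjective f hf hbounded hfu
  exact ⟨(p : H × H).1, φ, hφ, ((continuous_fst.comp continuous_subtype_val).tendsto p).comp hp⟩

namespace IsGraphCompact

theorem exists_factorization (hV : IsGraphCompact T V) (hz : z ∈ resolventSet T) :
    ∃ L : H →L[ℂ] H, IsCompactOperator L ∧
      Factorization (perturb T V) z (resolvent T z) (1 + L) := by
  let R : H →ₗ[ℂ] T.domain := (resolvent T z).toLinearMap.codRestrict T.domain
    (resolvent_mem_domain hz)
  have apply_R (x : H) : T (R x) = x + z • resolvent T z x := apply_resolvent hz x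
  have hVR : IsCompactOperator (V ∘ₗ R) := by
    refine isCompactOperator_of_forall_seq fun x hx => hV (fun n => R (x n)) ?_
    have hRx (n : ℕ) : ‖resolvent T z (x n)‖ ≤ ‖resolvent T z‖ :=
      (resolvent T z).unit_le_opNorm _ (hx n)
    refine ⟨max ‖resolvent T z‖ (1 + ‖z‖ * ‖resolvent T z‖), fun n =>
      ⟨(hRx n).trans (le_max_left _ _), le_trans ?_ (le_max_right _ _)⟩⟩
    rw [apply_R]
    refine norm_add_le_of_le (hx n) ?_
    rw [norm_smul]
    exact mul_le_mul_of_nonneg_left (hRx n) (norm_nonneg z)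
  have hfac := factorization_resolvent hz
  refine ⟨ContinuousLinearMap.mkOfIsCompactOperator hVR, hVR, hfac.injective, hfac.domain_eq,
    fun x _ => ?_⟩
  change T (R x) + V (R x) - z • resolvent T z x = x + V (R x)
  rw [apply_R]
  abel

theorem isFredholmPoint [CompleteSpace H] (hV : IsGraphCompact T V) (hz : z ∈ resolventSet T) :
    IsFredholmPoint (perturb T V) z := by
  obtain ⟨L, hL, hfac⟩ := hV.exists_factorization hz
  obtain ⟨N, hN, A, C, hS⟩ := exists_eq_add_comp_of_isCompactOperator hL
  rw [hS] at hfac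
  exact hfac.isFredholmPoint

theorem mem_Delta4 [CompleteSpace H] (hV : IsGraphCompact T V) (hz : z ∈ resolventSet T)
    (hclosed : (shift (perturb T V) z).IsClosed) : z ∈ Delta4 (perturb T V) := by
  obtain ⟨L, hL, hfac⟩ := hV.exists_factorization hz
  obtain ⟨N, hN, A, C, hS⟩ := exists_eq_add_comp_of_isCompactOperator hL
  rw [hS] at hfac
  exact hfac.mem_Delta4 hclosed

theorem not_finiteDimensional_kernel [CompleteSpace H] (hV : IsGraphCompact T V)
    (hT : HasSingularSequence T z) (hclosed : (shift (perturb T V) z).IsClosed)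
    (hrange : IsClosed (range (shift (perturb T V) z) : Set H)) :
    ¬ FiniteDimensional ℂ (kernel (shift (perturb T V) z)) := by
  intro hker
  obtain ⟨u, hu, hu_sep, hu_lim⟩ := hT
  have hu_bound (φ : ℕ → ℕ) : Bornology.IsBounded (Set.range fun n => (u (φ n) : H)) :=
    isBounded_iff_forall_norm_le.2 ⟨1, Set.forall_mem_range.2 fun n => (hu _).le⟩
  obtain ⟨M, hM⟩ := hu_lim.norm.bddAbove_range
  obtain ⟨y, φ, hφ, hy⟩ := hV u ⟨max 1 (M + ‖z‖), fun n => by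
    refine ⟨(hu n).le.trans (le_max_left _ _), le_trans ?_ (le_max_right _ _)⟩
    rw [← sub_add_cancel (T (u n)) (z • (u n : H))]
    refine norm_add_le_of_le (hM ⟨n, rfl⟩) ?_
    rw [norm_smul, hu, mul_one]⟩
  have hlim : Tendsto (fun n => shift (perturb T V) z (u (φ n))) atTop (𝓝 (0 + y)) := by
    refine ((hu_lim.comp hφ.tendsto_atTop).add hy).congr fun n => ?_
    change T (u (φ n)) - z • (u (φ n) : H) + V (u (φ n)) =
      T (u (φ n)) + V (u (φ n)) - z • (u (φ n) : H)
    abel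
  obtain ⟨x, ψ, hψ, hx⟩ := exists_subseq_tendsto_of_isClosed_range hclosed hrange hker
    (u := fun n => u (φ n)) (hu_bound φ) hlim
  obtain ⟨N, hN⟩ := Metric.cauchySeq_iff.1 hx.cauchySeq 1 one_pos
  exact (hN N le_rfl (N + 1) N.le_succ).not_ge
    (hu_sep ((hφ.comp hψ).injective.ne N.succ_ne_self.symm))

end IsGraphCompact

theorem essentialSpectrum_eq {S : Set ℂ} (hDelta5 : Sᶜ ⊆ Delta5 T) (hDelta1 : Delta1 T ⊆ Sᶜ)
    (j : Fin 5) : essentialSpectrum T j = S := by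
  have hfredholm : Delta3 T ⊆ Delta2 T := fun _ h => ⟨⟨h.1, h.2.1, Or.inl h.2.2.1⟩, h.2.2.1⟩
  have h₂ : Delta2 T ⊆ Delta1 T := fun _ h => h.1
  have h₄ : Delta4 T ⊆ Delta3 T := fun _ h => h.1
  have h₅ : Delta5 T ⊆ Delta4 T := fun _ h => h.1
  rw [essentialSpectrum, compl_eq_comm, Set.Subset.antisymm_iff]
  constructor
  · fin_cases j
    · exact hDelta5.trans (h₅.trans (h₄.trans (hfredholm.trans h₂)))
    · exact hDelta5.trans (h₅.trans (h₄.trans hfredholm))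
    · exact hDelta5.trans (h₅.trans h₄)
    · exact hDelta5.trans h₅
    · exact hDelta5
  · fin_cases j
    · exact hDelta1
    · exact h₂.trans hDelta1
    · exact hfredholm.trans (h₂.trans hDelta1)
    · exact h₄.trans (hfredholm.trans (h₂.trans hDelta1))
    · exact h₅.trans (h₄.trans (hfredholm.trans (h₂.trans hDelta1)))

end RelativelyCompact

/-! ### Perturbations of symmetric operators -/

section SymmetricPerturbation

variable {H : Type*} [NormedAddCommGroup H] [InnerProductSpace ℂ H]
  {T : H →ₗ.[ℂ] H} {V : T.domain →ₗ[ℂ] H} {z : ℂ}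

theorem inner_apply_self_im (hT : T.IsFormalAdjoint T) (u : T.domain) :
    (⟪(u : H), T u⟫_ℂ).im = 0 := by
  rw [← Complex.conj_eq_iff_im, inner_conj_symm, hT]

theorem norm_sq_eq_of_apply_add_eq_smul (hT : T.IsFormalAdjoint T) {u : T.domain} {v : H} {y : ℝ}
    (huv : T u + v = (y * Complex.I) • (u : H)) :
    ‖v‖ ^ 2 = (y * ‖(u : H)‖) ^ 2 + ‖T u‖ ^ 2 := by
  rw [eq_sub_of_add_eq' huv, @norm_sub_sq ℂ, inner_smul_left, norm_smul]
  simp [inner_apply_self_im hT u, mul_pow]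

theorem re_inner_apply_of_apply_add_eq_smul (hT : T.IsFormalAdjoint T) {u : T.domain} {v : H}
    {y : ℝ} (huv : T u + v = (y * Complex.I) • (u : H)) :
    (⟪T u, v⟫_ℂ).re = -‖T u‖ ^ 2 := by
  rw [eq_sub_of_add_eq' huv, inner_sub_right, inner_smul_right, hT, inner_self_eq_norm_sq_to_K]
  simp [inner_apply_self_im hT u, ← Complex.ofReal_pow]

theorem tendsto_inner_of_dense {D : Set H} (hD : Dense D) {x y : ℕ → H} {w : H} {C : ℝ}
    (hx : ∀ n, ‖x n‖ ≤ C) (hxD : ∀ d ∈ D, Tendsto (fun n => ⟪x n, d⟫_ℂ) atTop (𝓝 0))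
    (hy : Tendsto y atTop (𝓝 w)) : Tendsto (fun n => ⟪x n, y n⟫_ℂ) atTop (𝓝 0) := by
  rw [Metric.tendsto_atTop]
  intro ε hε
  have hC : 0 ≤ C := (norm_nonneg _).trans (hx 0)
  obtain ⟨d, hd, hwd⟩ := hD.exists_dist_lt w (ε := ε / (C + 1)) (by positivity)
  rw [lt_div_iff₀ (by positivity)] at hwd
  have hlim : Tendsto (fun n => C * dist (y n) d + ‖⟪x n, d⟫_ℂ‖) atTop (𝓝 (C * dist w d + 0)) :=
    ((hy.dist tendsto_const_nhds).const_mul C).add (tendsto_zero_iff_norm_tendsto_zero.1 (hxD d hd))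
  have hlt : C * dist w d + 0 < ε := by linarith [dist_nonneg (x := w) (y := d)]
  obtain ⟨N, hN⟩ := eventually_atTop.1 (hlim.eventually_lt_const hlt)
  refine ⟨N, fun n hn => lt_of_le_of_lt ?_ (hN n hn)⟩
  rw [dist_zero_right, dist_eq_norm, ← sub_add_cancel (y n) d, inner_add_right, sub_add_cancel]
  exact norm_add_le_of_le ((norm_inner_le_norm _ _).trans
    (mul_le_mul_of_nonneg_right (hx n) (norm_nonneg _))) le_rfl

theorem exists_norm_add_norm_eq_one (h : IsEigenvalue (perturb T V) z) :
    ∃ u : T.domain, ‖(u : H)‖ + ‖T u‖ = 1 ∧ T u + V u = z • (u : H) := by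
  obtain ⟨(u : T.domain), hu₀, hu⟩ := h
  change T u + V u = z • (u : H) at hu
  have hpos : 0 < ‖(u : H)‖ + ‖T u‖ :=
    add_pos_of_pos_of_nonneg (norm_pos_iff.2 (Subtype.coe_injective.ne hu₀)) (norm_nonneg _)
  set s := ‖(u : H)‖ + ‖T u‖ with hs
  have hnorm : ‖((s⁻¹ : ℝ) : ℂ)‖ = s⁻¹ := by
    rw [Complex.norm_real, Real.norm_of_nonneg (inv_nonneg.2 hpos.le)]
  refine ⟨((s⁻¹ : ℝ) : ℂ) • u, ?_, ?_⟩
  · rw [LinearPMap.map_smul, SetLike.val_smul, norm_smul, norm_smul, hnorm, ← mul_add, ← hs,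
      inv_mul_cancel₀ hpos.ne']
  · rw [LinearPMap.map_smul, map_smul, ← smul_add, hu, SetLike.val_smul, smul_comm]

/-- Otherwise `(T + V) u = i y u` with `‖u‖ + ‖T u‖ = 1` along a sequence of `y → ∞`. Then `u → 0`,
so `T u → 0` weakly, and a convergent subsequence of `V u` gives `-‖T u‖² = Re ⟪T u, V u⟫ → 0`. -/
theorem IsGraphCompact.exists_mem_resolventSet [CompleteSpace H] (hV : IsGraphCompact T V)
    (hd : Dense (T.domain : Set H)) (hT : T.IsFormalAdjoint T)
    (hres : ∀ y : ℝ, y ≠ 0 → (y * Complex.I : ℂ) ∈ resolventSet T) :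
    ∃ y : ℝ, 0 < y ∧ (y * Complex.I : ℂ) ∈ resolventSet (perturb T V) := by
  by_contra! hcon
  have exists_eigenvector (n : ℕ) : ∃ u : T.domain, ‖(u : H)‖ + ‖T u‖ = 1 ∧
      T u + V u = ((n + 1 : ℝ) * Complex.I : ℂ) • (u : H) := by
    have hn : (0 : ℝ) < n + 1 := n.cast_add_one_pos
    exact_mod_cast exists_norm_add_norm_eq_one
      ((hV.isFredholmPoint (hres _ hn.ne')).isEigenvalue (hcon _ hn))
  choose u hu hTVu using exists_eigenvector
  have norm_Tu_le (n : ℕ) : ‖T (u n)‖ ≤ 1 := by linarith [hu n, norm_nonneg (u n : H)]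
  obtain ⟨w, φ, hφ, hw⟩ := hV u ⟨1, fun n => ⟨by linarith [hu n, norm_nonneg (T (u n))],
    norm_Tu_le n⟩⟩
  have norm_u_le (n : ℕ) : ‖(u n : H)‖ ≤ ‖V (u n)‖ * (1 / (n + 1)) := by
    rw [mul_one_div, le_div_iff₀ n.cast_add_one_pos, mul_comm]
    refine le_of_sq_le_sq ?_ (norm_nonneg _)
    rw [norm_sq_eq_of_apply_add_eq_smul hT (hTVu n)]
    exact le_add_of_nonneg_right (sq_nonneg _)
  have u_tendsto : Tendsto (fun n => (u (φ n) : H)) atTop (𝓝 0) := by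
    refine squeeze_zero_norm (fun n => norm_u_le (φ n)) ?_
    simpa only [mul_zero, Function.comp_def] using hw.norm.mul
      ((tendsto_one_div_add_atTop_nhds_zero_nat (𝕜 := ℝ)).comp hφ.tendsto_atTop)
  have inner_tendsto : Tendsto (fun n => ⟪T (u (φ n)), V (u (φ n))⟫_ℂ) atTop (𝓝 0) := by
    refine tendsto_inner_of_dense hd (fun n => norm_Tu_le (φ n)) (fun d hd => ?_) hw
    have := u_tendsto.inner (𝕜 := ℂ) (tendsto_const_nhds (x := T ⟨d, hd⟩))
    rw [inner_zero_left] at this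
    exact this.congr fun n => (hT _ ⟨d, hd⟩).symm
  have Tu_tendsto : Tendsto (fun n => -‖T (u (φ n))‖ ^ 2) atTop (𝓝 0) := by
    refine ((Complex.continuous_re.tendsto 0).comp inner_tendsto).congr fun n => ?_
    exact re_inner_apply_of_apply_add_eq_smul hT (hTVu (φ n))
  have Tu_tendsto_one : Tendsto (fun n => -‖T (u (φ n))‖ ^ 2) atTop (𝓝 (-(1 - ‖(0 : H)‖) ^ 2)) :=
    ((u_tendsto.norm.const_sub 1).pow 2).neg.congr fun n => by
      rw [← hu (φ n), add_sub_cancel_left]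
  have := tendsto_nhds_unique Tu_tendsto Tu_tendsto_one
  norm_num at this

end SymmetricPerturbation

/-! ### Symmetries of the spectrum -/

section SpectralSymmetry

open scoped LinearPMap

variable {H : Type*} [NormedAddCommGroup H] [InnerProductSpace ℂ H]
  {T S : H →ₗ.[ℂ] H} {z : ℂ}

theorem neg_mem_resolventSet_neg (hz : z ∈ resolventSet T) : -z ∈ resolventSet (-T) := by
  refine ⟨-resolvent T z, fun x => ?_, fun u => ?_⟩
  · refine ⟨neg_mem (resolvent_mem_domain hz x), ?_⟩
    change -T (-⟨resolvent T z x, resolvent_mem_domain hz x⟩) - -z • -resolvent T z x = x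
    rw [LinearPMap.map_neg, apply_resolvent hz]
    module
  · change -resolvent T z (-T (u : T.domain) - -z • (u : H)) = u
    rw [neg_smul, ← neg_sub', map_neg, neg_neg]
    exact resolvent_apply_sub hz u

theorem spectrum_neg (T : H →ₗ.[ℂ] H) : spectrum (-T) = -spectrum T := by
  ext z
  refine not_congr ⟨fun hz => ?_, fun hz => ?_⟩
  · simpa only [neg_neg] using neg_mem_resolventSet_neg hz
  · simpa only [neg_neg] using neg_mem_resolventSet_neg hz

/-- The operator `J T J`, with its natural domain when `J` is an involution. -/
def conjugate (J : H →L[ℂ] H) (T : H →ₗ.[ℂ] H) : H →ₗ.[ℂ] H where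
  domain := T.domain.comap J.toLinearMap
  toFun := J.toLinearMap ∘ₗ T.toFun ∘ₗ J.toLinearMap.restrict fun _ => id

variable {J : H →L[ℂ] H}

theorem conjugate_apply (u : (conjugate J T).domain) : conjugate J T u = J (T ⟨J u, u.2⟩) := rfl

theorem conjugate_eq_neg (hJ : Function.Involutive J)
    (h : ∀ u : T.domain, ∃ hu : J u ∈ T.domain, T ⟨J u, hu⟩ = -J (T u)) :
    conjugate J T = -T := by
  refine LinearPMap.ext ?_ fun x hx hx' => ?_
  · exact Submodule.ext fun x => ⟨fun hx => hJ x ▸ (h ⟨J x, hx⟩).fst, fun hx => (h ⟨x, hx⟩).fst⟩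
  · rw [conjugate_apply, (h ⟨x, hx'⟩).snd, map_neg, hJ, LinearPMap.neg_apply]

theorem isFormalAdjoint_conjugate (hJ : Function.Involutive J)
    (hJ_symm : ∀ x y, ⟪J x, y⟫_ℂ = ⟪x, J y⟫_ℂ)
    (hJT : ∀ u v : T.domain, ⟪J (T u), v⟫_ℂ = ⟪(u : H), J (T v)⟫_ℂ) :
    (conjugate J T).IsFormalAdjoint T := fun u v => by
  rw [conjugate_apply, hJT, hJ_symm, hJ]

theorem conjugate_conjugate (hJ : Function.Involutive J) : conjugate J (conjugate J T) = T := by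
  refine LinearPMap.ext ?_ fun x hx hx' => ?_
  · ext x
    change J (J x) ∈ T.domain ↔ x ∈ T.domain
    rw [hJ]
  · rw [conjugate_apply, conjugate_apply, hJ]
    simp only [hJ x]

theorem exists_conjugate_apply_eq (hJ : Function.Involutive J) (u : T.domain) :
    ∃ h : J u ∈ (conjugate J T).domain, conjugate J T ⟨J u, h⟩ = J (T u) := by
  have hmem : J (J u) ∈ T.domain := (hJ (u : H)).symm ▸ u.2
  refine ⟨hmem, ?_⟩
  rw [conjugate_apply]
  simp only [hJ (u : H)]

theorem mem_resolventSet_conjugate (hJ : Function.Involutive J) (hz : z ∈ resolventSet T) :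
    z ∈ resolventSet (conjugate J T) := by
  refine ⟨J ∘L resolvent T z ∘L J, fun x => ?_, fun u => ?_⟩
  · obtain ⟨hmem, happly⟩ :=
      exists_conjugate_apply_eq hJ ⟨resolvent T z (J x), resolvent_mem_domain hz (J x)⟩
    refine ⟨hmem, (congrArg (· - z • J (resolvent T z (J x))) happly).trans ?_⟩
    rw [apply_resolvent hz, map_add, hJ, map_smul, add_sub_cancel_right]
  · change J (resolvent T z (J (J (T ⟨J u, u.2⟩) - z • (u : H)))) = u
    rw [map_sub, hJ, map_smul, resolvent_apply_sub hz ⟨J u, u.2⟩, hJ]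

theorem spectrum_conjugate (hJ : Function.Involutive J) :
    spectrum (conjugate J T) = spectrum T := by
  rw [spectrum, spectrum, compl_inj_iff]
  refine Set.Subset.antisymm (fun z hz => ?_) fun z => mem_resolventSet_conjugate hJ
  simpa only [conjugate_conjugate hJ] using mem_resolventSet_conjugate hJ hz

theorem mem_orthogonal_range_of_isFormalAdjoint (hST : S.IsFormalAdjoint T) {u : S.domain}
    (hu : S u = z • (u : H)) : (u : H) ∈ (range (shift T (conj z)))ᗮ := by
  rw [Submodule.mem_orthogonal']
  rintro _ ⟨(v : T.domain), rfl⟩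
  change ⟪(u : H), T v - conj z • (v : H)⟫_ℂ = 0
  rw [inner_sub_right, ← hST, hu, inner_smul_left, inner_smul_right, sub_self]

theorem IsEigenvalue.conj_notMem_resolventSet (hz : IsEigenvalue S z)
    (hST : S.IsFormalAdjoint T) : conj z ∉ resolventSet T := by
  intro hρ
  obtain ⟨u, hu₀, hu⟩ := hz
  have hrange : (u : H) ∈ range (shift T (conj z)) := by
    obtain ⟨hmem, hR⟩ := (isBoundedInverse_resolvent hρ).1 u
    exact ⟨⟨_, hmem⟩, hR⟩
  exact hu₀ (Subtype.ext (inner_self_eq_zero.1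
    ((Submodule.mem_orthogonal _ _).1 (mem_orthogonal_range_of_isFormalAdjoint hST hu) _ hrange)))

theorem IsEigenvalue.conjugate (hJ : Function.Involutive J) (hz : IsEigenvalue T z) :
    IsEigenvalue (conjugate J T) z := by
  obtain ⟨u, hu₀, hu⟩ := hz
  obtain ⟨hmem, happly⟩ := exists_conjugate_apply_eq hJ u
  refine ⟨⟨J u, hmem⟩, fun h => hu₀ (Subtype.ext (hJ.injective ?_)), ?_⟩
  · exact (congrArg Subtype.val h).trans (map_zero J).symm
  · rw [happly, hu, map_smul]

theorem finiteDimensional_kernel_of_finiteDimensional_orthogonal (hJ : Function.Involutive J)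
    (hT : (conjugate J T).IsFormalAdjoint T) (hz : conj z = z)
    (hcoker : FiniteDimensional ℂ (range (shift T z))ᗮ) :
    FiniteDimensional ℂ (kernel (shift T z)) := by
  let f : kernel (shift T z) →ₗ[ℂ] (range (shift T z))ᗮ :=
    (J.toLinearMap ∘ₗ T.domain.subtype ∘ₗ (kernel (shift T z)).subtype).codRestrict _ (by
      rintro ⟨(u : T.domain), hu⟩
      replace hu : T u - z • (u : H) = 0 := hu
      obtain ⟨hmem, happly⟩ := exists_conjugate_apply_eq hJ u
      rw [sub_eq_zero.1 hu, map_smul] at happly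
      have := mem_orthogonal_range_of_isFormalAdjoint hT happly
      rwa [hz] at this)
  exact FiniteDimensional.of_injective f fun u v huv =>
    Subtype.ext (Subtype.ext (hJ.injective (congrArg Subtype.val huv)))

theorem eq_of_le_of_mem_resolventSet (hST : S ≤ T) (hS : z ∈ resolventSet S)
    (hT : ¬ IsEigenvalue T z) : S = T := by
  refine LinearPMap.eq_of_le_of_domain_eq hST (hST.1.antisymm fun u hu => ?_)
  lift u to T.domain using hu
  set x := T u - z • (u : H) with hx
  let v : T.domain := ⟨resolvent S z x, hST.1 (resolvent_mem_domain hS x)⟩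
  have hv : T v = x + z • (v : H) :=
    (hST.2 (x := ⟨_, resolvent_mem_domain hS x⟩) rfl).symm.trans (apply_resolvent hS x)
  have huv : u = v := by
    by_contra hne
    refine hT ⟨u - v, sub_ne_zero.2 hne, ?_⟩
    rw [LinearPMap.map_sub, hv, hx, AddSubgroupClass.coe_sub]
    module
  exact huv ▸ resolvent_mem_domain hS x

theorem adjoint_eq_conjugate_of_mem_resolventSet [CompleteSpace H] (hd : Dense (T.domain : Set H))
    (hJ : Function.Involutive J) (hT : (conjugate J T).IsFormalAdjoint T)
    (hz : z ∈ resolventSet T) (hz' : conj z ∈ resolventSet T) : T† = conjugate J T := by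
  refine (eq_of_le_of_mem_resolventSet (hT.symm.le_adjoint hd)
    (mem_resolventSet_conjugate hJ hz) fun h => ?_).symm
  exact h.conj_notMem_resolventSet (LinearPMap.adjoint_isFormalAdjoint hd) hz'

section Perturbation

variable [CompleteSpace H] {V : T.domain →ₗ[ℂ] H}

theorem exists_mul_I_mem_resolventSet_perturb (hV : IsGraphCompact T V)
    (hd : Dense (T.domain : Set H)) (hT : T.IsFormalAdjoint T)
    (hreal : ∀ z ∈ spectrum T, conj z = z) :
    ∃ y : ℝ, (y * Complex.I : ℂ) ∈ resolventSet T ∩ resolventSet (perturb T V) := by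
  have hres (y : ℝ) (hy : y ≠ 0) : (y * Complex.I : ℂ) ∈ resolventSet T := by
    by_contra h
    have := Complex.conj_eq_iff_im.1 (hreal _ h)
    rw [Complex.im_ofReal_mul, Complex.I_im, mul_one] at this
    exact hy this
  obtain ⟨y, hy, hmem⟩ := hV.exists_mem_resolventSet hd hT hres
  exact ⟨y, hres y hy.ne', hmem⟩

theorem eventually_mem_resolventSet_perturb (hV : IsGraphCompact T V)
    (hd : Dense (T.domain : Set H)) (hT : T.IsFormalAdjoint T)
    (hreal : ∀ z ∈ spectrum T, conj z = z) (hconn : IsPreconnected (resolventSet T))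
    (hz : z ∈ resolventSet T) : ∀ᶠ w in 𝓝[≠] z, w ∈ resolventSet (perturb T V) := by
  obtain ⟨y, hy⟩ := exists_mul_I_mem_resolventSet_perturb hV hd hT hreal
  exact eventually_mem_resolventSet_of_isPreconnected hconn
    (fun w hw => hV.isFredholmPoint hw) ⟨_, hy⟩ hz

theorem mem_Delta5_perturb (hV : IsGraphCompact T V)
    (hd : Dense (T.domain : Set H)) (hT : T.IsFormalAdjoint T)
    (hreal : ∀ z ∈ spectrum T, conj z = z) (hconn : IsPreconnected (resolventSet T))
    (hz : z ∈ resolventSet T) : z ∈ Delta5 (perturb T V) := by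
  obtain ⟨y, hy⟩ := exists_mul_I_mem_resolventSet_perturb hV hd hT hreal
  exact ⟨hV.mem_Delta4 hz (isClosed_shift_of_mem_resolventSet hy.2 z),
    eventually_mem_resolventSet_perturb hV hd hT hreal hconn hz⟩

theorem hasFiniteAlgebraicMultiplicity_perturb (hV : IsGraphCompact T V)
    (hd : Dense (T.domain : Set H)) (hT : T.IsFormalAdjoint T)
    (hreal : ∀ z ∈ spectrum T, conj z = z) (hconn : IsPreconnected (resolventSet T))
    (hz : z ∈ resolventSet T) : HasFiniteAlgebraicMultiplicity (perturb T V) z := by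
  have hev := eventually_mem_resolventSet_perturb hV hd hT hreal hconn hz
  exact hasFiniteAlgebraicMultiplicity ((hV.isFredholmPoint hz).meromorphicAt_resolvent hev) hev
    (mem_Delta5_perturb hV hd hT hreal hconn hz).1.1.2.2.1

theorem notMem_Delta1_perturb (hV : IsGraphCompact T V) (hJ : Function.Involutive J)
    (hJV : (conjugate J (perturb T V)).IsFormalAdjoint (perturb T V)) (hz : conj z = z)
    (hsing : HasSingularSequence T z) : z ∉ Delta1 (perturb T V) := by
  rintro ⟨hclosed, hrange, hfin⟩
  exact hV.not_finiteDimensional_kernel hsing hclosed hrange (hfin.elim id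
    (finiteDimensional_kernel_of_finiteDimensional_orthogonal hJ hJV hz))

theorem essentialSpectrum_perturb (hV : IsGraphCompact T V)
    (hd : Dense (T.domain : Set H)) (hT : T.IsFormalAdjoint T)
    (hreal : ∀ z ∈ spectrum T, conj z = z) (hconn : IsPreconnected (resolventSet T))
    (hsing : ∀ z ∈ spectrum T, HasSingularSequence T z) (hJ : Function.Involutive J)
    (hJV : (conjugate J (perturb T V)).IsFormalAdjoint (perturb T V)) (j : Fin 5) :
    essentialSpectrum (perturb T V) j = spectrum T := by
  refine essentialSpectrum_eq (fun z hz => ?_) (fun z hz hzT => ?_) j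
  · exact mem_Delta5_perturb hV hd hT hreal hconn (not_not.1 hz)
  · exact notMem_Delta1_perturb hV hJ hJV (hreal z hzT) (hsing z hzT) hz

theorem conj_mem_spectrum_perturb (hV : IsGraphCompact T V)
    (hreal : ∀ z ∈ spectrum T, conj z = z) (hJ : Function.Involutive J)
    (hJV : (conjugate J (perturb T V)).IsFormalAdjoint (perturb T V))
    (hz : z ∈ spectrum (perturb T V)) : conj z ∈ spectrum (perturb T V) := by
  by_cases hzT : z ∈ resolventSet T
  · exact (((hV.isFredholmPoint hzT).isEigenvalue hz).conjugate hJ).conj_notMem_resolventSet hJV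
  · rwa [hreal z hzT]

theorem adjoint_perturb_eq_conjugate (hV : IsGraphCompact T V)
    (hd : Dense (T.domain : Set H)) (hT : T.IsFormalAdjoint T)
    (hreal : ∀ z ∈ spectrum T, conj z = z) (hJ : Function.Involutive J)
    (hJV : (conjugate J (perturb T V)).IsFormalAdjoint (perturb T V)) :
    (perturb T V)† = conjugate J (perturb T V) := by
  obtain ⟨y, -, hy⟩ := exists_mul_I_mem_resolventSet_perturb hV hd hT hreal
  refine adjoint_eq_conjugate_of_mem_resolventSet hd hJ hJV hy (not_not.1 fun h => ?_)
  have := conj_mem_spectrum_perturb hV hreal hJ hJV h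
  rw [Complex.conj_conj] at this
  exact this hy

end Perturbation

end SpectralSymmetry

/-! ### Weak convergence -/

section Weak

variable {H H' : Type*} [NormedAddCommGroup H] [InnerProductSpace ℂ H] [CompleteSpace H]
  [NormedAddCommGroup H'] [InnerProductSpace ℂ H'] [CompleteSpace H']

theorem exists_subseq_tendsto_inner_sub [TopologicalSpace.SeparableSpace H] {x : ℕ → H} {M : ℝ}
    (hx : ∀ n, ‖x n‖ ≤ M) :
    ∃ (a : H) (φ : ℕ → ℕ), StrictMono φ ∧
      ∀ y, Tendsto (fun n => ⟪y, x (φ n) - a⟫_ℂ) atTop (𝓝 0) := by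
  let toDual := InnerProductSpace.toDual ℂ H
  obtain ⟨ℓ, -, φ, hφ, hℓ⟩ := WeakDual.isSeqCompact_closedBall ℂ H 0 M
    (x := fun n => StrongDual.toWeakDual (toDual (x n))) fun n => by
      rw [Set.mem_preimage, mem_closedBall_zero_iff]
      exact (toDual.norm_map (x n)).trans_le (hx n)
  set a := toDual.symm (WeakDual.toStrongDual ℓ) with ha
  refine ⟨a, φ, hφ, fun y => ?_⟩
  have tendsto_inner : Tendsto (fun n => ⟪x (φ n), y⟫_ℂ) atTop (𝓝 ⟪a, y⟫_ℂ) := by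
    rw [ha, InnerProductSpace.toDual_symm_apply]
    exact tendsto_iff_forall_eval_tendsto_topDualPairing.1 hℓ y
  have tendsto_conj := (Complex.continuous_conj.tendsto _).comp tendsto_inner
  rw [inner_conj_symm] at tendsto_conj
  refine (tendsto_sub_nhds_zero_iff.2 tendsto_conj).congr fun n => ?_
  rw [Function.comp_apply, inner_conj_symm, inner_sub_right]

theorem tendsto_inner_clm_apply (L : H →L[ℂ] H') {x : ℕ → H}
    (hx : ∀ y, Tendsto (fun n => ⟪y, x n⟫_ℂ) atTop (𝓝 0)) (y : H') :
    Tendsto (fun n => ⟪y, L (x n)⟫_ℂ) atTop (𝓝 0) := by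
  refine (hx (ContinuousLinearMap.adjoint L y)).congr fun n => ?_
  rw [ContinuousLinearMap.adjoint_inner_left]

theorem exists_subseq_tendsto_inner_sub_of_graph_bounded [TopologicalSpace.SeparableSpace H]
    {T : H →ₗ.[ℂ] H} {z : ℂ} (hz : z ∈ resolventSet T) {u : ℕ → T.domain} {C : ℝ}
    (hu : ∀ n, ‖(u n : H)‖ ≤ C) (hTu : ∀ n, ‖T (u n)‖ ≤ C) :
    ∃ (a : T.domain) (φ : ℕ → ℕ), StrictMono φ ∧
      ∀ y, Tendsto (fun n => ⟪y, ((u (φ n) - a : T.domain) : H)⟫_ℂ) atTop (𝓝 0) := by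
  obtain ⟨w, φ, hφ, hw⟩ := exists_subseq_tendsto_inner_sub
    (x := fun n => T (u n) - z • (u n : H)) (M := C + ‖z‖ * C) fun n =>
      norm_sub_le_of_le (hTu n) ((norm_smul _ _).trans_le (by gcongr; exact hu n))
  refine ⟨⟨resolvent T z w, resolvent_mem_domain hz w⟩, φ, hφ, fun y => ?_⟩
  refine (tendsto_inner_clm_apply (resolvent T z) hw y).congr fun n => ?_
  rw [map_sub, resolvent_apply_sub hz, Submodule.coe_sub]

end Weak

end

end UnboundedOp

namespace MatrixSchrodinger

open MeasureTheory Filter Topology FourierTransform UnboundedOp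
open scoped ENNReal InnerProductSpace SchwartzMap Matrix ComplexConjugate

noncomputable section

/-! ### The Fourier transform and the Laplacian -/

section FourierInversion

variable {V F : Type*} [NormedAddCommGroup V] [InnerProductSpace ℝ V] [FiniteDimensional ℝ V]
  [MeasurableSpace V] [BorelSpace V] [NormedAddCommGroup F] [NormedSpace ℂ F]

theorem ae_eq_of_forall_integral_schwartz_smul_eq [CompleteSpace F] {f g : V → F}
    (hf : LocallyIntegrable f) (hg : LocallyIntegrable g)
    (h : ∀ u : 𝓢(V, ℂ), ∫ x, u x • f x = ∫ x, u x • g x) : f =ᵐ[volume] g := by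
  refine ae_eq_of_integral_contDiff_smul_eq hf hg fun φ hφ hφc => ?_
  have hsupp : HasCompactSupport (Complex.ofRealCLM ∘ φ) := hφc.comp_left rfl
  simpa only [HasCompactSupport.toSchwartzMap_toFun, Function.comp_apply,
    Complex.ofRealCLM_apply, Complex.coe_smul] using
    h (hsupp.toSchwartzMap (Complex.ofRealCLM.contDiff.comp hφ))

theorem continuous_fourierInv {g : V → F} (hg : Integrable g) : Continuous (𝓕⁻ g) := by
  rw [← Real.Lp.fourierTransformInv_toLp (memLp_one_iff_integrable.2 hg)]
  exact map_continuous _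

theorem integral_fourierInv_smul_eq [CompleteSpace F] {u : V → ℂ} {g : V → F} (hu : Integrable u)
    (hg : Integrable g) : ∫ ξ, 𝓕⁻ u ξ • g ξ = ∫ x, u x • 𝓕⁻ g x := by
  have hflip : (-innerₗ V).flip = -innerₗ V := by ext; simp [real_inner_comm]
  have h := VectorFourier.integral_fourierIntegral_smul_eq_flip (μ := volume) (ν := volume)
    (L := -innerₗ V) Real.continuous_fourierChar
    (continuous_inner.neg : Continuous fun p : V × V => -(inner ℝ p.1 p.2)) hu hg
  rwa [hflip] at h

end FourierInversion

theorem locallyIntegrable_coeFn {d : ℕ} {F : Type*} [NormedAddCommGroup F] (f : L2 d F) :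
    LocallyIntegrable f volume :=
  (Lp.memLp f).locallyIntegrable one_le_two

section Fourier

open TemperedDistribution

variable {d : ℕ} {F : Type*} [NormedAddCommGroup F] [InnerProductSpace ℂ F]

theorem toDistr_apply [CompleteSpace F] (f : L2 d F) (u : 𝓢(Space d, ℂ)) :
    toDistr d F f u = ∫ x, u x • f x :=
  Lp.toTemperedDistribution_apply f u

variable [CompleteSpace F]

theorem fourier_toDistr (f : L2 d F) : 𝓕 (toDistr d F f) = toDistr d F (𝓕 f) :=
  Lp.fourier_toTemperedDistribution_eq f

theorem fourier_injective {f g : L2 d F} (h : (𝓕 f : L2 d F) =ᵐ[volume] (𝓕 g : L2 d F)) : f = g :=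
  (Lp.fourierTransformₗᵢ (Space d) F).injective (Lp.ext h)

theorem coeFn_fourier_smul (c : ℂ) (f : L2 d F) :
    (𝓕 (c • f) : L2 d F) =ᵐ[volume] fun ξ => c • (𝓕 f : L2 d F) ξ := by
  rw [FourierTransform.fourier_smul]
  exact Lp.coeFn_smul _ _

theorem coeFn_fourier_sub (f g : L2 d F) :
    (𝓕 (f - g) : L2 d F) =ᵐ[volume] fun ξ => (𝓕 f : L2 d F) ξ - (𝓕 g : L2 d F) ξ := by
  have h : (𝓕 (f - g) : L2 d F) = 𝓕 f - 𝓕 g := (Lp.fourierTransformₗᵢ (Space d) F).map_sub f g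
  rw [h]
  exact Lp.coeFn_sub _ _

theorem norm_le_of_norm_fourier_le {f g : L2 d F} {c : ℝ}
    (h : ∀ᵐ ξ, ‖(𝓕 f : L2 d F) ξ‖ ≤ c * ‖(𝓕 g : L2 d F) ξ‖) : ‖f‖ ≤ c * ‖g‖ := by
  rw [← Lp.norm_fourier_eq f, ← Lp.norm_fourier_eq g]
  exact Lp.norm_le_mul_norm_of_ae_le_mul h

theorem ae_eq_fourierInv {f : L2 d F} {g : Space d → F} (hg : Integrable g)
    (hfg : (𝓕 f : L2 d F) =ᵐ[volume] g) : f =ᵐ[volume] 𝓕⁻ g := by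
  refine ae_eq_of_forall_integral_schwartz_smul_eq (locallyIntegrable_coeFn f)
    (continuous_fourierInv hg).locallyIntegrable fun u => ?_
  have hinv : toDistr d F f = 𝓕⁻ (toDistr d F (𝓕 f)) := by
    rw [← fourier_toDistr, fourierInv_fourier_eq]
  calc ∫ x, u x • f x = ∫ ξ, (𝓕⁻ u) ξ • (𝓕 f : L2 d F) ξ := by
        rw [← toDistr_apply, hinv, TemperedDistribution.fourierInv_apply, toDistr_apply]
    _ = ∫ ξ, 𝓕⁻ (u : Space d → ℂ) ξ • g ξ := by
        rw [SchwartzMap.fourierInv_coe]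
        exact integral_congr_ae (hfg.mono fun ξ h => congrArg _ h)
    _ = ∫ x, u x • 𝓕⁻ g x := integral_fourierInv_smul_eq u.integrable hg

theorem smulLeftCLM_toDistr_eq_iff {a : Space d → ℂ} (ha : a.HasTemperateGrowth) (f h : L2 d F) :
    smulLeftCLM F a (toDistr d F f) = toDistr d F h ↔ h =ᵐ[volume] fun x => a x • f x := by
  have smulLeft_apply (u : 𝓢(Space d, ℂ)) :
      smulLeftCLM F a (toDistr d F f) u = ∫ x, u x • a x • f x := by
    simp only [smulLeftCLM_apply_apply, toDistr_apply, SchwartzMap.smulLeftCLM_apply_apply ha,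
      smul_eq_mul, smul_smul, mul_comm]
  constructor
  · intro heq
    refine ae_eq_of_forall_integral_schwartz_smul_eq (locallyIntegrable_coeFn h)
      ((locallyIntegrable_coeFn f).continuous_smul ha.1.continuous) fun u => ?_
    rw [← smulLeft_apply, heq, toDistr_apply]
  · intro hae
    ext u
    rw [smulLeft_apply, toDistr_apply]
    exact integral_congr_ae (hae.mono fun x hx => by simp only [hx])

end Fourier

section Laplacian

open TemperedDistribution
open scoped Laplacian

variable {d : ℕ} {F : Type*} [NormedAddCommGroup F] [InnerProductSpace ℂ F]

/-- The symbol of `-Δ`. The factor `2 π` comes from the normalization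
`𝓕 f ξ = ∫ exp (-2 π i ⟪x, ξ⟫) f x` of the Fourier transform. -/
def symbol (ξ : Space d) : ℝ := (2 * Real.pi) ^ 2 * ‖ξ‖ ^ 2

theorem symbol_nonneg (ξ : Space d) : 0 ≤ symbol ξ := by unfold symbol; positivity

theorem sq_norm_le_symbol (ξ : Space d) : ‖ξ‖ ^ 2 ≤ symbol ξ :=
  le_mul_of_one_le_left (by positivity) (one_le_pow₀ (by linarith [Real.pi_gt_three]))

theorem norm_symbol (ξ : Space d) : ‖(symbol ξ : ℂ)‖ = symbol ξ := by
  rw [Complex.norm_real, Real.norm_of_nonneg (symbol_nonneg ξ)]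

@[fun_prop]
theorem continuous_symbol : Continuous (symbol : Space d → ℝ) := by unfold symbol; fun_prop

theorem memLp_one_add_sq_norm_smul_iff {f : Space d → F} (hf : MemLp f 2) :
    MemLp (fun ξ => ((1 + ‖ξ‖ ^ 2 : ℝ) : ℂ) • f ξ) 2 ↔ MemLp (fun ξ => (symbol ξ : ℂ) • f ξ) 2 := by
  have hpi : (2 * Real.pi : ℂ) ^ 2 ≠ 0 := by simp [Real.pi_ne_zero]
  constructor
  · intro h
    refine ((h.sub hf).const_smul ((2 * Real.pi : ℂ) ^ 2)).ae_eq (.of_forall fun ξ => ?_)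
    simp only [Pi.smul_apply, Pi.sub_apply, symbol]
    push_cast
    module
  · intro h
    refine (hf.add (h.const_smul ((2 * Real.pi : ℂ) ^ 2)⁻¹)).ae_eq (.of_forall fun ξ => ?_)
    simp only [Pi.smul_apply, Pi.add_apply, symbol, smul_smul]
    push_cast
    rw [inv_mul_cancel_left₀ hpi]
    module

variable [CompleteSpace F]

theorem mem_laplacian_domain_iff (f : L2 d F) :
    f ∈ (laplacian d F).domain ↔ MemLp (fun ξ => (symbol ξ : ℂ) • (𝓕 f : L2 d F) ξ) 2 := by
  rw [← memLp_one_add_sq_norm_smul_iff (Lp.memLp _)]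
  change MemSobolev 2 2 (toDistr d F f) ↔ _
  have hexp : (fun ξ : Space d => (((1 + ‖ξ‖ ^ 2) ^ ((2 : ℝ) / 2) : ℝ) : ℂ)) =
      fun ξ => ((1 + ‖ξ‖ ^ 2 : ℝ) : ℂ) := by
    ext ξ
    rw [div_self two_ne_zero, Real.rpow_one]
  have hgrowth : (fun ξ : Space d => ((1 + ‖ξ‖ ^ 2 : ℝ) : ℂ)).HasTemperateGrowth := by fun_prop
  rw [memSobolev_iff_exists_smulLeftCLM_fourier, fourier_toDistr, hexp]
  constructor
  · rintro ⟨h, hh⟩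
    exact (Lp.memLp h).ae_eq ((smulLeftCLM_toDistr_eq_iff hgrowth _ h).1 hh)
  · intro h
    exact ⟨h.toLp _, (smulLeftCLM_toDistr_eq_iff hgrowth _ _).2 h.coeFn_toLp⟩

theorem fourier_laplacian (f : (laplacian d F).domain) :
    (𝓕 (laplacian d F f) : L2 d F) =ᵐ[volume]
      fun ξ => -(symbol ξ : ℂ) • (𝓕 (f : L2 d F) : L2 d F) ξ := by
  have hgrowth : (fun ξ : Space d => -(symbol ξ : ℂ)).HasTemperateGrowth := by
    unfold symbol
    fun_prop
  have hsymbol : (fun ξ : Space d => -(symbol ξ : ℂ)) =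
      (-((2 * Real.pi : ℝ) : ℂ) ^ 2) • fun ξ : Space d => ((‖ξ‖ ^ 2 : ℝ) : ℂ) := by
    ext ξ
    simp [symbol]
  have hΔ : toDistr d F (laplacian d F f) = Δ (toDistr d F (f : L2 d F)) :=
    (exists_laplacian d F f).choose_spec
  refine (smulLeftCLM_toDistr_eq_iff hgrowth _ _).1 ?_
  rw [← fourier_toDistr, ← fourier_toDistr, hΔ, laplacian_eq_fourierMultiplierCLM,
    fourierMultiplierCLM_apply, hsymbol, smulLeftCLM_smul (by fun_prop), ← Complex.coe_smul,
    FourierTransform.fourier_smul, fourier_fourierInv_eq]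
  simp

theorem exists_laplacian_eq {f g : L2 d F}
    (h : (𝓕 g : L2 d F) =ᵐ[volume] fun ξ => -(symbol ξ : ℂ) • (𝓕 f : L2 d F) ξ) :
    ∃ hf : f ∈ (laplacian d F).domain, laplacian d F ⟨f, hf⟩ = g := by
  have hf : f ∈ (laplacian d F).domain := by
    refine (mem_laplacian_domain_iff f).2 ((Lp.memLp (𝓕 g : L2 d F)).neg.ae_eq ?_)
    filter_upwards [h] with ξ hξ
    rw [Pi.neg_apply, hξ, neg_smul, neg_neg]
  exact ⟨hf, fourier_injective ((fourier_laplacian ⟨f, hf⟩).trans h.symm)⟩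

theorem isFormalAdjoint_laplacian : (laplacian d F).IsFormalAdjoint (laplacian d F) := by
  intro f g
  rw [← Lp.inner_fourier_eq, ← Lp.inner_fourier_eq (f : L2 d F), L2.inner_def, L2.inner_def]
  refine integral_congr_ae ?_
  filter_upwards [fourier_laplacian f, fourier_laplacian g] with ξ hf hg
  rw [hf, hg, inner_smul_left, inner_smul_right]
  simp

theorem toLp_mem_laplacian_domain (u : 𝓢(Space d, F)) :
    u.toLp 2 volume ∈ (laplacian d F).domain := by
  have hu : toDistr d F (u.toLp 2 volume) = (u : 𝓢'(Space d, F)) :=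
    Lp.toTemperedDistribution_toLp_eq u
  change MemSobolev 2 2 (toDistr d F (u.toLp 2 volume))
  rw [hu]
  exact u.memSobolev

theorem dense_laplacian_domain : Dense ((laplacian d F).domain : Set (L2 d F)) :=
  (SchwartzMap.denseRange_toLpCLM (E := Space d) (F := F) (p := 2) (by norm_num)).mono <| by
    rintro _ ⟨u, rfl⟩
    exact toLp_mem_laplacian_domain u

end Laplacian

section CompLp

variable {d : ℕ} {F F' : Type*} [NormedAddCommGroup F] [InnerProductSpace ℂ F] [CompleteSpace F]
  [NormedAddCommGroup F'] [InnerProductSpace ℂ F'] [CompleteSpace F']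

theorem toDistr_compLpL (L : F →L[ℂ] F') (f : L2 d F) (u : 𝓢(Space d, ℂ)) :
    toDistr d F' (L.compLpL 2 volume f) u = L (toDistr d F f u) := by
  rw [toDistr_apply, toDistr_apply, ← L.integral_comp_comm]
  · exact integral_congr_ae ((L.coeFn_compLpL f).mono fun x hx => by simp only [hx, map_smul])
  · exact memLp_one_iff_integrable.1 ((Lp.memLp f).smul (u.memLp 2 volume))

theorem fourier_compLpL (L : F →L[ℂ] F') (f : L2 d F) :
    (𝓕 (L.compLpL 2 volume f) : L2 d F') = L.compLpL 2 volume (𝓕 f : L2 d F) := by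
  apply toDistr_injective d F'
  rw [← fourier_toDistr]
  ext u
  rw [TemperedDistribution.fourier_apply, toDistr_compLpL, toDistr_compLpL, ← fourier_toDistr,
    TemperedDistribution.fourier_apply]

theorem exists_laplacian_compLpL_eq (L : F →L[ℂ] F') (f : (laplacian d F).domain) :
    ∃ hLf : L.compLpL 2 volume (f : L2 d F) ∈ (laplacian d F').domain,
      laplacian d F' ⟨_, hLf⟩ = L.compLpL 2 volume (laplacian d F f) := by
  refine exists_laplacian_eq ?_
  rw [fourier_compLpL, fourier_compLpL]
  filter_upwards [fourier_laplacian f, L.coeFn_compLpL (𝓕 (f : L2 d F) : L2 d F),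
    L.coeFn_compLpL (𝓕 (laplacian d F f) : L2 d F)] with ξ hΔ hLf hLΔ
  rw [hLΔ, hLf, hΔ, map_smul]

end CompLp

section FourierMul

variable {d : ℕ} {F : Type*} [NormedAddCommGroup F] [InnerProductSpace ℂ F] [CompleteSpace F]

/-- The Fourier multiplier `𝓕⁻¹ a 𝓕` with bounded symbol `a`. -/
def fourierMul {a : Space d → ℂ} (ha : MemLp a ∞ (volume : Measure (Space d))) :
    L2 d F →L[ℂ] L2 d F :=
  (Lp.fourierTransformₗᵢ (Space d) F).symm.toContinuousLinearEquiv.toContinuousLinearMap ∘L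
    ((ContinuousLinearMap.lsmul ℂ ℂ).holderL volume ∞ 2 2 (ha.toLp a)) ∘L
      (Lp.fourierTransformₗᵢ (Space d) F).toContinuousLinearEquiv.toContinuousLinearMap

theorem fourier_fourierMul {a : Space d → ℂ} (ha : MemLp a ∞) (f : L2 d F) :
    (𝓕 (fourierMul ha f) : L2 d F) =ᵐ[volume] fun ξ => a ξ • (𝓕 f : L2 d F) ξ := by
  have h : (𝓕 (fourierMul ha f) : L2 d F) =
      (ContinuousLinearMap.lsmul ℂ ℂ).holder 2 (ha.toLp a) (𝓕 f : L2 d F) :=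
    (Lp.fourierTransformₗᵢ (Space d) F).apply_symm_apply _
  rw [h]
  filter_upwards [(ContinuousLinearMap.lsmul ℂ ℂ).coeFn_holder (r := 2) (ha.toLp a)
    (𝓕 f : L2 d F), ha.coeFn_toLp] with ξ hmul hcoe
  rw [hmul, hcoe, ContinuousLinearMap.lsmul_apply]

theorem exists_laplacian_fourierMul_eq {a : Space d → ℂ} (ha : MemLp a ∞)
    (f : (laplacian d F).domain) :
    ∃ hf : fourierMul ha (f : L2 d F) ∈ (laplacian d F).domain,
      laplacian d F ⟨_, hf⟩ = fourierMul ha (laplacian d F f) := by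
  refine exists_laplacian_eq ?_
  filter_upwards [fourier_laplacian f, fourier_fourierMul ha (f : L2 d F),
    fourier_fourierMul ha (laplacian d F f)] with ξ hΔ hf hf'
  rw [hf', hf, hΔ, smul_comm]

end FourierMul

/-! ### Decaying potentials -/

section Resolvent

variable {d : ℕ} {F : Type*} [NormedAddCommGroup F] [InnerProductSpace ℂ F] [CompleteSpace F]
  {w : ℂ}

theorem symbol_sub_ne_zero (hw : w ∉ Complex.ofReal '' Set.Ici 0) (ξ : Space d) :
    (symbol ξ : ℂ) - w ≠ 0 :=
  sub_ne_zero.2 fun h => hw ⟨symbol ξ, symbol_nonneg ξ, h⟩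

theorem memLp_inv_symbol_sub (hw : w ∉ Complex.ofReal '' Set.Ici 0) :
    MemLp (fun ξ : Space d => ((symbol ξ : ℂ) - w)⁻¹) ∞ := by
  have isClosed_image : IsClosed (Complex.ofReal '' Set.Ici 0) :=
    Complex.isometry_ofReal.isClosedEmbedding.isClosedMap _ isClosed_Ici
  have infDist_pos : 0 < Metric.infDist w (Complex.ofReal '' Set.Ici 0) :=
    (isClosed_image.notMem_iff_infDist_pos (Set.nonempty_Ici.image _)).1 hw
  have hcont : Continuous fun ξ : Space d => ((symbol ξ : ℂ) - w)⁻¹ :=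
    Continuous.inv₀ (by fun_prop) (symbol_sub_ne_zero hw)
  refine memLp_top_of_bound hcont.aestronglyMeasurable
    (Metric.infDist w (Complex.ofReal '' Set.Ici 0))⁻¹ (.of_forall fun ξ => ?_)
  rw [norm_inv, ← dist_eq_norm, dist_comm]
  gcongr
  exact Metric.infDist_le_dist_of_mem ⟨symbol ξ, symbol_nonneg ξ, rfl⟩

theorem mem_resolventSet_neg_laplacian (hw : w ∉ Complex.ofReal '' Set.Ici 0) :
    w ∈ resolventSet (-laplacian d F) := by
  set R : L2 d F →L[ℂ] L2 d F := fourierMul (memLp_inv_symbol_sub hw)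
  have fourier_R (f : L2 d F) := fourier_fourierMul (memLp_inv_symbol_sub hw) f
  refine ⟨R, fun f => ?_, fun u => fourier_injective ?_⟩
  · obtain ⟨hRf, hΔ⟩ : ∃ hRf : R f ∈ (laplacian d F).domain,
        laplacian d F ⟨R f, hRf⟩ = -w • R f - f := by
      refine exists_laplacian_eq ?_
      filter_upwards [coeFn_fourier_sub (-w • R f) f, coeFn_fourier_smul (-w) (R f),
        fourier_R f] with ξ hsub hsmul hR
      have := symbol_sub_ne_zero hw ξ
      rw [hsub, hsmul, hR]
      match_scalars
      field
    refine ⟨hRf, ?_⟩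
    change -laplacian d F ⟨R f, hRf⟩ - w • R f = f
    rw [hΔ]
    module
  · have shift_eq : shift (-laplacian d F) w u =
        (-1 : ℂ) • laplacian d F u - w • (u : L2 d F) := by
      change -laplacian d F u - w • (u : L2 d F) = _
      module
    rw [shift_eq]
    filter_upwards [fourier_R ((-1 : ℂ) • laplacian d F u - w • (u : L2 d F)),
      coeFn_fourier_sub ((-1 : ℂ) • laplacian d F u) (w • (u : L2 d F)),
      coeFn_fourier_smul (-1) (laplacian d F u), coeFn_fourier_smul w (u : L2 d F),
      fourier_laplacian u] with ξ hR hsub hneg hsmul hΔ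
    have := symbol_sub_ne_zero hw ξ
    rw [hR, hsub, hneg, hsmul, hΔ]
    match_scalars
    field

end Resolvent

section DominatedConvergence

variable {α E : Type*} [MeasurableSpace α] {μ : Measure α} [NormedAddCommGroup E]

theorem tendsto_eLpNorm_zero_of_dominated {p : ℝ≥0∞} (hp₀ : p ≠ 0) (hp : p ≠ ∞) {f : ℕ → α → E}
    {g : α → ℝ} (hf : ∀ n, AEStronglyMeasurable (f n) μ) (hg : MemLp g p μ)
    (hfg : ∀ n, ∀ᵐ x ∂μ, ‖f n x‖ ≤ g x)
    (hlim : ∀ᵐ x ∂μ, Tendsto (fun n => f n x) atTop (𝓝 0)) :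
    Tendsto (fun n => eLpNorm (f n) p μ) atTop (𝓝 0) := by
  have hp_pos : 0 < p.toReal := ENNReal.toReal_pos hp₀ hp
  have tendsto_lintegral : Tendsto (fun n => ∫⁻ x, ‖f n x‖ₑ ^ p.toReal ∂μ) atTop
      (𝓝 (∫⁻ _, 0 ∂μ)) := by
    refine tendsto_lintegral_of_dominated_convergence' (fun x => ‖g x‖ₑ ^ p.toReal)
      (fun n => (hf n).enorm.pow_const _) (fun n => ?_)
      (lintegral_rpow_enorm_lt_top_of_eLpNorm_lt_top hp₀ hp hg.2).ne ?_
    · filter_upwards [hfg n] with x hx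
      gcongr
      exact enorm_le_iff_norm_le.2 (hx.trans (le_abs_self _))
    · filter_upwards [hlim] with x hx
      simpa [hp_pos] using hx.enorm.ennrpow_const p.toReal
  rw [lintegral_zero] at tendsto_lintegral
  simp only [eLpNorm_eq_lintegral_rpow_enorm_toReal hp₀ hp]
  simpa [hp_pos] using tendsto_lintegral.ennrpow_const (1 / p.toReal)

theorem norm_le_eLpNorm_indicator_add {p : ℝ≥0∞} [Fact (1 ≤ p)] {s : Set α} (hs : MeasurableSet s)
    {c : ℝ} (hc : 0 ≤ c) {f g : Lp E p μ} (hfg : ∀ᵐ x ∂μ, x ∉ s → ‖f x‖ ≤ c * ‖g x‖) :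
    ‖f‖ ≤ (eLpNorm (s.indicator f) p μ).toReal + c * ‖g‖ := by
  have hin : MemLp (s.indicator f) p μ := (Lp.memLp f).indicator hs
  have hout : MemLp (sᶜ.indicator f) p μ := (Lp.memLp f).indicator hs.compl
  have norm_out_le : ‖hout.toLp _‖ ≤ c * ‖g‖ := by
    refine Lp.norm_le_mul_norm_of_ae_le_mul ?_
    filter_upwards [hout.coeFn_toLp, hfg] with x hcoe hx
    rw [hcoe]
    by_cases hxs : x ∈ s
    · rw [Set.indicator_of_notMem (Set.notMem_compl_iff.2 hxs), norm_zero]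
      positivity
    · rw [Set.indicator_of_mem hxs]
      exact hx hxs
  have eq_add : f = hin.toLp _ + hout.toLp _ := by
    rw [← MemLp.toLp_add hin hout]
    exact Lp.ext (MemLp.coeFn_toLp _ |>.trans (.of_eq (Set.indicator_self_add_compl s f))).symm
  calc ‖f‖ ≤ ‖hin.toLp _‖ + ‖hout.toLp _‖ := (congrArg _ eq_add).trans_le (norm_add_le _ _)
    _ ≤ _ := by
        rw [Lp.norm_toLp]
        gcongr

end DominatedConvergence

section LowPass

variable {d : ℕ}

theorem memLp_indicator_one {s : Set (Space d)} (hs : MeasurableSet s) :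
    MemLp (s.indicator fun _ => (1 : ℂ)) ∞ (volume : Measure (Space d)) :=
  (memLp_top_const (1 : ℂ)).indicator hs

/-- Truncation to the frequencies `‖ξ‖ ≤ N`. -/
def lowPass (N : ℝ) : L2 d ℂ →L[ℂ] L2 d ℂ :=
  fourierMul (memLp_indicator_one (measurableSet_closedBall (x := (0 : Space d)) (ε := N)))

theorem fourier_lowPass (N : ℝ) (f : L2 d ℂ) :
    (𝓕 (lowPass N f) : L2 d ℂ) =ᵐ[volume]
      (Metric.closedBall (0 : Space d) N).indicator (𝓕 f : L2 d ℂ) := by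
  filter_upwards [fourier_fourierMul (memLp_indicator_one
    (measurableSet_closedBall (x := (0 : Space d)) (ε := N))) f] with ξ hξ
  rw [lowPass, hξ, ← Set.indicator_smul_apply_left]
  simp only [one_smul]

theorem fourier_sub_lowPass (N : ℝ) (f : L2 d ℂ) :
    (𝓕 (f - lowPass N f) : L2 d ℂ) =ᵐ[volume]
      (Metric.closedBall (0 : Space d) N)ᶜ.indicator (𝓕 f : L2 d ℂ) := by
  filter_upwards [coeFn_fourier_sub f (lowPass N f), fourier_lowPass N f] with ξ hsub hlow
  rw [hsub, hlow, Set.indicator_compl, Pi.sub_apply]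

theorem norm_lowPass_le (N : ℝ) (f : L2 d ℂ) : ‖lowPass N f‖ ≤ ‖f‖ := by
  rw [← one_mul ‖f‖]
  refine norm_le_of_norm_fourier_le ?_
  filter_upwards [fourier_lowPass N f] with ξ hξ
  rw [hξ, one_mul]
  exact norm_indicator_le_norm_self _ _

theorem norm_sub_lowPass_le (N : ℝ) (f : L2 d ℂ) : ‖f - lowPass N f‖ ≤ ‖f‖ := by
  rw [← one_mul ‖f‖]
  refine norm_le_of_norm_fourier_le ?_
  filter_upwards [fourier_sub_lowPass N f] with ξ hξ
  rw [hξ, one_mul]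
  exact norm_indicator_le_norm_self _ _

theorem norm_sub_lowPass_le_norm_laplacian {N : ℝ} (hN : 0 < N) (u : (laplacian d ℂ).domain) :
    ‖(u : L2 d ℂ) - lowPass N (u : L2 d ℂ)‖ ≤ (N ^ 2)⁻¹ * ‖laplacian d ℂ u‖ := by
  refine norm_le_of_norm_fourier_le ?_
  filter_upwards [fourier_sub_lowPass N (u : L2 d ℂ), fourier_laplacian u] with ξ hhigh hΔ
  rw [hhigh, hΔ]
  by_cases hξ : ξ ∈ Metric.closedBall (0 : Space d) N
  · rw [Set.indicator_of_notMem (Set.notMem_compl_iff.2 hξ), norm_zero]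
    positivity
  · rw [mem_closedBall_zero_iff, not_le] at hξ
    have le_symbol : N ^ 2 ≤ symbol ξ := (by gcongr : N ^ 2 ≤ ‖ξ‖ ^ 2).trans (sq_norm_le_symbol ξ)
    rw [Set.indicator_of_mem (by simpa using hξ), norm_smul, norm_neg, norm_symbol, ← mul_assoc,
      inv_mul_eq_div]
    exact le_mul_of_one_le_left (norm_nonneg _) ((one_le_div (by positivity)).2 le_symbol)

end LowPass

section Decay

variable {d : ℕ}

theorem exists_lowPass_ae_eq_inner (N : ℝ) :
    ∃ (k : Space d → L2 d ℂ) (K : ℝ), (∀ x, ‖k x‖ ≤ K) ∧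
      ∀ f, lowPass N f =ᵐ[volume] fun x => ⟪k x, f⟫_ℂ := by
  set s := Metric.closedBall (0 : Space d) N
  have hs : MeasurableSet s := measurableSet_closedBall
  have hs_fin : volume s ≠ ⊤ := measure_closedBall_lt_top.ne
  let e (x ξ : Space d) : ℂ := s.indicator (fun ξ => (Real.fourierChar (-inner ℝ ξ x) : ℂ)) ξ
  have norm_e (x ξ : Space d) : ‖e x ξ‖ = ‖s.indicator (fun _ => (1 : ℂ)) ξ‖ := by
    simp only [e, norm_indicator_eq_indicator_norm, Circle.norm_coe, norm_one]
  have memLp_e (x : Space d) : MemLp (e x) 2 := by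
    have hcont : Continuous fun ξ : Space d => (Real.fourierChar (-inner ℝ ξ x) : ℂ) :=
      continuous_subtype_val.comp (Real.continuous_fourierChar.comp (by fun_prop))
    exact (memLp_indicator_const 2 hs (1 : ℂ) (.inr hs_fin)).mono
      (hcont.aestronglyMeasurable.indicator hs) (.of_forall fun ξ => (norm_e x ξ).le)
  refine ⟨fun x => (Lp.fourierTransformₗᵢ (Space d) ℂ).symm ((memLp_e x).toLp _),
    ‖indicatorConstLp 2 hs hs_fin (1 : ℂ)‖, fun x => ?_, fun f => ?_⟩
  · rw [LinearIsometryEquiv.norm_map]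
    refine Lp.norm_le_norm_of_ae_le ?_
    filter_upwards [(memLp_e x).coeFn_toLp,
      indicatorConstLp_coeFn (p := 2) (hs := hs) (hμs := hs_fin) (c := (1 : ℂ))] with ξ he hone
    rw [he, hone, norm_e]
  · have integrable_fourier : Integrable (s.indicator (𝓕 f : L2 d ℂ)) := by
      rw [integrable_indicator_iff hs]
      have : IsFiniteMeasure (volume.restrict s) := isFiniteMeasure_restrict.2 hs_fin
      exact ((Lp.memLp (𝓕 f : L2 d ℂ)).restrict s).integrable one_le_two
    filter_upwards [ae_eq_fourierInv integrable_fourier (fourier_lowPass N f)] with x hx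
    have inner_symm : ⟪(Lp.fourierTransformₗᵢ (Space d) ℂ).symm ((memLp_e x).toLp _), f⟫_ℂ =
        ⟪(memLp_e x).toLp _, (𝓕 f : L2 d ℂ)⟫_ℂ := by
      rw [← LinearIsometryEquiv.inner_map_map (Lp.fourierTransformₗᵢ (Space d) ℂ),
        LinearIsometryEquiv.apply_symm_apply]
      rfl
    rw [hx, Real.fourierInv_eq, inner_symm, L2.inner_def]
    refine integral_congr_ae ?_
    filter_upwards [(memLp_e x).coeFn_toLp] with ξ he
    rw [he]
    by_cases hξ : ξ ∈ s <;> simp [e, hξ, Circle.smul_def, mul_comm]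

theorem exists_forall_norm_lowPass_le_and_tendsto (N : ℝ) {f : ℕ → L2 d ℂ} {M : ℝ}
    (hM : ∀ n, ‖f n‖ ≤ M) (hf : ∀ y, Tendsto (fun n => ⟪y, f n⟫_ℂ) atTop (𝓝 0)) :
    ∃ K : ℝ, ∀ᵐ x, (∀ n, ‖lowPass N (f n) x‖ ≤ K) ∧
      Tendsto (fun n => lowPass N (f n) x) atTop (𝓝 0) := by
  obtain ⟨k, K, hkK, hk⟩ := exists_lowPass_ae_eq_inner (d := d) N
  have hK : 0 ≤ K := (norm_nonneg _).trans (hkK 0)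
  refine ⟨K * M, ?_⟩
  filter_upwards [ae_all_iff.2 fun n => hk (f n)] with x hx
  simp only [hx]
  exact ⟨fun n => (norm_inner_le_norm _ _).trans (mul_le_mul (hkK x) (hM n) (norm_nonneg _) hK),
    hf (k x)⟩

theorem coeFn_scalarMultiplication (X : Space d → ℝ) (u : (scalarMultiplication X).domain) :
    scalarMultiplication X u =ᵐ[volume] fun x => (X x : ℂ) * (u : L2 d ℂ) x :=
  (mem_multiplicationDomain _ u).coeFn_toLp

open scoped ContDiff in
theorem memLp_indicator_closedBall {X : Space d → ℝ} (hX : AEStronglyMeasurable X volume)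
    (hdom : (-laplacian d ℂ).domain ≤ (scalarMultiplication X).domain) (R : ℝ) :
    MemLp ((Metric.closedBall (0 : Space d) R).indicator X) 2 volume := by
  let b : ContDiffBump (0 : Space d) := ⟨max R 1, max R 1 + 1, by positivity, by linarith⟩
  have hasCompactSupport_b : HasCompactSupport (Complex.ofRealCLM ∘ b) :=
    b.hasCompactSupport.comp_left rfl
  have contDiff_b : ContDiff ℝ ∞ (Complex.ofRealCLM ∘ b) :=
    Complex.ofRealCLM.contDiff.comp b.contDiff
  let u : 𝓢(Space d, ℂ) := hasCompactSupport_b.toSchwartzMap contDiff_b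
  have memLp_mul : MemLp (fun x => (X x : ℂ) * u.toLp 2 volume x) 2 :=
    hdom (toLp_mem_laplacian_domain u)
  refine memLp_mul.mono (hX.indicator measurableSet_closedBall) ?_
  filter_upwards [u.coeFn_toLp 2 volume] with x hx
  rw [hx]
  by_cases hxR : x ∈ Metric.closedBall (0 : Space d) R
  · have hbx : b x = 1 :=
      b.one_of_mem_closedBall (Metric.closedBall_subset_closedBall (le_max_left R 1) hxR)
    have hux : u x = 1 := congrArg Complex.ofReal hbx
    rw [Set.indicator_of_mem hxR, hux, mul_one, Complex.norm_real]
  · rw [Set.indicator_of_notMem hxR, norm_zero]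
    exact norm_nonneg _

theorem DecaysAtInfinity.exists_forall_abs_le {X : Space d → ℝ} (hX : DecaysAtInfinity X) {η : ℝ}
    (hη : 0 < η) : ∃ R : ℝ, ∀ᵐ x, x ∉ Metric.closedBall (0 : Space d) R → |X x| ≤ η := by
  have hev : ∀ᶠ x in cocompact (Space d) ⊓ ae volume, |X x| ≤ η :=
    (hX.eventually (Metric.closedBall_mem_nhds 0 hη)).mono fun x hx => mem_closedBall_zero_iff.1 hx
  obtain ⟨s, hs, t, ht, hst⟩ := eventually_inf.1 hev
  rw [← Metric.cobounded_eq_cocompact,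
    (Metric.hasBasis_cobounded_compl_closedBall 0).mem_iff] at hs
  obtain ⟨R, -, hRs⟩ := hs
  exact ⟨R, mem_of_superset ht fun x hxt hxR => hst x ⟨hRs hxR, hxt⟩⟩

theorem tendsto_eLpNorm_indicator_scalarMultiplication {X : Space d → ℝ} {s : Set (Space d)}
    (hs : MeasurableSet s) (hXs : MemLp (s.indicator X) 2)
    {f : ℕ → (scalarMultiplication X).domain} {K : ℝ}
    (hf : ∀ᵐ x, (∀ n, ‖(f n : L2 d ℂ) x‖ ≤ K) ∧ Tendsto (fun n => (f n : L2 d ℂ) x) atTop (𝓝 0)) :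
    Tendsto (fun n => eLpNorm (s.indicator (scalarMultiplication X (f n))) 2 volume)
      atTop (𝓝 0) := by
  have hXf : ∀ᵐ x, ∀ n, scalarMultiplication X (f n) x = (X x : ℂ) * (f n : L2 d ℂ) x :=
    ae_all_iff.2 fun n => coeFn_scalarMultiplication X (f n)
  refine tendsto_eLpNorm_zero_of_dominated two_ne_zero ENNReal.ofNat_ne_top
    (fun n => (Lp.aestronglyMeasurable _).indicator hs) (hXs.norm.const_mul K) (fun n => ?_) ?_
  · filter_upwards [hf, hXf] with x hx hXx
    rw [norm_indicator_eq_indicator_norm, norm_indicator_eq_indicator_norm]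
    change _ ≤ K * s.indicator (fun a => ‖X a‖) x
    by_cases hxs : x ∈ s
    · simp only [Set.indicator_of_mem hxs, hXx n, norm_mul, Complex.norm_real]
      rw [mul_comm]
      exact mul_le_mul_of_nonneg_right (hx.1 n) (norm_nonneg _)
    · simp only [Set.indicator_of_notMem hxs, mul_zero, le_refl]
  · filter_upwards [hf, hXf] with x hx hXx
    by_cases hxs : x ∈ s
    · simpa only [Set.indicator_of_mem hxs, hXx, mul_zero] using hx.2.const_mul (X x : ℂ)
    · simp only [Set.indicator_of_notMem hxs, tendsto_const_nhds]

theorem DecaysAtInfinity.tendsto_scalarMultiplication {X : Space d → ℝ} (hX : DecaysAtInfinity X)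
    (hloc : ∀ R, MemLp ((Metric.closedBall (0 : Space d) R).indicator X) 2)
    {f : ℕ → (scalarMultiplication X).domain} {K M : ℝ} (hM : ∀ n, ‖(f n : L2 d ℂ)‖ ≤ M)
    (hf : ∀ᵐ x, (∀ n, ‖(f n : L2 d ℂ) x‖ ≤ K) ∧ Tendsto (fun n => (f n : L2 d ℂ) x) atTop (𝓝 0)) :
    Tendsto (fun n => scalarMultiplication X (f n)) atTop (𝓝 0) := by
  have hM₀ : 0 ≤ M := (norm_nonneg _).trans (hM 0)
  refine NormedAddGroup.tendsto_nhds_zero.2 fun δ hδ => ?_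
  set η := δ / (2 * (M + 1))
  have hη : 0 < η := by positivity
  have hηM : η * M < δ / 2 := by
    rw [div_mul_eq_mul_div, div_lt_div_iff₀ (by positivity) two_pos]
    linarith
  obtain ⟨R, hR⟩ := hX.exists_forall_abs_le hη
  have hball : MeasurableSet (Metric.closedBall (0 : Space d) R) := measurableSet_closedBall
  have tendsto_inside := (ENNReal.tendsto_toReal ENNReal.zero_ne_top).comp
    (tendsto_eLpNorm_indicator_scalarMultiplication hball (hloc R) hf)
  filter_upwards [tendsto_inside.eventually_lt_const (half_pos hδ)] with n hn
  have norm_le := norm_le_eLpNorm_indicator_add hball hη.le (f := scalarMultiplication X (f n))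
    (g := (f n : L2 d ℂ)) <| by
      filter_upwards [hR, coeFn_scalarMultiplication X (f n)] with x hx hXx hxR
      rw [hXx, norm_mul, Complex.norm_real]
      gcongr
      exact hx hxR
  calc ‖scalarMultiplication X (f n)‖ ≤ _ + η * M := norm_le.trans (by gcongr; exact hM n)
    _ < δ := by linarith [Function.comp_apply ▸ hn]

/-- The frequency truncation of an element of `H²`, as an element of `H²`. -/
def lowPassH2 (N : ℝ) (u : (-laplacian d ℂ).domain) : (-laplacian d ℂ).domain :=
  ⟨lowPass N (u : L2 d ℂ), (exists_laplacian_fourierMul_eq _ u).fst⟩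

theorem neg_laplacian_sub_lowPassH2 (N : ℝ) (u : (-laplacian d ℂ).domain) :
    (-laplacian d ℂ) (u - lowPassH2 N u) =
      (-laplacian d ℂ) u - lowPass N ((-laplacian d ℂ) u) := by
  have h : (-laplacian d ℂ) (lowPassH2 N u) = -lowPass N (laplacian d ℂ u) :=
    congrArg Neg.neg (exists_laplacian_fourierMul_eq _ u).snd
  rw [LinearPMap.map_sub, h, ← map_neg]
  rfl

section Bounded

variable {X : Space d → ℝ} (hdom : (-laplacian d ℂ).domain ≤ (scalarMultiplication X).domain)
  (hbound : ∀ ε : ℝ, 0 < ε → ∃ C : ℝ, ∀ u : (-laplacian d ℂ).domain,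
    ‖scalarMultiplication X (Submodule.inclusion hdom u)‖ ≤
      ε * ‖(-laplacian d ℂ) u‖ + C * ‖(u : L2 d ℂ)‖)

include hbound

theorem exists_norm_scalarMultiplication_sub_lowPassH2_le (M : ℝ) {δ : ℝ} (hδ : 0 < δ) :
    ∃ N : ℝ, ∀ u : (-laplacian d ℂ).domain, ‖(-laplacian d ℂ) u‖ ≤ M →
      ‖scalarMultiplication X (Submodule.inclusion hdom (u - lowPassH2 N u))‖ ≤ δ := by
  obtain ⟨C, hC⟩ := hbound (δ / (2 * (|M| + 1))) (by positivity)
  have hlim : Tendsto (fun N : ℝ => |C| * ((N ^ 2)⁻¹ * M)) atTop (𝓝 0) := by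
    simpa using ((tendsto_pow_atTop two_ne_zero).inv_tendsto_atTop.mul_const M).const_mul |C|
  obtain ⟨N, hN, hNδ⟩ :=
    ((eventually_gt_atTop 0).and (hlim.eventually_le_const (half_pos hδ))).exists
  refine ⟨N, fun u hu => ?_⟩
  have norm_laplacian_le : ‖(-laplacian d ℂ) (u - lowPassH2 N u)‖ ≤ M := by
    rw [neg_laplacian_sub_lowPassH2]
    exact (norm_sub_lowPass_le N _).trans hu
  have norm_le : ‖((u - lowPassH2 N u : (-laplacian d ℂ).domain) : L2 d ℂ)‖ ≤ (N ^ 2)⁻¹ * M :=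
    (norm_sub_lowPass_le_norm_laplacian hN u).trans <| by
      gcongr
      rwa [LinearPMap.neg_apply, norm_neg] at hu
  calc _ ≤ _ := hC (u - lowPassH2 N u)
    _ ≤ δ / (2 * (|M| + 1)) * |M| + |C| * ((N ^ 2)⁻¹ * M) := by
      gcongr
      · exact norm_laplacian_le.trans (le_abs_self M)
      · exact le_abs_self C
    _ ≤ δ / 2 + δ / 2 := by
      gcongr
      rw [div_mul_eq_mul_div, div_le_div_iff₀ (by positivity) two_pos]
      nlinarith
    _ = δ := add_halves δ

theorem tendsto_scalarMultiplication_of_tendsto_inner (hX : AEStronglyMeasurable X volume)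
    (hdecay : DecaysAtInfinity X) {v : ℕ → (-laplacian d ℂ).domain} {M : ℝ}
    (hv : ∀ n, ‖(v n : L2 d ℂ)‖ ≤ M) (hΔv : ∀ n, ‖(-laplacian d ℂ) (v n)‖ ≤ M)
    (hweak : ∀ y, Tendsto (fun n => ⟪y, (v n : L2 d ℂ)⟫_ℂ) atTop (𝓝 0)) :
    Tendsto (fun n => scalarMultiplication X (Submodule.inclusion hdom (v n))) atTop (𝓝 0) := by
  refine NormedAddGroup.tendsto_nhds_zero.2 fun δ hδ => ?_
  obtain ⟨N, hN⟩ :=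
    exists_norm_scalarMultiplication_sub_lowPassH2_le hdom hbound M (half_pos hδ)
  obtain ⟨K, hK⟩ := exists_forall_norm_lowPass_le_and_tendsto N hv hweak
  have tendsto_low : Tendsto (fun n => scalarMultiplication X
      (Submodule.inclusion hdom (lowPassH2 N (v n)))) atTop (𝓝 0) :=
    hdecay.tendsto_scalarMultiplication (memLp_indicator_closedBall hX hdom)
      (fun n => (norm_lowPass_le N _).trans (hv n)) hK
  filter_upwards [NormedAddGroup.tendsto_nhds_zero.1 tendsto_low _ (half_pos hδ)] with n hn
  have split : scalarMultiplication X (Submodule.inclusion hdom (v n)) =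
      scalarMultiplication X (Submodule.inclusion hdom (lowPassH2 N (v n))) +
        scalarMultiplication X (Submodule.inclusion hdom (v n - lowPassH2 N (v n))) := by
    rw [← LinearPMap.map_add, ← map_add, add_sub_cancel]
  rw [split]
  exact (norm_add_le _ _).trans_lt (by linarith [hN (v n) (hΔv n)])

end Bounded

theorem laplacianCompact_of_decaysAtInfinity {X : Space d → ℝ} (hX : AEStronglyMeasurable X volume)
    (hbound : LaplacianBoundedZero X) (hdecay : DecaysAtInfinity X) : LaplacianCompact X := by
  obtain ⟨hdom, hbound⟩ := hbound
  refine ⟨hdom, fun u ⟨C, hC⟩ => ?_⟩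
  have mem_resolventSet : (-1 : ℂ) ∈ resolventSet (-laplacian d ℂ) :=
    mem_resolventSet_neg_laplacian <| by
      rintro ⟨s, hs, h⟩
      have : s = -1 := by exact_mod_cast h
      linarith [Set.mem_Ici.1 hs]
  have : Fact ((2 : ℝ≥0∞) ≠ ⊤) := ⟨ENNReal.ofNat_ne_top⟩
  obtain ⟨a, φ, hφ, hweak⟩ := exists_subseq_tendsto_inner_sub_of_graph_bounded mem_resolventSet
    (fun n => (hC n).1) (fun n => (hC n).2)
  refine ⟨scalarMultiplication X (Submodule.inclusion hdom a), φ, hφ,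
    tendsto_sub_nhds_zero_iff.1 ?_⟩
  simp only [← LinearPMap.map_sub, ← map_sub]
  refine tendsto_scalarMultiplication_of_tendsto_inner hdom hbound hX hdecay
    (M := C + ‖(a : L2 d ℂ)‖ + ‖(-laplacian d ℂ) a‖) (fun n => ?_) (fun n => ?_) hweak
  · rw [Submodule.coe_sub]
    linarith [norm_sub_le (u (φ n) : L2 d ℂ) a, (hC (φ n)).1, norm_nonneg ((-laplacian d ℂ) a)]
  · rw [LinearPMap.map_sub]
    linarith [norm_sub_le ((-laplacian d ℂ) (u (φ n))) ((-laplacian d ℂ) a), (hC (φ n)).2,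
      norm_nonneg (a : L2 d ℂ)]

end Decay

/-! ### The free operator -/

section Matrices

variable {d : ℕ}

/-- The action of constant `2 × 2` matrices on `L²(ℝ^d, ℂ²)`, as a homomorphism of algebras. -/
def matrixOp (d : ℕ) : Matrix (Fin 2) (Fin 2) ℂ →ₐ[ℂ] (L2 d C2 →L[ℂ] L2 d C2) :=
  AlgHom.ofLinearMap
    { toFun := fun M => (matrixCLM M).compLpL 2 volume
      map_add' := fun M N => by
        rw [← ContinuousLinearMap.add_compLpL, matrixCLM, map_add]
        rfl
      map_smul' := fun c M => by
        rw [RingHom.id_apply, ← ContinuousLinearMap.smul_compLpL, matrixCLM, map_smul]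
        rfl }
    (by
      ext1 f
      refine Lp.ext ((ContinuousLinearMap.coeFn_compLpL _ f).trans (.of_forall fun x => ?_))
      simp only [matrixCLM, map_one, one_apply_eq_self])
    (fun M N => by
      ext1 f
      apply Lp.ext
      filter_upwards [(matrixCLM (M * N)).coeFn_compLpL f, (matrixCLM N).coeFn_compLpL f,
        (matrixCLM M).coeFn_compLpL ((matrixCLM N).compLpL 2 volume f)] with x hMN hN hM
      refine hMN.trans (Eq.trans ?_ hM.symm)
      rw [hN]
      simp only [matrixCLM, map_mul, mul_apply_eq_comp])

theorem coeFn_matrixOp (M : Matrix (Fin 2) (Fin 2) ℂ) (f : L2 d C2) :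
    matrixOp d M f =ᵐ[volume] fun x => matrixCLM M (f x) :=
  (matrixCLM M).coeFn_compLpL f

theorem matrixCLM_apply (M : Matrix (Fin 2) (Fin 2) ℂ) (v : C2) (i : Fin 2) :
    matrixCLM M v i = M i 0 * v 0 + M i 1 * v 1 := by
  change (M.mulVec (WithLp.ofLp v)) i = _
  rw [Matrix.mulVec, dotProduct, Fin.sum_univ_two]

theorem inner_matrixCLM_left (M : Matrix (Fin 2) (Fin 2) ℂ) (v w : C2) :
    ⟪matrixCLM M v, w⟫_ℂ = ⟪v, matrixCLM Mᴴ w⟫_ℂ := by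
  rw [← ContinuousLinearMap.adjoint_inner_right, ← ContinuousLinearMap.star_eq_adjoint, matrixCLM,
    ← map_star]
  rfl

theorem inner_matrixOp_left (M : Matrix (Fin 2) (Fin 2) ℂ) (f g : L2 d C2) :
    ⟪matrixOp d M f, g⟫_ℂ = ⟪f, matrixOp d Mᴴ g⟫_ℂ := by
  rw [L2.inner_def, L2.inner_def]
  refine integral_congr_ae ?_
  filter_upwards [coeFn_matrixOp M f, coeFn_matrixOp Mᴴ g] with x hf hg
  rw [hf, hg, inner_matrixCLM_left]

/-- The Pauli matrix `σ₃`. -/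
def pauliZ : Matrix (Fin 2) (Fin 2) ℂ := !![1, 0; 0, -1]

/-- The Pauli matrix `σ₁`. -/
def pauliX : Matrix (Fin 2) (Fin 2) ℂ := !![0, 1; 1, 0]

theorem pauliZ_mul_self : pauliZ * pauliZ = 1 := by
  simp [pauliZ, Matrix.one_fin_two]

theorem pauliX_mul_self : pauliX * pauliX = 1 := by
  simp [pauliX, Matrix.one_fin_two]

theorem conjTranspose_pauliZ : pauliZᴴ = pauliZ := by
  ext i j; fin_cases i <;> fin_cases j <;> simp [pauliZ]

theorem conjTranspose_pauliX : pauliXᴴ = pauliX := by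
  ext i j; fin_cases i <;> fin_cases j <;> simp [pauliX]

theorem pauliZ_mul_pauliX : pauliZ * pauliX = -(pauliX * pauliZ) := by
  simp [pauliZ, pauliX]

theorem matrixOp_involutive {M : Matrix (Fin 2) (Fin 2) ℂ} (hM : M * M = 1) :
    Function.Involutive (matrixOp d M) := fun f => by
  rw [← mul_apply_eq_comp, ← map_mul, hM, map_one, one_apply_eq_self]

end Matrices

section FreeOp

variable {d : ℕ} {μ : ℝ}

theorem freeOp_apply (u : (freeOp d μ).domain) :
    freeOp d μ u = matrixOp d pauliZ (-laplacian d C2 u + (μ : ℂ) • (u : L2 d C2)) := rfl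

theorem exists_freeOp_matrixOp_eq (M : Matrix (Fin 2) (Fin 2) ℂ) (u : (freeOp d μ).domain) :
    ∃ hMu : matrixOp d M u ∈ (freeOp d μ).domain, freeOp d μ ⟨matrixOp d M u, hMu⟩ =
      matrixOp d (pauliZ * M) (-laplacian d C2 u + (μ : ℂ) • (u : L2 d C2)) := by
  obtain ⟨hMu, hΔ⟩ := exists_laplacian_compLpL_eq (matrixCLM M) u
  refine ⟨hMu, (freeOp_apply _).trans ?_⟩
  rw [map_mul, mul_apply_eq_comp, map_add (matrixOp d M), map_neg, map_smul]
  exact congrArg (fun v => matrixOp d pauliZ (-v + _)) hΔ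

theorem freeOp_matrixOp_pauliX (u : (freeOp d μ).domain)
    (hu : matrixOp d pauliX u ∈ (freeOp d μ).domain) :
    freeOp d μ ⟨matrixOp d pauliX u, hu⟩ = -matrixOp d pauliX (freeOp d μ u) := by
  rw [(exists_freeOp_matrixOp_eq pauliX u).snd, pauliZ_mul_pauliX, map_neg, map_mul,
    neg_apply, mul_apply_eq_comp, freeOp_apply]

theorem isFormalAdjoint_freeOp : (freeOp d μ).IsFormalAdjoint (freeOp d μ) := by
  intro u v
  have h := isFormalAdjoint_laplacian (d := d) (F := C2)
  obtain ⟨hv, hΔv⟩ := exists_laplacian_compLpL_eq (matrixCLM pauliZ) v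
  have hΔ : ⟪laplacian d C2 u, matrixOp d pauliZ v⟫_ℂ =
      ⟪(u : L2 d C2), matrixOp d pauliZ (laplacian d C2 v)⟫_ℂ :=
    (h u ⟨_, hv⟩).trans (congrArg _ hΔv)
  rw [freeOp_apply, freeOp_apply, inner_matrixOp_left, conjTranspose_pauliZ, inner_add_left,
    map_add, inner_add_right, inner_neg_left, map_neg, inner_neg_right, hΔ, inner_smul_left,
    map_smul, inner_smul_right, Complex.conj_ofReal]

theorem norm_laplacian_le (u : (freeOp d μ).domain) :
    ‖laplacian d C2 u‖ ≤ ‖matrixOp d pauliZ‖ * ‖freeOp d μ u‖ + |μ| * ‖(u : L2 d C2)‖ := by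
  have h : laplacian d C2 u = (μ : ℂ) • (u : L2 d C2) - matrixOp d pauliZ (freeOp d μ u) := by
    rw [freeOp_apply, matrixOp_involutive pauliZ_mul_self]
    abel
  rw [h, add_comm]
  refine norm_sub_le_of_le (norm_smul_le _ _ |>.trans_eq ?_) ((matrixOp d pauliZ).le_opNorm _)
  rw [Complex.norm_real, Real.norm_eq_abs]

end FreeOp

section Gap

variable {μ : ℝ}

theorem mem_gapComplement_iff {z : ℂ} : z ∈ gapComplement μ ↔ z.im = 0 ∧ μ ≤ |z.re| := by
  simp only [gapComplement, Set.mem_image, Set.mem_union, Set.mem_Iic, Set.mem_Ici]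
  constructor
  · rintro ⟨t, ht, rfl⟩
    exact ⟨Complex.ofReal_im t, le_abs.2 (ht.symm.imp_right le_neg.1)⟩
  · rintro ⟨him, hre⟩
    exact ⟨z.re, (le_abs.1 hre).symm.imp_left le_neg.1, Complex.ext rfl him.symm⟩

theorem conj_eq_of_mem_gapComplement {z : ℂ} (hz : z ∈ gapComplement μ) : conj z = z :=
  Complex.conj_eq_iff_im.2 (mem_gapComplement_iff.1 hz).1

theorem isPreconnected_compl_gapComplement (hμ : 0 < μ) : IsPreconnected (gapComplement μ)ᶜ := by
  have hstar : StarConvex ℝ (0 : ℂ) (gapComplement μ)ᶜ := by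
    refine starConvex_zero_iff.2 fun z hz a ha₀ ha₁ haz => hz ?_
    rw [mem_gapComplement_iff, Complex.smul_im, Complex.smul_re, smul_eq_mul, smul_eq_mul,
      mul_eq_zero, abs_mul, abs_of_nonneg ha₀] at haz
    have ha : a ≠ 0 := by
      rintro rfl
      exact hμ.not_ge (haz.2.trans_eq (zero_mul _))
    exact mem_gapComplement_iff.2
      ⟨haz.1.resolve_left ha, haz.2.trans (mul_le_of_le_one_left (abs_nonneg _) ha₁)⟩
  refine (hstar.isPathConnected fun h => ?_).isConnected.isPreconnected
  exact hμ.not_ge ((mem_gapComplement_iff.1 h).2.trans_eq abs_zero)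

end Gap

/-! ### The spectrum of the free operator -/

section SingularSequence

variable {d : ℕ}

theorem exists_symbol_eq (hd : 0 < d) {t : ℝ} (ht : 0 ≤ t) : ∃ ξ : Space d, symbol ξ = t := by
  refine ⟨EuclideanSpace.single ⟨0, hd⟩ (√t / (2 * Real.pi)), ?_⟩
  rw [symbol, PiLp.norm_single, Real.norm_eq_abs, sq_abs, div_pow, Real.sq_sqrt ht,
    mul_div_cancel₀]
  positivity

theorem volume_symbol_preimage_Ioo_ne_zero (hd : 0 < d) {a b : ℝ} (ha : 0 ≤ a) (hab : a < b) :
    volume (symbol ⁻¹' Set.Ioo a b : Set (Space d)) ≠ 0 := by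
  obtain ⟨t, hat, htb⟩ := exists_between hab
  obtain ⟨ξ, rfl⟩ := exists_symbol_eq hd (ha.trans hat.le)
  exact ((isOpen_Ioo.preimage continuous_symbol).measure_pos volume ⟨ξ, hat, htb⟩).ne'

theorem volume_symbol_preimage_Ioo_ne_top (a b : ℝ) :
    volume (symbol ⁻¹' Set.Ioo a b : Set (Space d)) ≠ ⊤ := by
  have hsub : symbol ⁻¹' Set.Ioo a b ⊆ Metric.closedBall (0 : Space d) √b := fun ξ hξ =>
    mem_closedBall_zero_iff.2 (Real.le_sqrt_of_sq_le ((sq_norm_le_symbol ξ).trans hξ.2.le))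
  exact ((measure_mono hsub).trans_lt measure_closedBall_lt_top).ne

theorem exists_norm_eq_one_fourier_support {S : Set (Space d)} (hS : MeasurableSet S)
    (hS₀ : volume S ≠ 0) (hS_top : volume S ≠ ⊤) :
    ∃ f : L2 d ℂ, ‖f‖ = 1 ∧ ∀ᵐ ξ, ξ ∉ S → (𝓕 f : L2 d ℂ) ξ = 0 := by
  set g : L2 d ℂ := indicatorConstLp 2 hS hS_top 1
  have hg : ‖g‖ ≠ 0 := by
    rw [norm_indicatorConstLp two_ne_zero ENNReal.ofNat_ne_top, norm_one, one_mul]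
    exact (Real.rpow_pos_of_pos (ENNReal.toReal_pos hS₀ hS_top) _).ne'
  refine ⟨(Lp.fourierTransformₗᵢ (Space d) ℂ).symm (((‖g‖⁻¹ : ℝ) : ℂ) • g), ?_, ?_⟩
  · rw [LinearIsometryEquiv.norm_map, norm_smul, Complex.norm_real, norm_inv, norm_norm,
      inv_mul_cancel₀ hg]
  · have hfourier : (𝓕 ((Lp.fourierTransformₗᵢ (Space d) ℂ).symm (((‖g‖⁻¹ : ℝ) : ℂ) • g)) :
        L2 d ℂ) = ((‖g‖⁻¹ : ℝ) : ℂ) • g := LinearIsometryEquiv.apply_symm_apply _ _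
    rw [hfourier]
    filter_upwards [Lp.coeFn_smul ((‖g‖⁻¹ : ℝ) : ℂ) g,
      indicatorConstLp_coeFn (p := 2) (hs := hS) (hμs := hS_top) (c := (1 : ℂ))] with ξ hξ hgξ hξS
    rw [hξ, Pi.smul_apply, hgξ, Set.indicator_of_notMem hξS, smul_zero]

theorem norm_neg_laplacian_sub_le_of_fourier_support {S : Set (Space d)} {s ε : ℝ}
    (hSε : ∀ ξ ∈ S, |symbol ξ - s| ≤ ε) {f : L2 d ℂ}
    (hf : ∀ᵐ ξ, ξ ∉ S → (𝓕 f : L2 d ℂ) ξ = 0) :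
    ∃ hf : f ∈ (-laplacian d ℂ).domain,
      ‖(-laplacian d ℂ) ⟨f, hf⟩ - (s : ℂ) • f‖ ≤ ε * ‖f‖ := by
  have hmem : f ∈ (laplacian d ℂ).domain := by
    rw [mem_laplacian_domain_iff]
    refine (Lp.memLp (𝓕 f : L2 d ℂ)).of_le_mul (c := |s| + ε)
      ((Complex.continuous_ofReal.comp continuous_symbol).aestronglyMeasurable.smul
        (Lp.aestronglyMeasurable _)) ?_
    filter_upwards [hf] with ξ hξ
    by_cases hξS : ξ ∈ S
    · rw [norm_smul, norm_symbol]
      gcongr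
      linarith [(abs_le.1 (hSε ξ hξS)).2, le_abs_self s]
    · rw [hξ hξS, smul_zero, norm_zero, mul_zero]
  refine ⟨hmem, norm_le_of_norm_fourier_le ?_⟩
  have hneg : (-laplacian d ℂ) ⟨f, hmem⟩ = (-1 : ℂ) • laplacian d ℂ ⟨f, hmem⟩ :=
    (neg_one_smul ℂ _).symm
  rw [hneg]
  filter_upwards [hf, coeFn_fourier_sub ((-1 : ℂ) • laplacian d ℂ ⟨f, hmem⟩) ((s : ℂ) • f),
    coeFn_fourier_smul (-1) (laplacian d ℂ ⟨f, hmem⟩), coeFn_fourier_smul (s : ℂ) f,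
    fourier_laplacian ⟨f, hmem⟩] with ξ hξ hsub hΔneg hsmul hΔ
  rw [hsub, hΔneg, hsmul, hΔ]
  by_cases hξS : ξ ∈ S
  · rw [neg_smul, neg_smul, one_smul, neg_neg, ← sub_smul, norm_smul, ← Complex.ofReal_sub,
      Complex.norm_real]
    exact mul_le_mul_of_nonneg_right (hSε ξ hξS) (norm_nonneg _)
  · simp only [hξ hξS, smul_zero, sub_zero, norm_zero, mul_zero, le_refl]

theorem inner_eq_zero_of_disjoint_fourier_support {S S' : Set (Space d)} (hSS' : Disjoint S S')
    {f g : L2 d ℂ} (hf : ∀ᵐ ξ, ξ ∉ S → (𝓕 f : L2 d ℂ) ξ = 0)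
    (hg : ∀ᵐ ξ, ξ ∉ S' → (𝓕 g : L2 d ℂ) ξ = 0) : ⟪f, g⟫_ℂ = 0 := by
  rw [← Lp.inner_fourier_eq, L2.inner_def]
  refine integral_eq_zero_of_ae ?_
  filter_upwards [hf, hg] with ξ hfξ hgξ
  by_cases hξ : ξ ∈ S
  · rw [hgξ (Set.disjoint_left.1 hSS' hξ), inner_zero_right, Pi.zero_apply]
  · rw [hfξ hξ, inner_zero_left, Pi.zero_apply]

theorem one_le_dist_of_inner_eq_zero {H : Type*} [NormedAddCommGroup H] [InnerProductSpace ℂ H]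
    {x y : H} (hx : ‖x‖ = 1) (hxy : ⟪x, y⟫_ℂ = 0) : 1 ≤ dist x y := by
  rw [dist_eq_norm, ← one_le_sq_iff₀ (norm_nonneg _), norm_sub_sq (𝕜 := ℂ), hxy, hx, map_zero]
  linarith [sq_nonneg ‖y‖]

theorem hasSingularSequence_neg_laplacian (hd : 0 < d) {s : ℝ} (hs : 0 ≤ s) :
    HasSingularSequence (-laplacian d ℂ) s := by
  let r (n : ℕ) : ℝ := s + 1 / ((n : ℝ) + 1)
  have hsr (n : ℕ) : s ≤ r n := le_add_of_nonneg_right (by positivity)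
  have hr : StrictAnti r := fun m n hmn => by
    simp only [r]
    gcongr
  let shell (n : ℕ) : Set (Space d) := symbol ⁻¹' Set.Ioo (r (n + 1)) (r n)
  have shell_disjoint : Pairwise (Function.onFun Disjoint shell) := fun m n hmn =>
    (hr.antitone.pairwise_disjoint_on_Ioo_succ hmn).preimage symbol
  have abs_symbol_sub_le (n : ℕ) : ∀ ξ ∈ shell n, |symbol ξ - s| ≤ 1 / ((n : ℝ) + 1) := by
    intro ξ hξ
    rw [abs_of_nonneg (sub_nonneg.2 ((hsr _).trans hξ.1.le)), sub_le_iff_le_add']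
    exact hξ.2.le
  choose f norm_f support_f using fun n => exists_norm_eq_one_fourier_support
    ((isOpen_Ioo.preimage continuous_symbol).measurableSet)
    (volume_symbol_preimage_Ioo_ne_zero hd (hs.trans (hsr _)) (hr n.lt_succ_self))
    (volume_symbol_preimage_Ioo_ne_top (d := d) (r (n + 1)) (r n))
  choose mem_domain norm_sub_le using fun n =>
    norm_neg_laplacian_sub_le_of_fourier_support (abs_symbol_sub_le n) (support_f n)
  refine ⟨fun n => ⟨f n, mem_domain n⟩, norm_f, fun m n hmn =>
    one_le_dist_of_inner_eq_zero (norm_f m) <|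
      inner_eq_zero_of_disjoint_fourier_support (shell_disjoint hmn) (support_f m) (support_f n),
    ?_⟩
  refine squeeze_zero_norm (fun n => ?_) tendsto_one_div_add_atTop_nhds_zero_nat
  exact (norm_sub_le n).trans_eq (by rw [norm_f, mul_one])

end SingularSequence

section FreeSpectrum

variable {d : ℕ} {μ : ℝ}

theorem norm_toSpanSingleton_compLpL {F : Type*} [NormedAddCommGroup F] [InnerProductSpace ℂ F]
    {e : F} (he : ‖e‖ = 1) (f : L2 d ℂ) :
    ‖(ContinuousLinearMap.toSpanSingleton ℂ e).compLpL 2 volume f‖ = ‖f‖ := by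
  rw [Lp.norm_def, Lp.norm_def]
  congr 1
  refine eLpNorm_congr_norm_ae ?_
  filter_upwards [(ContinuousLinearMap.toSpanSingleton ℂ e).coeFn_compLpL f] with x hx
  rw [hx, ContinuousLinearMap.toSpanSingleton_apply, norm_smul, he, mul_one]

theorem matrixOp_toSpanSingleton {M : Matrix (Fin 2) (Fin 2) ℂ} {e : C2} {σ : ℂ}
    (he : matrixCLM M e = σ • e) (f : L2 d ℂ) :
    matrixOp d M ((ContinuousLinearMap.toSpanSingleton ℂ e).compLpL 2 volume f) =
      σ • (ContinuousLinearMap.toSpanSingleton ℂ e).compLpL 2 volume f := by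
  set g : L2 d C2 := (ContinuousLinearMap.toSpanSingleton ℂ e).compLpL 2 volume f
  apply Lp.ext
  filter_upwards [coeFn_matrixOp M g, Lp.coeFn_smul σ g,
    (ContinuousLinearMap.toSpanSingleton ℂ e).coeFn_compLpL f] with x hM hσ hg
  rw [hM, hσ, Pi.smul_apply, hg, ContinuousLinearMap.toSpanSingleton_apply, map_smul, he,
    smul_comm]

theorem hasSingularSequence_freeOp_of_neg_laplacian {s σ : ℂ} {e : C2} (he : ‖e‖ = 1)
    (heσ : matrixCLM pauliZ e = σ • e) (hs : HasSingularSequence (-laplacian d ℂ) s) :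
    HasSingularSequence (freeOp d μ) (σ * (s + μ)) := by
  obtain ⟨f, norm_f, dist_f, tendsto_f⟩ := hs
  let ι : L2 d ℂ →L[ℂ] L2 d C2 := (ContinuousLinearMap.toSpanSingleton ℂ e).compLpL 2 volume
  have norm_ι : ∀ g, ‖ι g‖ = ‖g‖ := norm_toSpanSingleton_compLpL he
  have hΔ (n : ℕ) : ∃ h : ι (f n) ∈ (laplacian d C2).domain,
      laplacian d C2 ⟨ι (f n), h⟩ = ι (laplacian d ℂ (f n)) :=
    exists_laplacian_compLpL_eq (ContinuousLinearMap.toSpanSingleton ℂ e) (f n)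
  choose mem_domain hΔ using hΔ
  refine ⟨fun n => ⟨ι (f n), mem_domain n⟩, fun n => (norm_ι _).trans (norm_f n),
    fun m n hmn => ?_, ?_⟩
  · have dist_eq : dist (ι (f m)) (ι (f n)) = dist (f m : L2 d ℂ) (f n) := by
      rw [dist_eq_norm, ← map_sub, norm_ι, dist_eq_norm]
    exact (dist_f hmn).trans_eq dist_eq.symm
  · have apply_eq (n : ℕ) : freeOp d μ ⟨ι (f n), mem_domain n⟩ - (σ * (s + μ)) • ι (f n) =
        σ • ι ((-laplacian d ℂ) (f n) - s • (f n : L2 d ℂ)) :=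
      calc
        _ = matrixOp d pauliZ (-ι (laplacian d ℂ (f n)) + (μ : ℂ) • ι (f n)) -
            (σ * (s + μ)) • ι (f n) :=
          congrArg (fun v => matrixOp d pauliZ (-v + _) - _) (hΔ n)
        _ = σ • ι (-laplacian d ℂ (f n) + (μ : ℂ) • (f n : L2 d ℂ)) -
            (σ * (s + μ)) • ι (f n) := by
          rw [← map_neg, ← map_smul ι, ← map_add, matrixOp_toSpanSingleton heσ]
        _ = _ := by
          rw [LinearPMap.neg_apply, map_add, map_sub, map_smul, map_smul]
          module
    have hlim := ((ι.continuous.tendsto _).comp tendsto_f).const_smul σ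
    rw [map_zero, smul_zero] at hlim
    exact hlim.congr fun n => (apply_eq n).symm

theorem hasSingularSequence_freeOp (hd : 0 < d) {z : ℂ} (hz : z ∈ gapComplement μ) :
    HasSingularSequence (freeOp d μ) z := by
  obtain ⟨t, ht | ht, rfl⟩ := hz
  · have hs := hasSingularSequence_neg_laplacian hd (sub_nonneg.2 (le_neg.1 (Set.mem_Iic.1 ht)))
    have heσ : matrixCLM pauliZ (EuclideanSpace.single 1 1) =
        (-1 : ℂ) • EuclideanSpace.single 1 1 := by
      ext i
      fin_cases i <;> simp [matrixCLM_apply, pauliZ]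
    convert hasSingularSequence_freeOp_of_neg_laplacian (by simp) heσ hs using 1
    push_cast
    ring
  · have hs := hasSingularSequence_neg_laplacian hd (sub_nonneg.2 (Set.mem_Ici.1 ht))
    have heσ : matrixCLM pauliZ (EuclideanSpace.single 0 1) =
        (1 : ℂ) • EuclideanSpace.single 0 1 := by
      ext i
      fin_cases i <;> simp [matrixCLM_apply, pauliZ]
    convert hasSingularSequence_freeOp_of_neg_laplacian (by simp) heσ hs using 1
    push_cast
    ring

theorem resolvent_neg_laplacian_matrixOp {w : ℂ} (hw : w ∈ resolventSet (-laplacian d C2))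
    (M : Matrix (Fin 2) (Fin 2) ℂ) (f : L2 d C2) :
    resolvent (-laplacian d C2) w (matrixOp d M f) =
      matrixOp d M (resolvent (-laplacian d C2) w f) := by
  obtain ⟨hMf, hΔ⟩ := exists_laplacian_compLpL_eq (matrixCLM M)
    ⟨resolvent (-laplacian d C2) w f, resolvent_mem_domain hw f⟩
  have shift_eq : (-laplacian d C2) ⟨matrixOp d M (resolvent (-laplacian d C2) w f), hMf⟩ -
      w • matrixOp d M (resolvent (-laplacian d C2) w f) = matrixOp d M f := by
    refine (congrArg (fun v => -v - _) hΔ).trans (Eq.trans ?_ (congrArg (matrixOp d M)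
      (sub_eq_iff_eq_add.2 (apply_resolvent hw f))))
    rw [map_sub, map_smul, LinearPMap.neg_apply, map_neg]
    rfl
  rw [← shift_eq]
  exact resolvent_apply_sub hw ⟨_, hMf⟩

section Eigenmatrix

variable {M : Matrix (Fin 2) (Fin 2) ℂ} {σ z : ℂ}

theorem exists_freeOp_matrixOp_resolvent_eq (hM : pauliZ * M = σ • M) (hσ : σ * σ = 1)
    (hz : σ * z - μ ∈ resolventSet (-laplacian d C2)) (f : L2 d C2) :
    ∃ h : matrixOp d M (resolvent (-laplacian d C2) (σ * z - μ) f) ∈ (freeOp d μ).domain,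
      freeOp d μ ⟨_, h⟩ = σ • matrixOp d M f +
        z • matrixOp d M (resolvent (-laplacian d C2) (σ * z - μ) f) := by
  set u : (freeOp d μ).domain :=
    ⟨resolvent (-laplacian d C2) (σ * z - μ) f, resolvent_mem_domain hz f⟩
  have neg_laplacian_u : -laplacian d C2 u = f + (σ * z - μ) • (u : L2 d C2) :=
    apply_resolvent hz f
  obtain ⟨hMu, freeOp_eq⟩ := exists_freeOp_matrixOp_eq M u
  refine ⟨hMu, freeOp_eq.trans ?_⟩
  rw [neg_laplacian_u, hM, add_assoc, ← add_smul, sub_add_cancel, map_smul, smul_apply, map_add,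
    map_smul, smul_add, smul_smul, ← mul_assoc, hσ, one_mul]

theorem matrixOp_resolvent_freeOp_sub (hM : M * pauliZ = σ • M) (hσ : σ * σ = 1)
    (hz : σ * z - μ ∈ resolventSet (-laplacian d C2)) (u : (freeOp d μ).domain) :
    matrixOp d M (resolvent (-laplacian d C2) (σ * z - μ) (freeOp d μ u - z • (u : L2 d C2))) =
      σ • matrixOp d M u := by
  have matrixOp_freeOp : matrixOp d M (freeOp d μ u) =
      σ • matrixOp d M (-laplacian d C2 u + (μ : ℂ) • (u : L2 d C2)) := by
    rw [← smul_apply, ← map_smul, ← hM, map_mul, mul_apply_eq_comp, freeOp_apply]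
  have shift_eq : matrixOp d M (freeOp d μ u - z • (u : L2 d C2)) =
      σ • matrixOp d M ((-laplacian d C2) u - (σ * z - μ) • (u : L2 d C2)) := by
    rw [map_sub, matrixOp_freeOp]
    change _ = σ • matrixOp d M (-laplacian d C2 u - (σ * z - μ) • (u : L2 d C2))
    simp only [map_smul, map_add, map_sub]
    linear_combination (norm := module) hσ • z • matrixOp d M u
  rw [← resolvent_neg_laplacian_matrixOp hz, shift_eq, map_smul,
    resolvent_neg_laplacian_matrixOp hz, resolvent_apply_sub hz u]

end Eigenmatrix

theorem mul_sub_mem_resolventSet_neg_laplacian {z σ : ℂ} (hσ : σ * σ = 1)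
    (hz : z ∉ gapComplement μ) : σ * z - μ ∈ resolventSet (-laplacian d C2) := by
  refine mem_resolventSet_neg_laplacian ?_
  rintro ⟨t, ht, h⟩
  have hz_eq : z = σ * ((t + μ : ℝ) : ℂ) := by
    rw [Complex.ofReal_add, h, sub_add_cancel, ← mul_assoc, hσ, one_mul]
  refine hz ?_
  rcases mul_self_eq_one_iff.1 hσ with rfl | rfl
  · exact ⟨t + μ, .inr (Set.mem_Ici.2 (le_add_of_nonneg_left ht)), by rw [hz_eq, one_mul]⟩
  · exact ⟨-(t + μ), .inl (Set.mem_Iic.2 (neg_le_neg (le_add_of_nonneg_left ht))),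
      by rw [hz_eq, neg_one_mul, Complex.ofReal_neg]⟩

/-- The spectral projection of `pauliZ` onto its eigenspace for the eigenvalue `σ = ±1`. -/
def pauliZProj (σ : ℂ) : Matrix (Fin 2) (Fin 2) ℂ := (1 / 2 : ℂ) • (1 + σ • pauliZ)

theorem pauliZ_mul_pauliZProj {σ : ℂ} (hσ : σ * σ = 1) :
    pauliZ * pauliZProj σ = σ • pauliZProj σ := by
  rw [pauliZProj, mul_smul_comm, mul_add, mul_one, mul_smul_comm, pauliZ_mul_self]
  linear_combination (norm := module) (-(1 / 2) * hσ) • pauliZ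

theorem pauliZProj_mul_pauliZ {σ : ℂ} (hσ : σ * σ = 1) :
    pauliZProj σ * pauliZ = σ • pauliZProj σ := by
  rw [← pauliZ_mul_pauliZProj hσ]
  simp only [pauliZProj, smul_mul_assoc, mul_smul_comm, add_mul, mul_add, one_mul, mul_one]

theorem pauliZProj_one_add_pauliZProj_neg_one : pauliZProj 1 + pauliZProj (-1) = 1 := by
  simp only [pauliZProj]
  module

theorem mem_resolventSet_freeOp {z : ℂ} (hz : z ∉ gapComplement μ) :
    z ∈ resolventSet (freeOp d μ) := by
  have hσ_pos : (1 : ℂ) * 1 = 1 := one_mul 1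
  have hσ_neg : (-1 : ℂ) * -1 = 1 := by norm_num
  have hz_pos := mul_sub_mem_resolventSet_neg_laplacian (d := d) hσ_pos hz
  have hz_neg := mul_sub_mem_resolventSet_neg_laplacian (d := d) hσ_neg hz
  let P := matrixOp d (pauliZProj 1)
  let Q := matrixOp d (pauliZProj (-1))
  have hadd (f : L2 d C2) : P f + Q f = f := by
    rw [← add_apply, ← map_add, pauliZProj_one_add_pauliZProj_neg_one, map_one, one_apply_eq_self]
  refine ⟨P ∘L resolvent (-laplacian d C2) (1 * z - μ) -
    Q ∘L resolvent (-laplacian d C2) (-1 * z - μ), fun f => ?_, fun u => ?_⟩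
  · obtain ⟨mem_pos, eq_pos⟩ :=
      exists_freeOp_matrixOp_resolvent_eq (pauliZ_mul_pauliZProj hσ_pos) hσ_pos hz_pos f
    obtain ⟨mem_neg, eq_neg⟩ :=
      exists_freeOp_matrixOp_resolvent_eq (pauliZ_mul_pauliZProj hσ_neg) hσ_neg hz_neg f
    refine ⟨(freeOp d μ).domain.sub_mem mem_pos mem_neg, sub_eq_iff_eq_add.2 ?_⟩
    refine ((freeOp d μ).map_sub ⟨_, mem_pos⟩ ⟨_, mem_neg⟩).trans ?_
    rw [eq_pos, eq_neg]
    change _ = f + z • (P (resolvent _ _ f) - Q (resolvent _ _ f))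
    linear_combination (norm := module) hadd f
  · have eq_pos := matrixOp_resolvent_freeOp_sub (pauliZProj_mul_pauliZ hσ_pos) hσ_pos hz_pos u
    have eq_neg := matrixOp_resolvent_freeOp_sub (pauliZProj_mul_pauliZ hσ_neg) hσ_neg hz_neg u
    refine (congrArg₂ (· - ·) eq_pos eq_neg).trans ?_
    rw [one_smul, neg_one_smul, sub_neg_eq_add, hadd]

theorem spectrum_freeOp (hd : 0 < d) : UnboundedOp.spectrum (freeOp d μ) = gapComplement μ :=
  Set.Subset.antisymm (fun _ hz => not_not.1 fun h => hz (mem_resolventSet_freeOp h))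
    fun _ hz => (hasSingularSequence_freeOp hd hz).mem_spectrum

end FreeSpectrum

/-! ### The matrix potential -/

section Potential

variable {d : ℕ} {μ : ℝ} {X U W : Space d → ℝ}

/-- The `j`-th component of a function in `H²(ℝ^d, ℂ²)`. -/
def component (j : Fin 2) : (laplacian d C2).domain →ₗ[ℂ] (laplacian d ℂ).domain :=
  ((EuclideanSpace.proj j : C2 →L[ℂ] ℂ).compLpL 2 volume).toLinearMap.restrict fun f hf =>
    (exists_laplacian_compLpL_eq (EuclideanSpace.proj j) ⟨f, hf⟩).fst

theorem laplacian_component (j : Fin 2) (u : (laplacian d C2).domain) :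
    laplacian d ℂ (component j u) =
      (EuclideanSpace.proj j : C2 →L[ℂ] ℂ).compLpL 2 volume (laplacian d C2 u) :=
  (exists_laplacian_compLpL_eq (EuclideanSpace.proj j) u).snd

/-- Multiplication of the `j`-th component of a function in `H²(ℝ^d, ℂ²)` by `X`; the other
component is replaced by zero. -/
def componentMul (hX : LaplacianCompact X) (j : Fin 2) :
    (laplacian d C2).domain →ₗ[ℂ] L2 d C2 :=
  ((ContinuousLinearMap.toSpanSingleton ℂ (EuclideanSpace.single j 1)).compLpL 2
      volume).toLinearMap ∘ₗ
    (scalarMultiplication X).toFun ∘ₗ Submodule.inclusion hX.fst ∘ₗ component j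

theorem coeFn_componentMul (hX : LaplacianCompact X) (j : Fin 2) (u : (laplacian d C2).domain) :
    componentMul hX j u =ᵐ[volume]
      fun x => ((X x : ℂ) * (u : L2 d C2) x j) • EuclideanSpace.single j 1 := by
  set v := Submodule.inclusion hX.fst (component j u)
  let e : C2 := EuclideanSpace.single j 1
  filter_upwards [(ContinuousLinearMap.toSpanSingleton ℂ e).coeFn_compLpL
    (scalarMultiplication X v), coeFn_scalarMultiplication X v,
    (EuclideanSpace.proj j : C2 →L[ℂ] ℂ).coeFn_compLpL (u : L2 d C2)] with x he hX hproj
  refine he.trans ?_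
  rw [ContinuousLinearMap.toSpanSingleton_apply, hX]
  exact congrArg (fun c : ℂ => ((X x : ℂ) * c) • e) hproj

theorem isGraphCompact_componentMul (hX : LaplacianCompact X) (j : Fin 2) :
    IsGraphCompact (freeOp d μ) (componentMul hX j) := by
  rintro u ⟨C, hC⟩
  set π : L2 d C2 →L[ℂ] L2 d ℂ := (EuclideanSpace.proj j : C2 →L[ℂ] ℂ).compLpL 2 volume
  have norm_laplacian_u (n : ℕ) :
      ‖laplacian d C2 (u n)‖ ≤ ‖matrixOp d pauliZ‖ * C + |μ| * C := by
    refine (norm_laplacian_le (u n)).trans ?_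
    gcongr
    exacts [(hC n).2, (hC n).1]
  have norm_neg_laplacian_component (n : ℕ) : ‖(-laplacian d ℂ) (component j (u n))‖ ≤
      ‖π‖ * (‖matrixOp d pauliZ‖ * C + |μ| * C) := by
    rw [LinearPMap.neg_apply, norm_neg]
    refine (congrArg norm (laplacian_component j (u n))).trans_le ?_
    exact π.le_of_opNorm_le_of_le le_rfl (norm_laplacian_u n)
  obtain ⟨y, φ, hφ, hy⟩ := hX.snd (fun n => component j (u n))
    ⟨max (‖π‖ * C) (‖π‖ * (‖matrixOp d pauliZ‖ * C + |μ| * C)), fun n =>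
      ⟨le_max_of_le_left (π.le_of_opNorm_le_of_le le_rfl (hC n).1),
        le_max_of_le_right (norm_neg_laplacian_component n)⟩⟩
  exact ⟨_, φ, hφ, (((ContinuousLinearMap.toSpanSingleton ℂ (EuclideanSpace.single j 1)).compLpL
    2 volume).continuous.tendsto y).comp hy⟩

/-- Multiplication of functions in `H²(ℝ^d, ℂ²)` by `X`. -/
def vectorMul (hX : LaplacianCompact X) : (laplacian d C2).domain →ₗ[ℂ] L2 d C2 :=
  componentMul hX 0 + componentMul hX 1

theorem coeFn_vectorMul (hX : LaplacianCompact X) (u : (laplacian d C2).domain) :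
    vectorMul hX u =ᵐ[volume] fun x => (X x : ℂ) • (u : L2 d C2) x := by
  filter_upwards [coeFn_componentMul hX 0 u, coeFn_componentMul hX 1 u,
    Lp.coeFn_add (componentMul hX 0 u) (componentMul hX 1 u)] with x h₀ h₁ hadd
  refine hadd.trans ?_
  rw [Pi.add_apply, h₀, h₁]
  ext i
  fin_cases i <;> simp

theorem isGraphCompact_vectorMul (hX : LaplacianCompact X) :
    IsGraphCompact (freeOp d μ) (vectorMul hX) :=
  (isGraphCompact_componentMul hX 0).add (isGraphCompact_componentMul hX 1)

theorem vectorMul_matrixOp (hX : LaplacianCompact X) (M : Matrix (Fin 2) (Fin 2) ℂ)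
    (u : (laplacian d C2).domain) (hMu : matrixOp d M u ∈ (laplacian d C2).domain) :
    vectorMul hX ⟨matrixOp d M u, hMu⟩ = matrixOp d M (vectorMul hX u) := by
  apply Lp.ext
  filter_upwards [coeFn_vectorMul hX ⟨matrixOp d M u, hMu⟩, coeFn_vectorMul hX u,
    coeFn_matrixOp M u, coeFn_matrixOp M (vectorMul hX u)] with x hXMu hXu hMu hMXu
  rw [hXMu, hMu, hMXu, hXu, map_smul]

theorem inner_vectorMul_left (hX : LaplacianCompact X) (u v : (laplacian d C2).domain) :
    ⟪vectorMul hX u, (v : L2 d C2)⟫_ℂ = ⟪(u : L2 d C2), vectorMul hX v⟫_ℂ := by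
  rw [L2.inner_def, L2.inner_def]
  refine integral_congr_ae ?_
  filter_upwards [coeFn_vectorMul hX u, coeFn_vectorMul hX v] with x hu hv
  rw [hu, hv, inner_smul_left, inner_smul_right, Complex.conj_ofReal]

/-- The matrix potential on `H²(ℝ^d, ℂ²)`, written as `σ₃ U + σ₃ σ₁ W`. -/
def potentialH2 (hU : LaplacianCompact U) (hW : LaplacianCompact W) :
    (laplacian d C2).domain →ₗ[ℂ] L2 d C2 :=
  (matrixOp d pauliZ).toLinearMap ∘ₗ
    (vectorMul hU + (matrixOp d pauliX).toLinearMap ∘ₗ vectorMul hW)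

variable (hU : LaplacianCompact U) (hW : LaplacianCompact W)

theorem potentialH2_apply (u : (laplacian d C2).domain) : potentialH2 hU hW u =
    matrixOp d pauliZ (vectorMul hU u + matrixOp d pauliX (vectorMul hW u)) := rfl

theorem isGraphCompact_potentialH2 : IsGraphCompact (freeOp d μ) (potentialH2 hU hW) :=
  ((isGraphCompact_vectorMul hU).add ((isGraphCompact_vectorMul hW).clm_comp _)).clm_comp _

theorem coeFn_potentialH2 (u : (laplacian d C2).domain) : potentialH2 hU hW u =ᵐ[volume]
    fun x => matrixCLM !![(U x : ℂ), (W x : ℂ); -(W x : ℂ), -(U x : ℂ)] ((u : L2 d C2) x) := by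
  set f := vectorMul hU u
  set g := vectorMul hW u
  filter_upwards [coeFn_matrixOp pauliZ (f + matrixOp d pauliX g),
    Lp.coeFn_add f (matrixOp d pauliX g), coeFn_matrixOp pauliX g, coeFn_vectorMul hU u,
    coeFn_vectorMul hW u] with x hZ hadd hX hf hg
  rw [potentialH2_apply, hZ, hadd, Pi.add_apply, hX, hf, hg]
  ext i
  fin_cases i
  · simp [matrixCLM_apply, pauliZ, pauliX]
  · simp [matrixCLM_apply, pauliZ, pauliX]
    ring

theorem laplacian_domain_le (hU : LaplacianCompact U) (hW : LaplacianCompact W) :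
    (laplacian d C2).domain ≤ (potential U W).domain := fun u hu =>
  (Lp.memLp (potentialH2 hU hW ⟨u, hu⟩)).ae_eq (coeFn_potentialH2 hU hW ⟨u, hu⟩)

theorem fullOp_eq_perturb : fullOp μ U W = perturb (freeOp d μ) (potentialH2 hU hW) := by
  refine LinearPMap.ext (inf_eq_left.2 (laplacian_domain_le hU hW)) fun u hu hu' => ?_
  refine congrArg (freeOp d μ ⟨u, hu'⟩ + ·) (Lp.ext ?_)
  exact (mem_multiplicationDomain _ _).coeFn_toLp.trans (coeFn_potentialH2 hU hW ⟨u, hu'⟩).symm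

end Potential

/-! ### Symmetries of the full operator -/

section Symmetry

open scoped LinearPMap

variable {d : ℕ} {μ : ℝ} {U W : Space d → ℝ}

theorem inner_pauliZ_freeOp_left (u v : (freeOp d μ).domain) :
    ⟪matrixOp d pauliZ (freeOp d μ u), (v : L2 d C2)⟫_ℂ =
      ⟪(u : L2 d C2), matrixOp d pauliZ (freeOp d μ v)⟫_ℂ := by
  rw [freeOp_apply, freeOp_apply, matrixOp_involutive pauliZ_mul_self,
    matrixOp_involutive pauliZ_mul_self, inner_add_left, inner_add_right, inner_neg_left,
    inner_neg_right, inner_smul_left, inner_smul_right, Complex.conj_ofReal]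
  congr 2
  exact isFormalAdjoint_laplacian u v

variable (hU : LaplacianCompact U) (hW : LaplacianCompact W)

theorem inner_pauliZ_potentialH2_left (u v : (laplacian d C2).domain) :
    ⟪matrixOp d pauliZ (potentialH2 hU hW u), (v : L2 d C2)⟫_ℂ =
      ⟪(u : L2 d C2), matrixOp d pauliZ (potentialH2 hU hW v)⟫_ℂ := by
  obtain ⟨hv, -⟩ := exists_laplacian_compLpL_eq (matrixCLM pauliX) v
  rw [potentialH2_apply, potentialH2_apply, matrixOp_involutive pauliZ_mul_self,
    matrixOp_involutive pauliZ_mul_self, inner_add_left, inner_add_right,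
    inner_vectorMul_left hU, inner_matrixOp_left, conjTranspose_pauliX,
    ← vectorMul_matrixOp hW pauliX v hv]
  exact congrArg _ (inner_vectorMul_left hW u ⟨_, hv⟩)

theorem isFormalAdjoint_conjugate_pauliZ :
    (conjugate (matrixOp d pauliZ) (perturb (freeOp d μ) (potentialH2 hU hW))).IsFormalAdjoint
      (perturb (freeOp d μ) (potentialH2 hU hW)) := by
  refine isFormalAdjoint_conjugate (matrixOp_involutive pauliZ_mul_self)
    (fun f g => by rw [inner_matrixOp_left, conjTranspose_pauliZ])
    fun (u v : (freeOp d μ).domain) => ?_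
  change ⟪matrixOp d pauliZ (freeOp d μ u + potentialH2 hU hW u), (v : L2 d C2)⟫_ℂ =
    ⟪(u : L2 d C2), matrixOp d pauliZ (freeOp d μ v + potentialH2 hU hW v)⟫_ℂ
  rw [map_add, map_add, inner_add_left, inner_add_right, inner_pauliZ_freeOp_left]
  exact congrArg _ (inner_pauliZ_potentialH2_left hU hW u v)

theorem potentialH2_matrixOp_pauliX (u : (laplacian d C2).domain)
    (hu : matrixOp d pauliX u ∈ (laplacian d C2).domain) :
    potentialH2 hU hW ⟨matrixOp d pauliX u, hu⟩ = -matrixOp d pauliX (potentialH2 hU hW u) := by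
  rw [potentialH2_apply, potentialH2_apply, vectorMul_matrixOp, vectorMul_matrixOp, ← map_add,
    ← mul_apply_eq_comp, ← map_mul, pauliZ_mul_pauliX, map_neg, map_mul, neg_apply,
    mul_apply_eq_comp]

theorem conjugate_pauliX :
    conjugate (matrixOp d pauliX) (perturb (freeOp d μ) (potentialH2 hU hW)) =
      -perturb (freeOp d μ) (potentialH2 hU hW) := by
  refine conjugate_eq_neg (matrixOp_involutive pauliX_mul_self)
    fun (u : (freeOp d μ).domain) => ?_
  obtain ⟨hu, -⟩ := exists_freeOp_matrixOp_eq pauliX u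
  refine ⟨hu, ?_⟩
  change freeOp d μ ⟨_, hu⟩ + potentialH2 hU hW ⟨_, hu⟩ =
    -matrixOp d pauliX (freeOp d μ u + potentialH2 hU hW u)
  rw [freeOp_matrixOp_pauliX, map_add, neg_add]
  exact congrArg _ (potentialH2_matrixOp_pauliX hU hW u hu)

end Symmetry

/-! ### Spectral consequences -/

section FreeSpectrum

variable {d : ℕ} {μ : ℝ}

theorem conj_eq_of_mem_spectrum_freeOp {z : ℂ} (hz : z ∈ UnboundedOp.spectrum (freeOp d μ)) :
    conj z = z :=
  conj_eq_of_mem_gapComplement (not_not.1 fun h => hz (mem_resolventSet_freeOp h))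

theorem isPreconnected_resolventSet_freeOp (hd : 0 < d) (hμ : 0 < μ) :
    IsPreconnected (resolventSet (freeOp d μ)) := by
  rw [← compl_compl (resolventSet (freeOp d μ)), ← UnboundedOp.spectrum, spectrum_freeOp hd]
  exact isPreconnected_compl_gapComplement hμ

end FreeSpectrum

section FullSpectrum

open scoped LinearPMap

variable {d : ℕ} {μ : ℝ} {U W : Space d → ℝ} {z : ℂ}
  (hU : LaplacianCompact U) (hW : LaplacianCompact W)

include hU hW

theorem essentialSpectrum_fullOp (hd : 0 < d) (hμ : 0 < μ) (j : Fin 5) :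
    essentialSpectrum (fullOp μ U W) j = gapComplement μ := by
  rw [fullOp_eq_perturb hU hW, ← spectrum_freeOp hd]
  exact essentialSpectrum_perturb (isGraphCompact_potentialH2 hU hW) dense_laplacian_domain
    isFormalAdjoint_freeOp (fun _ => conj_eq_of_mem_spectrum_freeOp)
    (isPreconnected_resolventSet_freeOp hd hμ)
    (fun z hz => hasSingularSequence_freeOp hd (spectrum_freeOp hd ▸ hz))
    (matrixOp_involutive pauliZ_mul_self) (isFormalAdjoint_conjugate_pauliZ hU hW) j

theorem eventually_mem_resolventSet_fullOp (hd : 0 < d) (hμ : 0 < μ) (hz : z ∉ gapComplement μ) :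
    ∀ᶠ w in 𝓝[≠] z, w ∈ resolventSet (fullOp μ U W) := by
  rw [fullOp_eq_perturb hU hW]
  exact eventually_mem_resolventSet_perturb (isGraphCompact_potentialH2 hU hW)
    dense_laplacian_domain isFormalAdjoint_freeOp (fun _ => conj_eq_of_mem_spectrum_freeOp)
    (isPreconnected_resolventSet_freeOp hd hμ) (mem_resolventSet_freeOp hz)

theorem isEigenvalue_fullOp (hz : z ∈ UnboundedOp.spectrum (fullOp μ U W))
    (hz_gap : z ∉ gapComplement μ) : IsEigenvalue (fullOp μ U W) z := by
  rw [fullOp_eq_perturb hU hW] at hz ⊢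
  exact ((isGraphCompact_potentialH2 hU hW).isFredholmPoint
    (mem_resolventSet_freeOp hz_gap)).isEigenvalue hz

theorem hasFiniteAlgebraicMultiplicity_fullOp (hd : 0 < d) (hμ : 0 < μ)
    (hz : z ∉ gapComplement μ) : HasFiniteAlgebraicMultiplicity (fullOp μ U W) z := by
  rw [fullOp_eq_perturb hU hW]
  exact hasFiniteAlgebraicMultiplicity_perturb (isGraphCompact_potentialH2 hU hW)
    dense_laplacian_domain isFormalAdjoint_freeOp (fun _ => conj_eq_of_mem_spectrum_freeOp)
    (isPreconnected_resolventSet_freeOp hd hμ) (mem_resolventSet_freeOp hz)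

theorem spectrum_fullOp_eq_neg :
    UnboundedOp.spectrum (fullOp μ U W) = -UnboundedOp.spectrum (fullOp μ U W) := by
  rw [← spectrum_neg, fullOp_eq_perturb hU hW, ← conjugate_pauliX hU hW,
    spectrum_conjugate (matrixOp_involutive pauliX_mul_self)]

theorem spectrum_adjoint_fullOp :
    UnboundedOp.spectrum (fullOp μ U W)† = UnboundedOp.spectrum (fullOp μ U W) := by
  rw [fullOp_eq_perturb hU hW, adjoint_perturb_eq_conjugate (isGraphCompact_potentialH2 hU hW)
    dense_laplacian_domain isFormalAdjoint_freeOp (fun _ => conj_eq_of_mem_spectrum_freeOp)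
    (matrixOp_involutive pauliZ_mul_self) (isFormalAdjoint_conjugate_pauliZ hU hW),
    spectrum_conjugate (matrixOp_involutive pauliZ_mul_self)]

theorem conj_mem_spectrum_fullOp (hz : z ∈ UnboundedOp.spectrum (fullOp μ U W)) :
    conj z ∈ UnboundedOp.spectrum (fullOp μ U W) := by
  rw [fullOp_eq_perturb hU hW] at hz ⊢
  exact conj_mem_spectrum_perturb (isGraphCompact_potentialH2 hU hW)
    (fun _ => conj_eq_of_mem_spectrum_freeOp) (matrixOp_involutive pauliZ_mul_self)
    (isFormalAdjoint_conjugate_pauliZ hU hW) hz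

end FullSpectrum

end

end MatrixSchrodinger

open MatrixSchrodinger UnboundedOp MeasureTheory Filter Topology in
open scoped Pointwise LinearPMap ComplexConjugate in
theorem theorem1 (d : ℕ) (hd : 0 < d) (μ : ℝ) (hμ : 0 < μ) :
    (∀ X : Space d → ℝ, AEStronglyMeasurable X volume →
      LaplacianBoundedZero X → DecaysAtInfinity X → LaplacianCompact X) ∧
    ∀ U W : Space d → ℝ, AEStronglyMeasurable U volume → AEStronglyMeasurable W volume →
      LaplacianCompact U → LaplacianCompact W →
      UnboundedOp.spectrum (freeOp d μ) = gapComplement μ ∧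
      (∀ j : Fin 5, essentialSpectrum (fullOp μ U W) j = gapComplement μ) ∧
      (∀ z ∉ gapComplement μ, ∀ᶠ w in 𝓝[≠] z, w ∉ UnboundedOp.spectrum (fullOp μ U W)) ∧
      (∀ z ∈ UnboundedOp.spectrum (fullOp μ U W) \ gapComplement μ,
        IsEigenvalue (fullOp μ U W) z ∧ HasFiniteAlgebraicMultiplicity (fullOp μ U W) z) ∧
      UnboundedOp.spectrum (fullOp μ U W) = -UnboundedOp.spectrum (fullOp μ U W) ∧
      UnboundedOp.spectrum (fullOp μ U W)† = UnboundedOp.spectrum (fullOp μ U W) ∧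
      (∀ z ∈ UnboundedOp.spectrum (fullOp μ U W),
        conj z ∈ UnboundedOp.spectrum (fullOp μ U W) ∧
        -conj z ∈ UnboundedOp.spectrum (fullOp μ U W)) := by
  refine ⟨fun X hX hbound hdecay => laplacianCompact_of_decaysAtInfinity hX hbound hdecay,
    fun U W _ _ hU hW => ⟨spectrum_freeOp hd, essentialSpectrum_fullOp hU hW hd hμ,
      fun z hz => ?_, fun z hz => ⟨?_, ?_⟩, spectrum_fullOp_eq_neg hU hW,
      spectrum_adjoint_fullOp hU hW, fun z hz => ⟨?_, ?_⟩⟩⟩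
  · filter_upwards [eventually_mem_resolventSet_fullOp hU hW hd hμ hz] with w hw
    exact not_not.2 hw
  · exact isEigenvalue_fullOp hU hW hz.1 hz.2
  · exact hasFiniteAlgebraicMultiplicity_fullOp hU hW hd hμ hz.2
  · exact conj_mem_spectrum_fullOp hU hW hz
  · rw [spectrum_fullOp_eq_neg hU hW, Set.neg_mem_neg]
    exact conj_mem_spectrum_fullOp hU hW hz
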